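/- Let $m,n\ge 0$, $L\ge 1$, and let $w_1=w_1(0)\cdots w_1(L-1)$ and $w_2=w_2(0)\cdots w_2(L-1)$ be cyclically reduced words of the same length $L$ in the standard generators (and their inverses) of the free groups $\mathbb F_m$ and $\mathbb F_n$; indices are taken modulo $L$. Let $$G=\langle \mathbb F_m,\mathbb F_n \mid w_1=w_2\rangle .$$ Let $R_1,R_2$ be the roses with one vertex and $m$, respectively $n$, petals, let $A$ be the annulus obtained from a $2\times L$ square grid by identifying top and bottom, and let $X$ be the square complex obtained by attaching the left-hand boundary of $A$ to $R_1$ along $w_1$ and the right-hand boundary of $A$ to $R_2$ along $w_2$. For $k\in\mathbb Z/L$ let $e_k$ be the horizontal edge in the left-hand column of $A$ that starts between the letters $w_1(k-1)$ and $w_1(k)$, oriented from left to right; these are the edges dual to the hyperplane $H$ that runs down the left-hand column. Let $i\neq j$ and let $X'$ be obtained from $X$ by gluing together the oriented edges $e_i$ and $e_j$. Assume that $G$ is one-ended, and that $$\{w_1(i),\,w_1(i-1)^{-1}\}\cap\{w_1(j),\,w_1(j-1)^{-1}\}=\emptyset .$$ Then: 1. $X'$ is non-positively curved, and its universal cover $\tilde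 X'$ is a CAT(0) cube complex. 2. $\tilde X'$ is essential: no halfspace $\mathfrak h$ is contained in a bounded neighbourhood of the complementary halfspace. (Halfspaces are sets of vertices, and distances are taken in the 1-skeleton.) 3. $\tilde X'$ contains a halfspace $\mathfrak h$ whose induced subgraph in the 1-skeleton has infinitely many ends. 4. $\tilde X'$ is locally finite and one-ended, and $G$ acts on it as the full group of deck transformations of $\tilde X'\to X'$ (in particular $\pi_1(X')\cong G$); this action is proper and cocompact. Moreover, there exist $m,n,L,w_1,w_2,i,j$ that satisfy all the assumptions. Hence there is a one-ended group $G$ acting properly and cocompactly on a one-ended, locally finite, essential CAT(0) cube complex that has an infinite-ended halfspace. -/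

import Mathlib

/-! ### Square complexes -/

/-- A square complex, given combinatorially: vertices `V`, edges `E` (each with a reference
orientation), squares `S`, each square attached along a closed edge path of length four.
An oriented edge is a pair `(e, b)`: `(e, true)` is `e` with its reference orientation and
`(e, false)` is `e` reversed. Loops, multiple edges and non-embedded squares are allowed. -/
structure SquareComplex where
  V : Type
  E : Type
  S : Type
  src : E → V
  tgt : E → V
  /-- the `k`-th oriented edge of the boundary path of a square -/
  bdry : S → Fin 4 → E × Bool
  bdry_closed : ∀ s k,
    cond (bdry s k).2 (tgt (bdry s k).1) (src (bdry s k).1) =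
      cond (bdry s (k + 1)).2 (src (bdry s (k + 1)).1) (tgt (bdry s (k + 1)).1)

namespace SquareComplex

variable (X : SquareComplex)

/-- Oriented edges. -/
abbrev Dart : Type := X.E × Bool

variable {X}

/-- The initial vertex of an oriented edge. -/
def dsrc (d : X.Dart) : X.V := cond d.2 (X.src d.1) (X.tgt d.1)

/-- The terminal vertex of an oriented edge. -/
def dtgt (d : X.Dart) : X.V := cond d.2 (X.tgt d.1) (X.src d.1)

/-- The reversed oriented edge. -/
def drev (d : X.Dart) : X.Dart := (d.1, !d.2)

theorem dsrc_drev (d : X.Dart) : dsrc (drev d) = dtgt d := by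
  rcases d with ⟨e, _ | _⟩ <;> rfl

theorem dtgt_drev (d : X.Dart) : dtgt (drev d) = dsrc d := by
  rcases d with ⟨e, _ | _⟩ <;> rfl

theorem dtgt_bdry (s : X.S) (k : Fin 4) : dtgt (X.bdry s k) = dsrc (X.bdry s (k + 1)) :=
  X.bdry_closed s k

/-! ### Edge paths, homotopy, simple connectivity -/

/-- The list of oriented edges `l` is an edge path from `u` to `v`. -/
def IsPath : X.V → List X.Dart → X.V → Prop
  | u, [], v => u = v
  | u, d :: l, v => dsrc d = u ∧ IsPath (dtgt d) l v

variable (X) in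
/-- Edge paths from `u` to `v`. -/
def Path (u v : X.V) : Type := {l : List X.Dart // IsPath u l v}

variable (X) in
/-- Elementary homotopies: inserting a backtrack, or the boundary path of a square. -/
inductive HomotopyStep : List X.Dart → List X.Dart → Prop
  | backtrack (l₁ l₂ : List X.Dart) (d : X.Dart) :
      HomotopyStep (l₁ ++ l₂) (l₁ ++ d :: drev d :: l₂)
  | square (l₁ l₂ : List X.Dart) (s : X.S) :
      HomotopyStep (l₁ ++ l₂)
        (l₁ ++ X.bdry s 0 :: X.bdry s 1 :: X.bdry s 2 :: X.bdry s 3 :: l₂)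

/-- One elementary homotopy between edge paths with the same endpoints. -/
def Path.Step {u v : X.V} (p q : X.Path u v) : Prop := X.HomotopyStep p.1 q.1

/-- Homotopy of edge paths relative to their endpoints. -/
def Path.Homotopic {u v : X.V} (p q : X.Path u v) : Prop := Relation.EqvGen Path.Step p q

/-- The constant edge path. -/
def Path.nil (v : X.V) : X.Path v v := ⟨[], rfl⟩

variable (X) in
def Connected : Prop := Nonempty X.V ∧ ∀ u v : X.V, Nonempty (X.Path u v)

variable (X) in
/-- Connected, and every closed edge path is null-homotopic. -/
def SimplyConnected : Prop :=
  X.Connected ∧ ∀ (v : X.V) (p : X.Path v v), p.Homotopic (Path.nil v)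

/-! ### Links, non-positive curvature, CAT(0) -/

/-- The corner of the square `c.1` at the initial vertex of its `c.2`-th boundary edge is an
edge of the link of that vertex, joining the two oriented edges that leave the corner along the
boundary of the square. Here `CornerJoins c d d'` says that these two are `d` and `d'`. -/
def CornerJoins (c : X.S × Fin 4) (d d' : X.Dart) : Prop :=
  (X.bdry c.1 c.2 = d ∧ drev (X.bdry c.1 (c.2 - 1)) = d') ∨
    (X.bdry c.1 c.2 = d' ∧ drev (X.bdry c.1 (c.2 - 1)) = d)

variable (X) in
/-- Gromov's link condition for a square complex: the link of every vertex (its vertices are the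
oriented edges that start there, its edges are the corners there) is a flag simplicial complex,
that is, a graph without loops, without double edges and without triangles. -/
def NonpositivelyCurved : Prop :=
  (∀ c : X.S × Fin 4, ∀ d : X.Dart, ¬ CornerJoins c d d) ∧
  (∀ c c' : X.S × Fin 4, ∀ d d' : X.Dart, CornerJoins c d d' → CornerJoins c' d d' → c = c') ∧
  ¬ ∃ (c₁ c₂ c₃ : X.S × Fin 4) (d₁ d₂ d₃ : X.Dart),
    CornerJoins c₁ d₁ d₂ ∧ CornerJoins c₂ d₂ d₃ ∧ CornerJoins c₃ d₃ d₁

variable (X) in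
/-- A CAT(0) square complex: simply connected and non-positively curved. -/
def IsCAT0 : Prop := X.SimplyConnected ∧ X.NonpositivelyCurved

variable (X) in
/-- Every vertex lies in finitely many edges and squares. -/
def LocallyFinite : Prop :=
  ∀ v : X.V, {d : X.Dart | dsrc d = v}.Finite ∧ {c : X.S × Fin 4 | dsrc (X.bdry c.1 c.2) = v}.Finite

variable (X) in
/-- The 1-skeleton; its path metric is the combinatorial metric on the vertex set. -/
def skeleton : SimpleGraph X.V := SimpleGraph.fromRel fun u v => ∃ e, X.src e = u ∧ X.tgt e = v

/-! ### Hyperplanes, halfspaces, essentiality -/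

/-- Two edges are dual to the same hyperplane: the equivalence relation generated by being
opposite edges of a square. -/
def Parallel (e e' : X.E) : Prop :=
  Relation.EqvGen (fun a b => ∃ (s : X.S) (k : Fin 4),
    (X.bdry s k).1 = a ∧ (X.bdry s (k + 2)).1 = b) e e'

/-- The vertices on the same side as the terminal vertex of `d` of the hyperplane dual to `d`:
those that are joined to this terminal vertex by an edge path that does not cross the
hyperplane. -/
def side (d : X.Dart) : Set X.V :=
  {v | ∃ l : List X.Dart, IsPath (dtgt d) l v ∧ ∀ d' ∈ l, ¬ Parallel d.1 d'.1}

/-- Halfspaces, as sets of vertices. -/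
def IsHalfspace (h : Set X.V) : Prop := ∃ d : X.Dart, h = side d

/-- A halfspace is deep if it is not contained in a bounded neighbourhood of the complementary
halfspace. -/
def IsDeep (h : Set X.V) : Prop :=
  ¬ ∃ R : ℕ, ∀ v ∈ h, ∃ u ∈ hᶜ, X.skeleton.edist u v ≤ (R : ℕ∞)

variable (X) in
/-- All halfspaces are deep. -/
def Essential : Prop := ∀ h : Set X.V, IsHalfspace h → IsDeep h

end SquareComplex

/-! ### Ends -/

/-- Exactly one end. -/
def SimpleGraph.OneEnded {V : Type} (Γ : SimpleGraph V) : Prop := ∃! ε, ε ∈ Γ.end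

/-- Infinitely many ends. -/
def SimpleGraph.InfiniteEnded {V : Type} (Γ : SimpleGraph V) : Prop := Γ.end.Infinite

/-- A one-ended group: finitely generated, with one-ended Cayley graph. (The number of ends does
not depend on the finite generating set.) -/
def IsOneEndedGroup (G : Type) [Group G] : Prop :=
  ∃ T : Set G, T.Finite ∧ Subgroup.closure T = ⊤ ∧ (SimpleGraph.mulCayley T).OneEnded

namespace SquareComplex

/-! ### The universal cover -/

section Cover

variable (X : SquareComplex) (x : X.V)

/-- Vertices of the universal cover: homotopy classes of edge paths that start at `x`. The first
component is the terminal vertex of the path. -/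
def CoverVertex : Type := Σ v : X.V, Quot (fun p q : X.Path x v => p.Step q)

variable {X x}

theorem IsPath.snoc {u v : X.V} {l : List X.Dart} (hl : IsPath u l v) (d : X.Dart)
    (h : dsrc d = v) : IsPath u (l ++ [d]) (dtgt d) := by
  induction l generalizing u with
  | nil => exact ⟨h.trans (Eq.symm hl), rfl⟩
  | cons a l ih => exact ⟨hl.1, ih hl.2⟩

theorem HomotopyStep.snoc {l l' : List X.Dart} (h : X.HomotopyStep l l') (d : X.Dart) :
    X.HomotopyStep (l ++ [d]) (l' ++ [d]) := by
  cases h with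
  | backtrack l₁ l₂ a => simpa using HomotopyStep.backtrack l₁ (l₂ ++ [d]) a
  | square l₁ l₂ s => simpa using HomotopyStep.square l₁ (l₂ ++ [d]) s

/-- Append an oriented edge to a homotopy class of paths. -/
def CoverVertex.move (q : X.CoverVertex x) (d : X.Dart) (h : dsrc d = q.1) : X.CoverVertex x :=
  ⟨dtgt d, Quot.map (fun p => ⟨p.1 ++ [d], p.2.snoc d h⟩) (fun _ _ hp => hp.snoc d) q.2⟩

theorem CoverVertex.mk_eq {v v' : X.V} (p : X.Path x v) (p' : X.Path x v') (hv : v = v')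
    (h : X.HomotopyStep p.1 p'.1) :
    (⟨v', Quot.mk _ p'⟩ : X.CoverVertex x) = ⟨v, Quot.mk _ p⟩ := by
  subst hv
  have hs : p.Step p' := h
  exact congrArg (Sigma.mk v) (Quot.sound hs).symm

theorem CoverVertex.move_move_drev (q : X.CoverVertex x) (d : X.Dart) (h : dsrc d = q.1) :
    (q.move d h).move (drev d) (dsrc_drev d) = q := by
  obtain ⟨v, p⟩ := q
  induction p using Quot.ind with
  | _ p =>
    refine CoverVertex.mk_eq p _ (h.symm.trans (dtgt_drev d).symm) ?_
    simpa using HomotopyStep.backtrack p.1 [] d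

/-- The corner of the lifted square at which its `k`-th boundary edge starts, for a lift of the
square `s` whose `0`-th corner is `q`. -/
def liftCorner (q : X.CoverVertex x) (s : X.S) (h : dsrc (X.bdry s 0) = q.1) :
    (k : Fin 4) → {r : X.CoverVertex x // dsrc (X.bdry s k) = r.1}
  | 0 => ⟨q, h⟩
  | 1 => ⟨q.move (X.bdry s 0) h, (dtgt_bdry s 0).symm⟩
  | 2 => ⟨(q.move (X.bdry s 0) h).move (X.bdry s 1) (dtgt_bdry s 0).symm, (dtgt_bdry s 1).symm⟩
  | 3 => ⟨((q.move (X.bdry s 0) h).move (X.bdry s 1) (dtgt_bdry s 0).symm).move (X.bdry s 2)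
      (dtgt_bdry s 1).symm, (dtgt_bdry s 2).symm⟩

theorem liftCorner_succ (q : X.CoverVertex x) (s : X.S) (h : dsrc (X.bdry s 0) = q.1)
    (k : Fin 4) :
    (liftCorner q s h k).1.move (X.bdry s k) (liftCorner q s h k).2 =
      (liftCorner q s h (k + 1)).1 := by
  fin_cases k
  · rfl
  · rfl
  · rfl
  · obtain ⟨v, p⟩ := q
    induction p using Quot.ind with
    | _ p =>
      refine CoverVertex.mk_eq p _ (h.symm.trans (dtgt_bdry s 3).symm) ?_
      simpa using HomotopyStep.square p.1 [] s

variable (X x) in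
/-- Edges of the universal cover: an edge of `X` together with a lift of its initial vertex. -/
def CoverEdge : Type := {q : X.CoverVertex x × X.E // X.src q.2 = q.1.1}

variable (X x) in
/-- Squares of the universal cover: a square of `X` together with a lift of its `0`-th corner. -/
def CoverSquare : Type := {q : X.CoverVertex x × X.S // dsrc (X.bdry q.2 0) = q.1.1}

/-- The lift of the oriented edge `d` that starts at `q`. -/
def liftDart (q : X.CoverVertex x) : (d : X.Dart) → dsrc d = q.1 → X.CoverEdge x × Bool
  | (e, true), h => (⟨(q, e), h⟩, true)
  | (e, false), h => (⟨(q.move (e, false) h, e), rfl⟩, false)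

/-- The initial vertex of an edge of the universal cover. -/
def coverSrc (a : X.CoverEdge x) : X.CoverVertex x := a.1.1

/-- The terminal vertex of an edge of the universal cover. -/
def coverTgt (a : X.CoverEdge x) : X.CoverVertex x := a.1.1.move (a.1.2, true) a.2

theorem liftDart_src (q : X.CoverVertex x) (d : X.Dart) (h : dsrc d = q.1) :
    cond (liftDart q d h).2 (coverSrc (liftDart q d h).1) (coverTgt (liftDart q d h).1) = q := by
  rcases d with ⟨e, _ | _⟩
  · exact CoverVertex.move_move_drev q (e, false) h
  · rfl

theorem liftDart_tgt (q : X.CoverVertex x) (d : X.Dart) (h : dsrc d = q.1) :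
    cond (liftDart q d h).2 (coverTgt (liftDart q d h).1) (coverSrc (liftDart q d h).1) =
      q.move d h := by
  rcases d with ⟨e, _ | _⟩ <;> rfl

variable (X x) in
/-- The universal cover of (the connected component of `x` in) `X`. -/
def universalCover : SquareComplex where
  V := X.CoverVertex x
  E := X.CoverEdge x
  S := X.CoverSquare x
  src := coverSrc
  tgt := coverTgt
  bdry t k := liftDart (liftCorner t.1.1 t.1.2 t.2 k).1 (X.bdry t.1.2 k)
    (liftCorner t.1.1 t.1.2 t.2 k).2
  bdry_closed t k := by
    rw [liftDart_tgt, liftDart_src, liftCorner_succ]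

/-- The covering projection on vertices. -/
def projV (v : (X.universalCover x).V) : X.V := Sigma.fst v

/-- The covering projection on edges. -/
def projE (e : (X.universalCover x).E) : X.E := e.1.2

/-- The covering projection on squares. -/
def projS (s : (X.universalCover x).S) : X.S := s.1.2

end Cover

/-! ### Group actions -/

/-- A left action of a group on a square complex by cellular automorphisms that respect the
chosen parametrizations of the cells (as deck transformations do). -/
structure CellularAction (G : Type) [Group G] (X : SquareComplex) where
  onV : G →* Equiv.Perm X.V
  onE : G →* Equiv.Perm X.E
  onS : G →* Equiv.Perm X.S
  map_src : ∀ g e, X.src (onE g e) = onV g (X.src e)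
  map_tgt : ∀ g e, X.tgt (onE g e) = onV g (X.tgt e)
  map_bdry : ∀ g s k, X.bdry (onS g s) k = (onE g (X.bdry s k).1, (X.bdry s k).2)

/-- Finitely many orbits of cells. -/
def CellularAction.Cocompact {G : Type} [Group G] {X : SquareComplex}
    (A : CellularAction G X) : Prop :=
  (∃ T : Set X.V, T.Finite ∧ ∀ v, ∃ t ∈ T, ∃ g, A.onV g t = v) ∧
  (∃ T : Set X.E, T.Finite ∧ ∀ e, ∃ t ∈ T, ∃ g, A.onE g t = e) ∧
  (∃ T : Set X.S, T.Finite ∧ ∀ s, ∃ t ∈ T, ∃ g, A.onS g t = s)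

/-- Finite vertex stabilizers; for locally finite complexes this is properness of the action. -/
def CellularAction.Proper {G : Type} [Group G] {X : SquareComplex}
    (A : CellularAction G X) : Prop :=
  ∀ v, {g : G | A.onV g v = v}.Finite

/-- `G` acts on the universal cover as the full group of deck transformations: the action is
compatible with the projection and simply transitive on the vertices over each vertex of `X`. -/
def CellularAction.IsDeckAction {G : Type} [Group G] {X : SquareComplex} {x : X.V}
    (A : CellularAction G (X.universalCover x)) : Prop :=
  (∀ g v, projV (A.onV g v) = projV v) ∧ (∀ g e, projE (A.onE g e) = projE e) ∧
  (∀ g s, projS (A.onS g s) = projS s) ∧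
  ∀ u v, projV u = projV v → ∃! g, A.onV g u = v

/-! ### Gluing two oriented edges -/

/-- The identification of vertices forced by gluing `a` to `b`. -/
def glueV (X : SquareComplex) (a b : X.E) (u v : X.V) : Prop :=
  (u = X.src a ∧ v = X.src b) ∨ (u = X.tgt a ∧ v = X.tgt b)

/-- The quotient of `X` by gluing together the edges `a` and `b`, with their reference
orientations. -/
def glueEdges (X : SquareComplex) (a b : X.E) : SquareComplex where
  V := Quot (X.glueV a b)
  E := Quot (fun e e' : X.E => e = a ∧ e' = b)
  S := X.S
  src := Quot.map X.src (fun _ _ h => Or.inl ⟨congrArg X.src h.1, congrArg X.src h.2⟩)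
  tgt := Quot.map X.tgt (fun _ _ h => Or.inr ⟨congrArg X.tgt h.1, congrArg X.tgt h.2⟩)
  bdry s k := (Quot.mk _ (X.bdry s k).1, (X.bdry s k).2)
  bdry_closed s k := by
    have h := congrArg (Quot.mk (X.glueV a b)) (X.bdry_closed s k)
    revert h
    generalize X.bdry s k = d
    generalize X.bdry s (k + 1) = d'
    rcases d with ⟨e, _ | _⟩ <;> rcases d' with ⟨e', _ | _⟩ <;> exact id

end SquareComplex

/-! ### The amalgam and its square complexes -/

/-- The cyclic amalgam `⟨F_m, F_n | w₁ = w₂⟩`. A letter `(a, true)` of a word stands for the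
generator `a` and `(a, false)` for its inverse. -/
abbrev CyclicAmalgam {m n L : ℕ} (w₁ : Fin L → Fin m × Bool) (w₂ : Fin L → Fin n × Bool) : Type :=
  PresentedGroup ({FreeGroup.map Sum.inl (FreeGroup.mk (List.ofFn w₁)) *
    (FreeGroup.map Sum.inr (FreeGroup.mk (List.ofFn w₂)))⁻¹} : Set (FreeGroup (Fin m ⊕ Fin n)))

/-- Vertices of `X`: the vertices of the two roses, and the `L` vertices on the core circle of
the annulus. -/
inductive AmalgamVertex (L : ℕ) : Type
  | left : AmalgamVertex L
  | right : AmalgamVertex L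
  | mid (k : Fin L) : AmalgamVertex L

/-- Edges of `X`: the petals of the two roses; for each of the `L` rows of the annulus the
horizontal edges in the left and in the right column; the vertical edges of the core circle. -/
inductive AmalgamEdge (m n L : ℕ) : Type
  | petal₁ (a : Fin m) : AmalgamEdge m n L
  | petal₂ (b : Fin n) : AmalgamEdge m n L
  | rung₁ (k : Fin L) : AmalgamEdge m n L
  | rung₂ (k : Fin L) : AmalgamEdge m n L
  | core (k : Fin L) : AmalgamEdge m n L

/-- Squares of `X`: the left and the right column of the annulus. -/
inductive AmalgamSquare (L : ℕ) : Type
  | sq₁ (k : Fin L) : AmalgamSquare L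
  | sq₂ (k : Fin L) : AmalgamSquare L

open AmalgamVertex AmalgamEdge AmalgamSquare in
/-- The square complex `X`: the annulus obtained from a `2 × L` grid by identifying top and
bottom (rows are indexed cyclically by `Fin L`), attached to the rose with `m` petals along `w₁`
on its left boundary and to the rose with `n` petals along `w₂` on its right boundary. -/
def amalgamComplex {m n L : ℕ} [NeZero L] (w₁ : Fin L → Fin m × Bool) (w₂ : Fin L → Fin n × Bool) :
    SquareComplex where
  V := AmalgamVertex L
  E := AmalgamEdge m n L
  S := AmalgamSquare L
  src
    | petal₁ _ => left
    | petal₂ _ => right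
    | rung₁ _ => left
    | rung₂ k => mid k
    | core k => mid k
  tgt
    | petal₁ _ => left
    | petal₂ _ => right
    | rung₁ k => mid k
    | rung₂ _ => right
    | core k => mid (k + 1)
  bdry
    | sq₁ k => ![(rung₁ k, true), (core k, true), (rung₁ (k + 1), false),
        (petal₁ (w₁ k).1, !(w₁ k).2)]
    | sq₂ k => ![(rung₂ k, true), (petal₂ (w₂ k).1, (w₂ k).2), (rung₂ (k + 1), false),
        (core k, false)]
  bdry_closed s k := by
    rcases s with r | r
    · rcases h : w₁ r with ⟨a, _ | _⟩ <;> fin_cases k <;> simp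
    · rcases h : w₂ r with ⟨a, _ | _⟩ <;> fin_cases k <;> simp

/-- The square complex `X'`, obtained from `X` by gluing together two edges dual to the
hyperplane in the left column of the annulus, both oriented from left to right. -/
def foldedComplex {m n L : ℕ} [NeZero L] (w₁ : Fin L → Fin m × Bool) (w₂ : Fin L → Fin n × Bool)
    (i j : Fin L) : SquareComplex :=
  (amalgamComplex w₁ w₂).glueEdges (AmalgamEdge.rung₁ i) (AmalgamEdge.rung₁ j)

/-- The base vertex of `X'`, the image of the vertex of the left rose. -/
def foldedBase {m n L : ℕ} [NeZero L] (w₁ : Fin L → Fin m × Bool) (w₂ : Fin L → Fin n × Bool)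
    (i j : Fin L) : (foldedComplex w₁ w₂ i j).V :=
  Quot.mk _ AmalgamVertex.left

/-- The two oriented petals of the left rose that leave its vertex along the left boundary of the
annulus in row `k`, upwards and downwards. -/
def rowLetters {m L : ℕ} [NeZero L] (w₁ : Fin L → Fin m × Bool) (k : Fin L) : Set (Fin m × Bool) :=
  {w₁ k, ((w₁ (k - 1)).1, !(w₁ (k - 1)).2)}

/-- The data of the construction: cyclically reduced words of the same length, with one-ended
amalgam, and two distinct edges that are folded, in rows `i` and `j`. The last condition says
that no square at the first edge and square at the second edge share an oriented edge of the left
rose at their corners; otherwise folding would create a double edge in a link. -/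
structure FoldingData {m n L : ℕ} [NeZero L] (w₁ : Fin L → Fin m × Bool)
    (w₂ : Fin L → Fin n × Bool) (i j : Fin L) : Prop where
  reduced₁ : FreeGroup.IsCyclicallyReduced (List.ofFn w₁)
  reduced₂ : FreeGroup.IsCyclicallyReduced (List.ofFn w₂)
  oneEnded : IsOneEndedGroup (CyclicAmalgam w₁ w₂)
  ne : i ≠ j
  disjoint : Disjoint (rowLetters w₁ i) (rowLetters w₁ j)

/-!
The edges of the folded complex `X'` fall into two classes: horizontal ones (the rungs of the
annulus) and vertical ones (petals and core circle). Each square has two opposite sides of either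
class, so links are bipartite, and non-positive curvature only says that links have no double
edges. Cyclic reducedness and the condition on the letters in the rows `i` and `j` rule these out
(`FoldingWords.nonpositivelyCurved`).

*Combinatorial distance.* Let `Z` be simply connected, with such a division of its edges and
without double edges in links. Letting vertical letters sink below horizontal ones across squares,
and cancelling, defines an action of edge paths on words that respects homotopy
(`SwapSystem.push`, `SwapSystem.push_push_rev`, `SwapSystem.push_square`). Each pair of vertices
thus gets a normal form, whose length is their distance. The distance to a fixed vertex `u` splits
the edges into those leading towards `u` and those leading away; two distinct edges leading from a
vertex towards `u` span a square (`IsCAT0VH.cornered_of_toward`), opposite sides of squares lead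
towards the same vertices (`IsCAT0VH.toward_bdry`), and the halfspace of an edge consists of the
vertices towards which it leads (`IsCAT0VH.mem_side_iff`). So rays without turns never come back
(`IsCAT0VH.dist_straight`), and a vertex whose link falls into two pieces separates the vertices
in these directions (`IsCAT0VH.not_joinedOff`).

*The group.* A labelling of the edges of `X'` by elements of `G`, with trivial product around each
square, and a homomorphism from `G` to `π₁(X')` are inverse to each other (`foldedDevelopment`;
any such pair is a `Development`). This gives the action of `G` by deck transformations, and
one-endedness passes between `G` and the universal cover along orbit maps
(`SimpleGraph.ConnectedAtInfinity.map`).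

*Essentiality.* If every edge can be continued without a turn, then every halfspace is deep
(`IsCAT0VH.essential`). In `X'` this could only fail for the folded edge at the left vertex. But
then the two ends of a lift of that edge would separate the universal cover into unbounded pieces,
against one-endedness (`exists_straight_partner`).

*The halfspace with infinitely many ends.* The two vertices of the core circle in the rows `i` and
`j` are identified in `X'`, and the link of the resulting vertex falls into two pieces when the
folded edge is removed (`not_cornered_of_mem_coreStar`). Take the hyperplane of a lift of the
folded edge and the halfspace to the right of it. Along the hyperplane runs a lift of the core
circle, and each of its vertices over the folded vertex is a cut vertex of the halfspace. A ray
that follows this line for `k` turns and then branches off at the folded vertex defines an end,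
and different `k` give different ends (`exists_infiniteEnded_halfspace`).

*Existence.* Both words are the commutator of two generators, `i = 0` and `j = 2`. For
one-endedness of the amalgam it is enough to look at the unfolded complex, which is the case `i =
j` of the construction. Its links are cycles, which stay connected when a clique is removed from
them, so paths can be pushed towards infinity (`IsCAT0VH.connectedAtInfinity_of_links`).
-/

/-! ### Normal forms of words in a two-coloured swap system -/

/-- The combinatorics of oriented edges in a square complex whose edges are divided into horizontal
and vertical ones, such that every square has two opposite horizontal and two opposite vertical
sides. `Swap t d d' t'` says that the paths `t d` and `d' t'`, with `t, t'` horizontal and `d, d'`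
vertical, run around a square from one corner to the opposite one. That `t` and `d` determine the
square is the absence of double edges in links. -/
structure SwapSystem (D : Type) where
  rev : D → D
  hor : D → Prop
  Swap : D → D → D → D → Prop
  rev_rev : ∀ d, rev (rev d) = d
  hor_rev : ∀ d, hor (rev d) ↔ hor d
  swap_hor₁ : ∀ {t d d' t'}, Swap t d d' t' → hor t
  swap_ver₁ : ∀ {t d d' t'}, Swap t d d' t' → ¬ hor d
  swap_ver₂ : ∀ {t d d' t'}, Swap t d d' t' → ¬ hor d'
  swap_hor₂ : ∀ {t d d' t'}, Swap t d d' t' → hor t'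
  swap_undo : ∀ {t d d' t'}, Swap t d d' t' → Swap t' (rev d) (rev d') t
  swap_flip : ∀ {t d d' t'}, Swap t d d' t' → Swap (rev t) d' d (rev t')
  swap_unique : ∀ {t d d' t' e s}, Swap t d d' t' → Swap t d e s → d' = e ∧ t' = s

namespace SwapSystem

variable {D : Type} (W : SwapSystem D)

open Classical in
/-- Right multiplication of a word by the letter `d`. Words are stored as stacks: the head of the
list is the last letter. A vertical letter sinks below horizontal ones as long as squares permit,
and cancels against its inverse. -/
noncomputable def push : List D → D → List D
  | [], d => [d]
  | t :: s, d =>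
    if t = W.rev d then s
    else if h : ∃ p : D × D, W.Swap t d p.1 p.2 then h.choose.2 :: push s h.choose.1
    else d :: t :: s

/-- A stack to which neither cancellation nor sinking applies. -/
def Irreducible (s : List D) : Prop :=
  s.IsChain fun d t => t ≠ W.rev d ∧ ∀ d' t', ¬ W.Swap t d d' t'

variable {W}

theorem rev_injective : Function.Injective W.rev := fun a b h => by
  rw [← W.rev_rev a, h, W.rev_rev]

@[simp] theorem push_nil (d : D) : W.push [] d = [d] := by rw [push]

theorem push_cancel (s : List D) (d : D) : W.push (W.rev d :: s) d = s := by
  rw [push, if_pos rfl]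

theorem push_rev_cancel (s : List D) (d : D) : W.push (d :: s) (W.rev d) = s := by
  rw [push, if_pos (W.rev_rev d).symm]

theorem Swap.ne_rev {t d d' t' : D} (h : W.Swap t d d' t') : t ≠ W.rev d := by
  rintro rfl
  exact W.swap_ver₁ h ((W.hor_rev d).1 (W.swap_hor₁ h))

/-- The value of `push` does not depend on the square that is chosen in its definition. -/
theorem push_swap {t d d' t' : D} (s : List D) (h : W.Swap t d d' t') :
    W.push (t :: s) d = t' :: W.push s d' := by
  have hex : ∃ p : D × D, W.Swap t d p.1 p.2 := ⟨(d', t'), h⟩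
  rw [push, if_neg (Swap.ne_rev h), dif_pos hex]
  obtain ⟨h₁, h₂⟩ := W.swap_unique h hex.choose_spec
  rw [← h₁, ← h₂]

theorem push_cons {t d : D} (s : List D) (h : t ≠ W.rev d)
    (h' : ∀ d' t', ¬ W.Swap t d d' t') : W.push (t :: s) d = d :: t :: s := by
  rw [push, if_neg h, dif_neg]
  rintro ⟨p, hp⟩
  exact h' _ _ hp

/-- The three ways in which a letter can act on a nonempty stack. -/
theorem push_cases (t d : D) (s : List D) :
    (t = W.rev d ∧ W.push (t :: s) d = s) ∨
    (∃ d' t', W.Swap t d d' t' ∧ W.push (t :: s) d = t' :: W.push s d') ∨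
    (t ≠ W.rev d ∧ (∀ d' t', ¬ W.Swap t d d' t') ∧ W.push (t :: s) d = d :: t :: s) := by
  by_cases h : t = W.rev d
  · subst h
    exact Or.inl ⟨rfl, push_cancel s d⟩
  by_cases h' : ∃ d' t', W.Swap t d d' t'
  · obtain ⟨d', t', h'⟩ := h'
    exact Or.inr (Or.inl ⟨d', t', h', push_swap s h'⟩)
  · have h'' : ∀ d' t', ¬ W.Swap t d d' t' := fun d' t' hs => h' ⟨d', t', hs⟩
    exact Or.inr (Or.inr ⟨h, h'', push_cons s h h''⟩)

theorem irreducible_nil : W.Irreducible [] := List.IsChain.nil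

theorem Irreducible.tail {t : D} {s : List D} (h : W.Irreducible (t :: s)) :
    W.Irreducible s := List.IsChain.tail h

theorem irreducible_cons {t : D} {s : List D} :
    W.Irreducible (t :: s) ↔ (∀ u ∈ s.head?, u ≠ W.rev t ∧ ∀ d' t', ¬ W.Swap u t d' t') ∧
      W.Irreducible s := by
  rw [Irreducible, List.isChain_cons]
  rfl

/-- If a letter sinks through the top of a stack and turns it into `t'`, then nothing below can
cancel against `t'`: undoing the swap would make a reduction possible in the original stack. -/
theorem Irreducible.push {s : List D} (hs : W.Irreducible s) (d : D) :
    W.Irreducible (W.push s d) := by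
  induction s generalizing d with
  | nil => simp [Irreducible]
  | cons t s ih =>
    rcases W.push_cases t d s with ⟨-, h⟩ | ⟨d', t', hsw, h⟩ | ⟨h₁, h₂, h⟩
    · rw [h]; exact hs.tail
    · rw [h, irreducible_cons]
      refine ⟨fun u hu => ⟨?_, fun _ _ hsw' => W.swap_ver₁ hsw' (W.swap_hor₂ hsw)⟩,
        ih hs.tail d'⟩
      rintro rfl
      have hrt : W.hor (W.rev t') := (W.hor_rev _).2 (W.swap_hor₂ hsw)
      have hd' := W.swap_ver₂ hsw
      cases s with
      | nil =>
        simp only [push_nil, List.head?_cons, Option.mem_def, Option.some.injEq] at hu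
        exact hd' (hu ▸ hrt)
      | cons u₀ s =>
        rcases W.push_cases u₀ d' s with ⟨h₀, h'⟩ | ⟨d'', u, hsw', h'⟩ | ⟨-, -, h'⟩
        · rw [h'] at hu
          subst h₀
          exact ((irreducible_cons.1 hs.tail).1 _ hu).2 _ _
            (W.swap_flip (W.swap_undo hsw))
        · rw [h'] at hu
          simp only [List.head?_cons, Option.mem_def, Option.some.injEq] at hu
          subst hu
          obtain ⟨-, h₃⟩ := W.swap_unique (W.swap_undo hsw') (W.swap_undo (W.swap_flip hsw))
          exact ((irreducible_cons.1 hs).1 u₀ rfl).1 h₃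
        · rw [h'] at hu
          simp only [List.head?_cons, Option.mem_def, Option.some.injEq] at hu
          exact hd' (hu ▸ hrt)
    · rw [h, irreducible_cons]
      refine ⟨fun u hu => ?_, hs⟩
      simp only [List.head?_cons, Option.mem_def, Option.some.injEq] at hu
      subst hu
      exact ⟨h₁, h₂⟩

/-- Backtracking acts trivially on normal forms. -/
theorem push_push_rev {s : List D} (hs : W.Irreducible s) (d : D) :
    W.push (W.push s d) (W.rev d) = s := by
  induction s generalizing d with
  | nil => rw [push_nil, push_rev_cancel]
  | cons t s ih =>
    rcases W.push_cases t d s with ⟨h₀, h⟩ | ⟨d', t', hsw, h⟩ | ⟨h₁, h₂, h⟩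
    · rw [h, h₀]
      subst h₀
      cases s with
      | nil => rw [push_nil]
      | cons u s =>
        obtain ⟨h₁, h₂⟩ := (irreducible_cons.1 hs).1 u rfl
        exact push_cons s h₁ h₂
    · rw [h, push_swap _ (W.swap_undo hsw), ih hs.tail]
    · rw [h, push_rev_cancel]

theorem push_rev_push {s : List D} (hs : W.Irreducible s) (d : D) :
    W.push (W.push s (W.rev d)) d = s := by
  have := push_push_rev hs (W.rev d)
  rwa [W.rev_rev] at this

/-- Horizontal letters never sink. -/
theorem push_hor_cons {t d : D} (s : List D) (hd : W.hor d) (h : t ≠ W.rev d) :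
    W.push (t :: s) d = d :: t :: s :=
  push_cons s h fun _ _ hsw => W.swap_ver₁ hsw hd

theorem push_hor_of_irreducible_cons {d : D} {s : List D} (hd : W.hor d)
    (h : W.Irreducible (d :: s)) : W.push s d = d :: s := by
  cases s with
  | nil => rw [push_nil]
  | cons t s => exact push_hor_cons s hd ((irreducible_cons.1 h).1 t rfl).1

/-- The two ways around a square act in the same way on normal forms. -/
theorem push_square {s : List D} (hs : W.Irreducible s) {t d d' t' : D}
    (h : W.Swap t d d' t') : W.push (W.push s t) d = W.push (W.push s d') t' := by
  by_cases hc : ∃ s', s = W.rev t :: s'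
  · obtain ⟨s', rfl⟩ := hc
    have h' := W.swap_flip h
    have hirr := hs.push d'
    rw [push_swap _ h'] at hirr ⊢
    rw [push_cancel, push_cancel]
  · have hpush : W.push s t = t :: s := by
      cases s with
      | nil => rw [push_nil]
      | cons u s =>
        refine push_hor_cons s (W.swap_hor₁ h) ?_
        rintro rfl
        exact hc ⟨s, rfl⟩
    have hirr : W.Irreducible (t' :: W.push s d') := by
      rw [← push_swap _ h, ← hpush]
      exact (hs.push t).push d
    rw [hpush, push_swap _ h, push_hor_of_irreducible_cons (W.swap_hor₂ h) hirr]

theorem length_push (s : List D) (d : D) :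
    (W.push s d).length = s.length + 1 ∨ (W.push s d).length + 1 = s.length := by
  induction s generalizing d with
  | nil => simp
  | cons t s ih =>
    rcases W.push_cases t d s with ⟨-, h⟩ | ⟨d', t', -, h⟩ | ⟨-, -, h⟩
    · simp [h]
    · rw [h]
      simpa using ih d'
    · simp [h]

/-- A horizontal letter shortens a stack only by cancelling its top. -/
theorem eq_cons_of_shorter {s : List D} {d : D} (hd : W.hor d)
    (h : (W.push s d).length < s.length) : ∃ s', s = W.rev d :: s' := by
  cases s with
  | nil => simp at h
  | cons t s =>
    rcases W.push_cases t d s with ⟨h₀, -⟩ | ⟨d', t', hsw, -⟩ | ⟨-, -, h'⟩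
    · exact ⟨s, by rw [h₀]⟩
    · exact absurd hd (W.swap_ver₁ hsw)
    · rw [h'] at h
      simp at h

/-- If both edges at a corner of a square shorten a word, then going to the opposite corner of the
square shortens it twice. -/
theorem shorter_of_square {s : List D} {t d d' t' : D} (h : W.Swap t d d' t')
    (h₁ : (W.push s (W.rev t)).length < s.length) (h₂ : (W.push s d).length < s.length) :
    (W.push (W.push s d) (W.rev t')).length < (W.push s d).length := by
  obtain ⟨s', rfl⟩ := eq_cons_of_shorter ((W.hor_rev t).2 (W.swap_hor₁ h)) h₁
  rw [W.rev_rev, push_swap _ h, push_rev_cancel]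
  simp

/-- Two vertical letters that both shorten a word are equal. -/
theorem eq_of_shorter_ver {s : List D} {a b : D} (ha : ¬ W.hor a) (hb : ¬ W.hor b)
    (h₁ : (W.push s a).length < s.length) (h₂ : (W.push s b).length < s.length) : a = b := by
  induction s generalizing a b with
  | nil => simp at h₁
  | cons t s ih =>
    rcases W.push_cases t a s with ⟨ha', ha''⟩ | ⟨a', t₁, hsw₁, ha'⟩ | ⟨-, -, ha'⟩
    · rcases W.push_cases t b s with ⟨hb', hb''⟩ | ⟨b', t₂, hsw₂, hb'⟩ | ⟨-, -, hb'⟩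
      · exact rev_injective (ha'.symm.trans hb')
      · exact absurd ((W.hor_rev a).1 (ha' ▸ W.swap_hor₁ hsw₂)) ha
      · rw [hb'] at h₂
        simp at h₂
    · rcases W.push_cases t b s with ⟨hb', hb''⟩ | ⟨b', t₂, hsw₂, hb'⟩ | ⟨-, -, hb'⟩
      · exact absurd ((W.hor_rev b).1 (hb' ▸ W.swap_hor₁ hsw₁)) hb
      · rw [ha'] at h₁
        rw [hb'] at h₂
        have hab := ih (W.swap_ver₂ hsw₁) (W.swap_ver₂ hsw₂) (by simpa using h₁)
          (by simpa using h₂)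
        subst hab
        exact (W.swap_unique (W.swap_flip hsw₁) (W.swap_flip hsw₂)).1
      · rw [hb'] at h₂
        simp at h₂
    · rw [ha'] at h₁
      simp at h₁

/-- Two distinct letters that both shorten a word span a square. -/
theorem exists_swap_of_shorter {s : List D} {a b : D} (hab : a ≠ b)
    (h₁ : (W.push s a).length < s.length) (h₂ : (W.push s b).length < s.length) :
    (∃ d' t', W.Swap (W.rev a) b d' t') ∨ ∃ d' t', W.Swap (W.rev b) a d' t' := by
  have key : ∀ a b : D, W.hor a → ¬ W.hor b → (W.push s a).length < s.length →
      (W.push s b).length < s.length → ∃ d' t', W.Swap (W.rev a) b d' t' := by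
    intro a b ha hb h₁ h₂
    obtain ⟨s', rfl⟩ := eq_cons_of_shorter ha h₁
    rcases W.push_cases (W.rev a) b s' with ⟨h, -⟩ | ⟨b', t₂, hsw, -⟩ | ⟨-, -, h⟩
    · exact absurd (rev_injective h ▸ ha) hb
    · exact ⟨b', t₂, hsw⟩
    · rw [h] at h₂
      simp at h₂
  by_cases ha : W.hor a <;> by_cases hb : W.hor b
  · obtain ⟨s', h⟩ := eq_cons_of_shorter ha h₁
    obtain ⟨s'', h'⟩ := eq_cons_of_shorter hb h₂
    rw [h, List.cons.injEq] at h'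
    exact absurd (rev_injective h'.1) hab
  · exact Or.inl (key a b ha hb h₁ h₂)
  · exact Or.inr (key b a hb ha h₂ h₁)
  · exact absurd (eq_of_shorter_ver ha hb h₁ h₂) hab

end SwapSystem

/-! ### The groupoid of homotopy classes of edge paths -/

namespace SquareComplex

variable {X : SquareComplex}

theorem drev_drev (d : X.Dart) : drev (drev d) = d := by
  rcases d with ⟨e, _ | _⟩ <;> rfl

theorem drev_injective : Function.Injective (drev : X.Dart → X.Dart) := fun a b h => by
  rw [← drev_drev a, h, drev_drev]

theorem IsPath.append {u v w : X.V} {l l' : List X.Dart} (h : IsPath u l v) (h' : IsPath v l' w) :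
    IsPath u (l ++ l') w := by
  induction l generalizing u with
  | nil => cases h; exact h'
  | cons d l ih => exact ⟨h.1, ih h.2⟩

theorem IsPath.of_append {u w : X.V} {l l' : List X.Dart} (h : IsPath u (l ++ l') w) :
    ∃ v, IsPath u l v ∧ IsPath v l' w := by
  induction l generalizing u with
  | nil => exact ⟨u, rfl, h⟩
  | cons d l ih =>
    obtain ⟨v, h₁, h₂⟩ := ih h.2
    exact ⟨v, ⟨h.1, h₁⟩, h₂⟩

theorem IsPath.unique {u v v' : X.V} {l : List X.Dart} (h : IsPath u l v) (h' : IsPath u l v') :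
    v = v' := by
  induction l generalizing u with
  | nil => exact Eq.trans (Eq.symm h) h'
  | cons d l ih => exact ih h.2 h'.2

theorem isPath_single (d : X.Dart) : IsPath (dsrc d) [d] (dtgt d) := ⟨rfl, rfl⟩

/-- The reversed list of oriented edges. -/
def revList (l : List X.Dart) : List X.Dart := (l.map drev).reverse

theorem IsPath.rev {u v : X.V} {l : List X.Dart} (h : IsPath u l v) : IsPath v (revList l) u := by
  induction l generalizing u with
  | nil => exact Eq.symm h
  | cons d l ih =>
    have := (ih h.2).snoc (drev d) (dsrc_drev d)
    rw [dtgt_drev, h.1] at this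
    simpa [revList] using this

theorem HomotopyStep.append_left {l l' : List X.Dart} (h : X.HomotopyStep l l')
    (a : List X.Dart) : X.HomotopyStep (a ++ l) (a ++ l') := by
  cases h with
  | backtrack l₁ l₂ d => simpa using HomotopyStep.backtrack (a ++ l₁) l₂ d
  | square l₁ l₂ s => simpa using HomotopyStep.square (a ++ l₁) l₂ s

theorem HomotopyStep.append_right {l l' : List X.Dart} (h : X.HomotopyStep l l')
    (a : List X.Dart) : X.HomotopyStep (l ++ a) (l' ++ a) := by
  cases h with
  | backtrack l₁ l₂ d => simpa using HomotopyStep.backtrack l₁ (l₂ ++ a) d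
  | square l₁ l₂ s => simpa using HomotopyStep.square l₁ (l₂ ++ a) s

variable (X) in
/-- Homotopy classes of edge paths from `u` to `v`. -/
def HC (u v : X.V) : Type := Quot (fun p q : X.Path u v => p.Step q)

namespace HC

/-- The class of an edge path. -/
def mk {u v : X.V} (l : List X.Dart) (h : IsPath u l v) : X.HC u v := Quot.mk _ ⟨l, h⟩

theorem exists_mk {u v : X.V} (c : X.HC u v) : ∃ l h, c = mk l h := by
  induction c using Quot.ind with
  | _ p => exact ⟨p.1, p.2, rfl⟩

theorem mk_eq_of_step {u v : X.V} {l l' : List X.Dart} (h : IsPath u l v) (h' : IsPath u l' v)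
    (hs : X.HomotopyStep l l') : mk l h = mk l' h' := Quot.sound hs

theorem mk_eq_mk_iff {u v : X.V} (p q : X.Path u v) :
    mk p.1 p.2 = mk q.1 q.2 ↔ p.Homotopic q :=
  ⟨fun h => Quot.eqvGen_exact h, fun h => Quot.eqvGen_sound h⟩

/-- The class of the constant path. -/
def one (u : X.V) : X.HC u u := mk [] rfl

/-- Concatenation. -/
def comp {u v w : X.V} (a : X.HC u v) (b : X.HC v w) : X.HC u w :=
  Quot.map₂ (r := fun p q : X.Path u v => p.Step q) (s := fun p q : X.Path v w => p.Step q)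
    (t := fun p q : X.Path u w => p.Step q)
    (fun p q => ⟨p.1 ++ q.1, p.2.append q.2⟩)
    (fun p _ _ h => HomotopyStep.append_left h p.1)
    (fun _ _ q h => HomotopyStep.append_right h q.1) a b

theorem mk_congr {u v : X.V} {l l' : List X.Dart} (h : IsPath u l v) (hl : l = l') :
    mk l h = mk l' (hl ▸ h) := by subst hl; rfl

theorem assoc {u v w z : X.V} (a : X.HC u v) (b : X.HC v w) (c : X.HC w z) :
    (a.comp b).comp c = a.comp (b.comp c) := by
  obtain ⟨l, h, rfl⟩ := a.exists_mk
  obtain ⟨l', h', rfl⟩ := b.exists_mk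
  obtain ⟨l'', h'', rfl⟩ := c.exists_mk
  exact mk_congr _ (List.append_assoc _ _ _)

@[simp] theorem one_comp {u v : X.V} (a : X.HC u v) : (one u).comp a = a := by
  obtain ⟨l, h, rfl⟩ := a.exists_mk
  rfl

@[simp] theorem comp_one {u v : X.V} (a : X.HC u v) : a.comp (one v) = a := by
  obtain ⟨l, h, rfl⟩ := a.exists_mk
  exact mk_congr _ (List.append_nil _)

theorem mk_comp_rev {u v : X.V} {l : List X.Dart} (h : IsPath u l v) :
    (mk l h).comp (mk (revList l) h.rev) = one u := by
  induction l generalizing u with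
  | nil => cases h; rfl
  | cons d l ih =>
    obtain ⟨h₁, h₂⟩ := h
    subst h₁
    have h₃ : IsPath (dtgt d) [drev d] (dsrc d) := ⟨dsrc_drev d, dtgt_drev d⟩
    have e₁ : mk (d :: l) ⟨rfl, h₂⟩ = (mk [d] (isPath_single d)).comp (mk l h₂) := rfl
    have e₂ : mk (revList (d :: l)) (IsPath.rev (l := d :: l) ⟨rfl, h₂⟩) =
        (mk (revList l) h₂.rev).comp (mk [drev d] h₃) := mk_congr _ (by simp [revList])
    rw [e₁, e₂, assoc, ← assoc (mk l h₂), ih, one_comp]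
    exact (mk_eq_of_step _ _ (HomotopyStep.backtrack [] [] d)).symm

theorem revList_revList (l : List X.Dart) : revList (revList l) = l := by
  have : (drev : X.Dart → X.Dart) ∘ drev = id := funext drev_drev
  simp [revList, this]

theorem exists_inv {u v : X.V} (a : X.HC u v) :
    ∃ b : X.HC v u, a.comp b = one u ∧ b.comp a = one v := by
  obtain ⟨l, h, rfl⟩ := a.exists_mk
  refine ⟨mk (revList l) h.rev, mk_comp_rev h, ?_⟩
  rw [← mk_comp_rev h.rev, mk_congr (h.rev.rev) (revList_revList l)]

/-- The inverse class. -/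
noncomputable def inv {u v : X.V} (a : X.HC u v) : X.HC v u := a.exists_inv.choose

@[simp] theorem comp_inv {u v : X.V} (a : X.HC u v) : a.comp a.inv = one u :=
  a.exists_inv.choose_spec.1

@[simp] theorem inv_comp {u v : X.V} (a : X.HC u v) : a.inv.comp a = one v :=
  a.exists_inv.choose_spec.2

@[simp] theorem inv_comp_cancel {u v w : X.V} (a : X.HC u v) (b : X.HC v w) :
    a.inv.comp (a.comp b) = b := by rw [← assoc, inv_comp, one_comp]

theorem comp_left_cancel {u v w : X.V} {a : X.HC u v} {b c : X.HC v w}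
    (h : a.comp b = a.comp c) : b = c := by
  rw [← inv_comp_cancel a b, h, inv_comp_cancel]

/-- The fundamental group at `v`. -/
noncomputable instance (v : X.V) : Group (X.HC v v) where
  mul := comp
  one := one v
  inv := inv
  mul_assoc := assoc
  one_mul := one_comp
  mul_one := comp_one
  inv_mul_cancel := inv_comp

theorem mul_def {v : X.V} (a b : X.HC v v) : a * b = a.comp b := rfl

end HC

/-! ### Simply connected complexes -/

theorem SimplyConnected.hc_eq (hX : X.SimplyConnected) {u v : X.V} (a b : X.HC u v) : a = b := by
  have h : a.comp b.inv = HC.one u := by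
    obtain ⟨l, h, hl⟩ := (a.comp b.inv).exists_mk
    rw [hl]
    exact (HC.mk_eq_mk_iff ⟨l, h⟩ (Path.nil u)).2 (hX.2 u ⟨l, h⟩)
  rw [← HC.comp_one a, ← HC.inv_comp b, ← HC.assoc, h, HC.one_comp]

/-! ### Lifting to the universal cover -/

section Cover

variable {x : X.V}

theorem move_eq (q : X.CoverVertex x) (d : X.Dart) (h : dsrc d = q.1) :
    q.move d h = ⟨dtgt d, HC.comp q.2 (HC.mk [d] ⟨h, rfl⟩)⟩ := by
  obtain ⟨v, p⟩ := q
  induction p using Quot.ind with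
  | _ p => rfl

theorem move_congr {q q' : X.CoverVertex x} {d d' : X.Dart} (hq : q = q') (hd : d = d')
    (h : dsrc d = q.1) : q.move d h = q'.move d' (hd ▸ hq ▸ h) := by
  subst hq; subst hd; rfl

/-- The covering projection on oriented edges. -/
def projD (D : (X.universalCover x).Dart) : X.Dart := (projE D.1, D.2)

theorem projD_drev (D : (X.universalCover x).Dart) : projD (drev D) = drev (projD D) := rfl

theorem dsrc_projD (D : (X.universalCover x).Dart) : dsrc (projD D) = projV (dsrc D) := by
  rcases D with ⟨a, _ | _⟩
  · rfl
  · exact a.2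

theorem dtgt_projD (D : (X.universalCover x).Dart) : dtgt (projD D) = projV (dtgt D) := by
  rw [← dsrc_drev, ← dsrc_drev, ← projD_drev, dsrc_projD]

/-- The lift of an oriented edge, as an oriented edge of the universal cover. -/
def lift (q : (X.universalCover x).V) (d : X.Dart) (h : dsrc d = projV q) :
    (X.universalCover x).Dart := liftDart q d h

theorem dsrc_lift (q : (X.universalCover x).V) (d : X.Dart) (h : dsrc d = projV q) :
    dsrc (lift q d h) = q := liftDart_src q d h

theorem dtgt_lift (q : (X.universalCover x).V) (d : X.Dart) (h : dsrc d = projV q) :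
    dtgt (lift q d h) = CoverVertex.move q d h := liftDart_tgt q d h

@[simp] theorem projD_lift (q : (X.universalCover x).V) (d : X.Dart) (h : dsrc d = projV q) :
    projD (lift q d h) = d := by
  rcases d with ⟨e, _ | _⟩ <;> rfl

theorem eq_lift (D : (X.universalCover x).Dart) :
    D = lift (dsrc D) (projD D) (dsrc_projD D) := by
  rcases D with ⟨a, _ | _⟩
  · refine Prod.ext (Subtype.ext (Prod.ext ?_ rfl)) rfl
    exact (CoverVertex.move_move_drev a.1.1 (a.1.2, true) a.2).symm
  · rfl

theorem lift_congr {q q' : (X.universalCover x).V} {d d' : X.Dart} (hq : q = q') (hd : d = d')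
    (h : dsrc d = projV q) : lift q d h = lift q' d' (hd ▸ hq ▸ h) := by
  subst hq; subst hd; rfl

/-- Oriented edges of the universal cover are determined by the initial vertex and the image. -/
theorem dart_ext {D D' : (X.universalCover x).Dart} (h : dsrc D = dsrc D')
    (h' : projD D = projD D') : D = D' := by
  rw [eq_lift D, eq_lift D']
  exact lift_congr h h' _

theorem dtgt_eq_move (D : (X.universalCover x).Dart) :
    dtgt D = CoverVertex.move (dsrc D) (projD D) (dsrc_projD D) := by
  conv_lhs => rw [eq_lift D]
  exact dtgt_lift _ _ _

theorem projD_bdry (t : (X.universalCover x).S) (k : Fin 4) :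
    projD ((X.universalCover x).bdry t k) = X.bdry (projS t) k :=
  projD_lift _ _ _

theorem dsrc_bdry_zero (t : (X.universalCover x).S) :
    dsrc ((X.universalCover x).bdry t 0) = t.1.1 := dsrc_lift _ _ _

theorem isPath_map_projD {q r : (X.universalCover x).V} {L : List (X.universalCover x).Dart}
    (h : IsPath q L r) : IsPath (projV q) (L.map projD) (projV r) := by
  induction L generalizing q with
  | nil => exact congrArg projV h
  | cons D L ih =>
    refine ⟨(dsrc_projD D).trans (congrArg projV h.1), ?_⟩
    rw [dtgt_projD]
    exact ih h.2

/-- The terminal vertex of a path in the universal cover is determined by the homotopy class of its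
image. -/
theorem endpoint_eq {q r : (X.universalCover x).V} {L : List (X.universalCover x).Dart}
    (h : IsPath q L r) :
    r = ⟨projV r, HC.comp q.2 (HC.mk (L.map projD) (isPath_map_projD h))⟩ := by
  induction L generalizing q with
  | nil =>
    cases h
    exact Sigma.ext rfl (heq_of_eq (HC.comp_one (X := X) _).symm)
  | cons D L ih =>
    obtain ⟨rfl, h⟩ := h
    refine (ih h).trans ?_
    refine Sigma.ext rfl (heq_of_eq ?_)
    have key : ∀ (q' : X.CoverVertex x) (hq : q' = CoverVertex.move (dsrc D) (projD D)
        (dsrc_projD D)) (h' : IsPath q'.1 (L.map projD) (projV r)),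
        HC.comp q'.2 (HC.mk (L.map projD) h') = HC.comp (dsrc D).2
          (HC.mk ((D :: L).map projD) (isPath_map_projD (q := dsrc D) (r := r) ⟨rfl, h⟩)) := by
      intro q' hq h'
      replace hq := hq.trans (move_eq _ _ _)
      subst hq
      exact HC.assoc _ _ _
    exact key _ (dtgt_eq_move D) (isPath_map_projD h)

/-- Edge paths lift to the universal cover, with any given initial vertex. -/
theorem exists_lift_path (q : (X.universalCover x).V) {l : List X.Dart} {v : X.V}
    (h : IsPath (projV q) l v) : ∃ L r, IsPath q L r ∧ L.map projD = l := by
  induction l generalizing q with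
  | nil => exact ⟨[], q, rfl, rfl⟩
  | cons d l ih =>
    obtain ⟨h₁, h₂⟩ := h
    obtain ⟨L, r, hL, hl⟩ := ih (dtgt (lift q d h₁)) (by rw [dtgt_lift]; exact h₂)
    exact ⟨lift q d h₁ :: L, r, ⟨dsrc_lift q d h₁, hL⟩, by simp [hl]⟩

/-- An edge path has at most one lift with a given initial vertex. -/
theorem lift_path_unique {q r r' : (X.universalCover x).V} {L L' : List (X.universalCover x).Dart}
    (h : IsPath q L r) (h' : IsPath q L' r') (he : L.map projD = L'.map projD) : L = L' := by
  induction L generalizing q L' with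
  | nil =>
    cases L' with
    | nil => rfl
    | cons => simp at he
  | cons D L ih =>
    cases L' with
    | nil => simp at he
    | cons D' L' =>
      simp only [List.map_cons, List.cons.injEq] at he
      have hD : D = D' := dart_ext (h.1.trans h'.1.symm) he.1
      subst hD
      rw [ih h.2 h'.2 he.2]

/-- The lift of a square with a given lift of its `0`-th corner. -/
def liftSquare (q : (X.universalCover x).V) (s : X.S) (h : dsrc (X.bdry s 0) = projV q) :
    (X.universalCover x).S := ⟨(q, s), h⟩

/-- An elementary homotopy between the images of two paths with the same ends lifts to one between
these paths. -/
theorem homotopyStep_lift {q r : (X.universalCover x).V} {L L' : List (X.universalCover x).Dart}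
    (h : IsPath q L r) (h' : IsPath q L' r)
    (hs : X.HomotopyStep (L.map projD) (L'.map projD)) :
    (X.universalCover x).HomotopyStep L L' := by
  generalize hl : L.map projD = l at hs
  generalize hl' : L'.map projD = l' at hs
  cases hs with
  | backtrack l₁ l₂ d =>
    obtain ⟨L₁, L₂, rfl, rfl, hL₂⟩ := List.map_eq_append_iff.1 hl'
    obtain ⟨D, L₃, rfl, rfl, hL₃⟩ := List.map_eq_cons_iff.1 hL₂
    obtain ⟨D', L₄, rfl, hD', rfl⟩ := List.map_eq_cons_iff.1 hL₃
    obtain ⟨v, h₁, h₂, h₃, h₄⟩ := h'.of_append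
    have hD : D' = drev D := dart_ext (h₃.trans (dsrc_drev D).symm) hD'
    subst hD
    rw [dtgt_drev, h₂] at h₄
    have := lift_path_unique h (h₁.append h₄) (by rw [hl, List.map_append])
    rw [this]
    exact HomotopyStep.backtrack _ _ _
  | square l₁ l₂ s =>
    obtain ⟨L₁, L₂, rfl, rfl, hL₂⟩ := List.map_eq_append_iff.1 hl'
    obtain ⟨B₀, L₃, rfl, hB₀, hL₃⟩ := List.map_eq_cons_iff.1 hL₂
    obtain ⟨B₁, L₄, rfl, hB₁, hL₄⟩ := List.map_eq_cons_iff.1 hL₃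
    obtain ⟨B₂, L₅, rfl, hB₂, hL₅⟩ := List.map_eq_cons_iff.1 hL₄
    obtain ⟨B₃, L₆, rfl, hB₃, rfl⟩ := List.map_eq_cons_iff.1 hL₅
    obtain ⟨v, h₁, h₂, h₃, h₄, h₅, h₆⟩ := h'.of_append
    set t : (X.universalCover x).S := liftSquare (dsrc B₀) s (by rw [← dsrc_projD, hB₀]) with ht
    have e₀ : (X.universalCover x).bdry t 0 = B₀ :=
      dart_ext (dsrc_bdry_zero t) ((projD_bdry t 0).trans hB₀.symm)
    have e₁ : (X.universalCover x).bdry t 1 = B₁ :=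
      dart_ext ((dtgt_bdry t 0).symm.trans (by rw [e₀, h₃])) ((projD_bdry t 1).trans hB₁.symm)
    have e₂ : (X.universalCover x).bdry t 2 = B₂ :=
      dart_ext ((dtgt_bdry t 1).symm.trans (by rw [e₁, h₄])) ((projD_bdry t 2).trans hB₂.symm)
    have e₃ : (X.universalCover x).bdry t 3 = B₃ :=
      dart_ext ((dtgt_bdry t 2).symm.trans (by rw [e₂, h₅])) ((projD_bdry t 3).trans hB₃.symm)
    have hc : dtgt B₃ = v := by
      rw [← e₃, ← h₂, ← e₀]
      exact dtgt_bdry t 3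
    rw [hc] at h₆
    have := lift_path_unique h (h₁.append h₆) (by rw [hl, List.map_append])
    rw [this, ← e₀, ← e₁, ← e₂, ← e₃]
    exact HomotopyStep.square _ _ _

theorem homotopic_lift {u v : X.V} {p p' : X.Path u v} (h : p.Homotopic p')
    {q r : (X.universalCover x).V} (hq : projV q = u) (P P' : (X.universalCover x).Path q r)
    (hP : P.1.map projD = p.1) (hP' : P'.1.map projD = p'.1) : P.Homotopic P' := by
  induction h generalizing r with
  | rel p p' h =>
    refine Relation.EqvGen.rel _ _ (homotopyStep_lift P.2 P'.2 ?_)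
    rw [hP, hP']
    exact h
  | refl p =>
    rw [Subtype.ext (lift_path_unique P.2 P'.2 (hP.trans hP'.symm))]
    exact Relation.EqvGen.refl _
  | symm p p' _ ih => exact Relation.EqvGen.symm _ _ (ih P' P hP' hP)
  | trans p p'' p' h _ ih ih' =>
    subst hq
    obtain ⟨L, r', hL, hl⟩ := exists_lift_path q p''.2
    have hv : projV r = v := (isPath_map_projD P.2).unique (hP ▸ p.2)
    have hv' : projV r' = v := (isPath_map_projD hL).unique (hl ▸ p''.2)
    have hr : r' = r := by
      rw [endpoint_eq hL, endpoint_eq P.2]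
      subst hv
      refine Sigma.ext hv' ?_
      have : HC.mk p.1 p.2 = HC.mk p''.1 p''.2 := (HC.mk_eq_mk_iff _ _).2 h
      have hh : ∀ (w : X.V) (hw : w = projV r) (l₁ l₂ : List X.Dart) (h₁ : IsPath (projV q) l₁ w)
          (h₂ : IsPath (projV q) l₂ (projV r)) (e₁ : l₁ = p''.1) (e₂ : l₂ = p.1),
          HEq (HC.comp q.2 (HC.mk l₁ h₁)) (HC.comp q.2 (HC.mk l₂ h₂)) := by
        rintro w rfl l₁ l₂ h₁ h₂ rfl rfl
        exact heq_of_eq (congrArg (HC.comp q.2) this.symm)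
      exact hh _ hv' _ _ _ _ hl hP
    subst hr
    exact Relation.EqvGen.trans _ _ _ (ih P ⟨L, hL⟩ hP hl) (ih' ⟨L, hL⟩ P' hl hP')

variable (X x) in
/-- The base vertex of the universal cover. -/
def coverBase : (X.universalCover x).V := ⟨x, HC.one x⟩

theorem exists_path_from_base (q : (X.universalCover x).V) :
    ∃ L, IsPath (coverBase X x) L q := by
  obtain ⟨v, c⟩ := q
  obtain ⟨l, h, rfl⟩ := HC.exists_mk (X := X) c
  obtain ⟨L, r, hL, hl⟩ := exists_lift_path (coverBase X x) h
  refine ⟨L, ?_⟩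
  have hv : projV r = v := (isPath_map_projD hL).unique (hl ▸ h)
  have hr := endpoint_eq hL
  subst hv
  subst hl
  rw [hr] at hL
  exact hL

theorem universalCover_connected : (X.universalCover x).Connected := by
  refine ⟨⟨coverBase X x⟩, fun u v => ?_⟩
  obtain ⟨L, hL⟩ := exists_path_from_base u
  obtain ⟨L', hL'⟩ := exists_path_from_base v
  exact ⟨⟨revList L ++ L', hL.rev.append hL'⟩⟩

theorem universalCover_simplyConnected : (X.universalCover x).SimplyConnected := by
  refine ⟨universalCover_connected, fun q P => ?_⟩
  have hp := isPath_map_projD P.2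
  have h : HC.mk _ hp = HC.one (projV q) := by
    have := endpoint_eq P.2
    have h₂ : q.2 = HC.comp q.2 (HC.mk _ hp) := by
      obtain ⟨v, c⟩ := q
      exact eq_of_heq (Sigma.mk.inj this).2
    refine HC.comp_left_cancel (a := (show X.HC x (projV q) from q.2)) ?_
    rw [HC.comp_one]
    exact h₂.symm
  exact homotopic_lift ((HC.mk_eq_mk_iff ⟨_, hp⟩ (Path.nil _)).1 h) rfl P (Path.nil q) rfl rfl

end Cover

end SquareComplex

/-! ### Simply connected complexes with horizontal and vertical edges -/

namespace SquareComplex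

variable {Z : SquareComplex}

/-- Two oriented edges are joined by an edge of the link of their common initial vertex. -/
def Cornered (d d' : Z.Dart) : Prop := ∃ c, CornerJoins c d d'

theorem Cornered.symm {d d' : Z.Dart} (h : Cornered d d') : Cornered d' d :=
  h.imp fun _ hc => Or.symm hc

/-- The horizontal side of the square `s` that leaves its `k`-th corner, if the sides `0` and `2`
are the horizontal ones. -/
def cornerH (s : Z.S) : Fin 4 → Z.Dart
  | 0 => Z.bdry s 0
  | 1 => drev (Z.bdry s 0)
  | 2 => Z.bdry s 2
  | 3 => drev (Z.bdry s 2)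

/-- The vertical side of the square `s` that leaves its `k`-th corner, if the sides `1` and `3`
are the vertical ones. -/
def cornerV (s : Z.S) : Fin 4 → Z.Dart
  | 0 => drev (Z.bdry s 3)
  | 1 => Z.bdry s 1
  | 2 => drev (Z.bdry s 1)
  | 3 => Z.bdry s 3

/-- A corner of a square joins its horizontal edge to its vertical one. -/
theorem cornerJoins_iff (s : Z.S) (k : Fin 4) (d d' : Z.Dart) : CornerJoins (s, k) d d' ↔
    (d = cornerH s k ∧ d' = cornerV s k) ∨ (d = cornerV s k ∧ d' = cornerH s k) := by
  have e₀ : (0 : Fin 4) - 1 = 3 := rfl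
  have e₂ : (2 : Fin 4) - 1 = 1 := rfl
  have e₃ : (3 : Fin 4) - 1 = 2 := rfl
  fin_cases k <;> simp [CornerJoins, cornerH, cornerV, e₀, e₂, e₃, eq_comm] <;> tauto

theorem dsrc_cornerH (s : Z.S) (k : Fin 4) : dsrc (cornerH s k) = dsrc (Z.bdry s k) := by
  fin_cases k
  · rfl
  · exact (dsrc_drev _).trans (dtgt_bdry s 0)
  · rfl
  · exact (dsrc_drev _).trans (dtgt_bdry s 2)

theorem dsrc_cornerV (s : Z.S) (k : Fin 4) : dsrc (cornerV s k) = dsrc (Z.bdry s k) := by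
  fin_cases k
  · exact (dsrc_drev _).trans (dtgt_bdry s 3)
  · rfl
  · exact (dsrc_drev _).trans (dtgt_bdry s 1)
  · rfl

theorem Cornered.dsrc_eq {d d' : Z.Dart} (h : Cornered d d') : dsrc d = dsrc d' := by
  obtain ⟨⟨s, k⟩, hc⟩ := h
  rcases (cornerJoins_iff s k d d').1 hc with ⟨rfl, rfl⟩ | ⟨rfl, rfl⟩
  · rw [dsrc_cornerH, dsrc_cornerV]
  · rw [dsrc_cornerH, dsrc_cornerV]

/-- A division of the edges into horizontal and vertical ones for which the boundary path of every
square is horizontal, vertical, horizontal, vertical. -/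
structure IsVH (Z : SquareComplex) (hor : Z.E → Prop) : Prop where
  hor_zero : ∀ s, hor (Z.bdry s 0).1
  ver_one : ∀ s, ¬ hor (Z.bdry s 1).1
  hor_two : ∀ s, hor (Z.bdry s 2).1
  ver_three : ∀ s, ¬ hor (Z.bdry s 3).1

variable {hor : Z.E → Prop}

theorem IsVH.hor_cornerH (h : IsVH Z hor) (s : Z.S) (k : Fin 4) : hor (cornerH s k).1 := by
  fin_cases k
  exacts [h.hor_zero s, h.hor_zero s, h.hor_two s, h.hor_two s]

theorem IsVH.ver_cornerV (h : IsVH Z hor) (s : Z.S) (k : Fin 4) : ¬ hor (cornerV s k).1 := by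
  fin_cases k
  exacts [h.ver_three s, h.ver_one s, h.ver_one s, h.ver_three s]

theorem IsVH.cornered_iff (h : IsVH Z hor) {d d' : Z.Dart} (hd : hor d.1) :
    Cornered d d' ↔ ∃ s k, d = cornerH s k ∧ d' = cornerV s k := by
  constructor
  · rintro ⟨⟨s, k⟩, hc⟩
    rcases (cornerJoins_iff s k d d').1 hc with hc | ⟨rfl, -⟩
    · exact ⟨s, k, hc⟩
    · exact absurd hd (h.ver_cornerV s k)
  · rintro ⟨s, k, hc⟩
    exact ⟨(s, k), (cornerJoins_iff s k d d').2 (Or.inl hc)⟩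

theorem IsVH.not_cornered_of_same (h : IsVH Z hor) {d d' : Z.Dart} (hd : hor d.1 ↔ hor d'.1) :
    ¬ Cornered d d' := by
  rintro ⟨⟨s, k⟩, hc⟩
  rcases (cornerJoins_iff s k d d').1 hc with ⟨rfl, rfl⟩ | ⟨rfl, rfl⟩
  · exact h.ver_cornerV s k (hd.1 (h.hor_cornerH s k))
  · exact h.ver_cornerV s k (hd.2 (h.hor_cornerH s k))

theorem IsVH.parallel (h : IsVH Z hor) {e e' : Z.E} (hp : Parallel e e') : hor e ↔ hor e' := by
  induction hp with
  | rel a b hab =>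
    obtain ⟨s, k, rfl, rfl⟩ := hab
    fin_cases k
    · exact iff_of_true (h.hor_zero s) (h.hor_two s)
    · exact iff_of_false (h.ver_one s) (h.ver_three s)
    · exact iff_of_true (h.hor_two s) (h.hor_zero s)
    · exact iff_of_false (h.ver_three s) (h.ver_one s)
  | refl => rfl
  | symm _ _ _ ih => exact ih.symm
  | trans _ _ _ _ _ ih ih' => exact ih.trans ih'

/-- In a complex with horizontal and vertical edges links are bipartite, so that non-positive
curvature only asks that links have no double edges. -/
theorem IsVH.nonpositivelyCurved (h : IsVH Z hor)
    (hinj : ∀ s k s' k', cornerH (Z := Z) s k = cornerH s' k' → cornerV s k = cornerV s' k' →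
      (s, k) = (s', k')) : Z.NonpositivelyCurved := by
  refine ⟨fun c d hc => h.not_cornered_of_same Iff.rfl ⟨c, hc⟩, ?_, ?_⟩
  · rintro ⟨s, k⟩ ⟨s', k'⟩ d d' hc hc'
    rw [cornerJoins_iff] at hc hc'
    rcases hc with ⟨rfl, rfl⟩ | ⟨rfl, rfl⟩ <;> rcases hc' with ⟨h₁, h₂⟩ | ⟨h₁, h₂⟩
    · exact hinj _ _ _ _ h₁ h₂
    · exact absurd (h₁ ▸ h.hor_cornerH s k) (h.ver_cornerV s' k')
    · exact absurd (h₂ ▸ h.hor_cornerH s k) (h.ver_cornerV s' k')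
    · exact hinj _ _ _ _ h₂ h₁
  · rintro ⟨c₁, c₂, c₃, d₁, d₂, d₃, h₁, h₂, h₃⟩
    have n₁ : ¬ (hor d₁.1 ↔ hor d₂.1) := fun e => h.not_cornered_of_same e ⟨_, h₁⟩
    have n₂ : ¬ (hor d₂.1 ↔ hor d₃.1) := fun e => h.not_cornered_of_same e ⟨_, h₂⟩
    have n₃ : ¬ (hor d₃.1 ↔ hor d₁.1) := fun e => h.not_cornered_of_same e ⟨_, h₃⟩
    tauto

/-- The swap system of a complex with horizontal and vertical edges whose links have no double
edges. -/
def IsVH.swapSystem (h : IsVH Z hor) (hZ : Z.NonpositivelyCurved) : SwapSystem Z.Dart where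
  rev := drev
  hor d := hor d.1
  Swap t d d' t' := ∃ s k, t = drev (cornerH s k) ∧ d = cornerV s k ∧
    d' = drev (cornerV s (k + 2)) ∧ t' = cornerH s (k + 2)
  rev_rev := drev_drev
  hor_rev _ := Iff.rfl
  swap_hor₁ := by
    rintro t d d' t' ⟨s, k, rfl, rfl, rfl, rfl⟩
    exact h.hor_cornerH s k
  swap_ver₁ := by
    rintro t d d' t' ⟨s, k, rfl, rfl, rfl, rfl⟩
    exact h.ver_cornerV s k
  swap_ver₂ := by
    rintro t d d' t' ⟨s, k, rfl, rfl, rfl, rfl⟩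
    exact h.ver_cornerV s (k + 2)
  swap_hor₂ := by
    rintro t d d' t' ⟨s, k, rfl, rfl, rfl, rfl⟩
    exact h.hor_cornerH s (k + 2)
  swap_undo := by
    rintro t d d' t' ⟨s, k, rfl, rfl, rfl, rfl⟩
    fin_cases k
    · exact ⟨s, 3, by simp [cornerH, cornerV, drev_drev]⟩
    · exact ⟨s, 2, by simp [cornerH, cornerV, drev_drev]⟩
    · exact ⟨s, 1, by simp [cornerH, cornerV, drev_drev]⟩
    · exact ⟨s, 0, by simp [cornerH, cornerV, drev_drev]⟩
  swap_flip := by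
    rintro t d d' t' ⟨s, k, rfl, rfl, rfl, rfl⟩
    fin_cases k
    · exact ⟨s, 1, by simp [cornerH, cornerV, drev_drev]⟩
    · exact ⟨s, 0, by simp [cornerH, cornerV, drev_drev]⟩
    · exact ⟨s, 3, by simp [cornerH, cornerV, drev_drev]⟩
    · exact ⟨s, 2, by simp [cornerH, cornerV, drev_drev]⟩
  swap_unique := by
    rintro t d d' t' e u ⟨s, k, rfl, rfl, rfl, rfl⟩ ⟨s', k', h₁, h₂, rfl, rfl⟩
    have := hZ.2.1 (s, k) (s', k') (cornerH s k) (cornerV s k)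
      ((cornerJoins_iff _ _ _ _).2 (Or.inl ⟨rfl, rfl⟩))
      ((cornerJoins_iff _ _ _ _).2 (Or.inl ⟨drev_injective h₁, h₂⟩))
    obtain ⟨rfl, rfl⟩ := Prod.mk.inj this
    exact ⟨rfl, rfl⟩

/-- A simply connected non-positively curved square complex with a division of the edges into
horizontal and vertical ones. -/
structure IsCAT0VH (Z : SquareComplex) (hor : Z.E → Prop) : Prop where
  simplyConnected : Z.SimplyConnected
  npc : Z.NonpositivelyCurved
  vh : IsVH Z hor

namespace IsCAT0VH

variable (hZ : IsCAT0VH Z hor)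

/-- The swap system of the complex. -/
abbrev sys : SwapSystem Z.Dart := hZ.vh.swapSystem hZ.npc

theorem foldl_irreducible {s : List Z.Dart} (hs : hZ.sys.Irreducible s) (l : List Z.Dart) :
    hZ.sys.Irreducible (l.foldl hZ.sys.push s) := by
  induction l generalizing s with
  | nil => exact hs
  | cons d l ih => exact ih (hs.push d)

/-- Elementary homotopies do not change the action of a path on irreducible stacks. -/
theorem foldl_eq_of_step {s l l' : List Z.Dart} (hs : hZ.sys.Irreducible s)
    (h : Z.HomotopyStep l l') : l.foldl hZ.sys.push s = l'.foldl hZ.sys.push s := by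
  cases h with
  | backtrack l₁ l₂ d =>
    have := SwapSystem.push_push_rev (hZ.foldl_irreducible hs l₁) d
    rw [List.foldl_append, List.foldl_append, List.foldl_cons, List.foldl_cons]
    exact congrArg (fun s => List.foldl hZ.sys.push s l₂) this.symm
  | square l₁ l₂ q =>
    have hirr := hZ.foldl_irreducible hs l₁
    rw [List.foldl_append, List.foldl_append]
    set s' := l₁.foldl hZ.sys.push s
    have hsw : hZ.sys.Swap (Z.bdry q 0) (Z.bdry q 1) (drev (Z.bdry q 3)) (drev (Z.bdry q 2)) :=
      ⟨q, 1, by simp [cornerH, cornerV, drev_drev]⟩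
    simp only [List.foldl_cons]
    rw [SwapSystem.push_square hirr hsw]
    have e₁ := SwapSystem.push_rev_push (hirr.push (drev (Z.bdry q 3))) (Z.bdry q 2)
    have e₂ := SwapSystem.push_rev_push hirr (Z.bdry q 3)
    change hZ.sys.push (hZ.sys.push (hZ.sys.push s' (drev (Z.bdry q 3))) (drev (Z.bdry q 2)))
      (Z.bdry q 2) = _ at e₁
    change hZ.sys.push (hZ.sys.push s' (drev (Z.bdry q 3))) (Z.bdry q 3) = _ at e₂
    rw [e₁, e₂]

theorem isPath_push {s : List Z.Dart} {u : Z.V} {d : Z.Dart} (h : IsPath u s.reverse (dsrc d)) :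
    IsPath u (hZ.sys.push s d).reverse (dtgt d) := by
  induction s generalizing d with
  | nil =>
    rw [SwapSystem.push_nil]
    exact ⟨Eq.symm h, rfl⟩
  | cons t s ih =>
    rw [List.reverse_cons] at h
    obtain ⟨v, h₁, h₂, h₃⟩ := h.of_append
    change dtgt t = dsrc d at h₃
    subst h₂
    rcases hZ.sys.push_cases t d s with ⟨h₀, h'⟩ | ⟨d', t', hsw, h'⟩ | ⟨-, -, h'⟩
    · rw [h', ← dsrc_drev]
      change t = drev d at h₀
      rwa [← h₀]
    · rw [h', List.reverse_cons]
      obtain ⟨q, k, rfl, rfl, rfl, rfl⟩ := hsw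
      have e₁ : dsrc (drev (cornerH q k)) = dsrc (drev (cornerV q (k + 2))) := by
        fin_cases k
        · simpa [cornerH, cornerV, drev_drev, dsrc_drev] using dtgt_bdry q 0
        · simpa [cornerH, cornerV, drev_drev, dsrc_drev] using (dtgt_bdry q 3).symm
        · simpa [cornerH, cornerV, drev_drev, dsrc_drev] using dtgt_bdry q 2
        · simpa [cornerH, cornerV, drev_drev, dsrc_drev] using (dtgt_bdry q 1).symm
      have e₂ : dtgt (cornerH q (k + 2)) = dtgt (cornerV q k) := by
        fin_cases k
        · simpa [cornerH, cornerV, dtgt_drev] using dtgt_bdry q 2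
        · simpa [cornerH, cornerV, dtgt_drev] using (dtgt_bdry q 1).symm
        · simpa [cornerH, cornerV, dtgt_drev] using dtgt_bdry q 0
        · simpa [cornerH, cornerV, dtgt_drev] using (dtgt_bdry q 3).symm
      have := ih (d := drev (cornerV q (k + 2))) (e₁ ▸ h₁)
      have h₅ := this.snoc (cornerH q (k + 2)) (by rw [dtgt_drev, dsrc_cornerH, dsrc_cornerV])
      rwa [e₂] at h₅
    · rw [h', List.reverse_cons, List.reverse_cons]
      exact (h₁.snoc t rfl).snoc d h₃.symm

theorem isPath_foldl {s l : List Z.Dart} {u v w : Z.V} (h : IsPath u s.reverse v)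
    (h' : IsPath v l w) : IsPath u (l.foldl hZ.sys.push s).reverse w := by
  induction l generalizing s v with
  | nil => cases h'; exact h
  | cons d l ih =>
    obtain ⟨rfl, h'⟩ := h'
    exact ih (hZ.isPath_push h) h'

/-- The normal form, as a stack, of the paths from `u` to `v`. -/
noncomputable def nf (u v : Z.V) : List Z.Dart :=
  (hZ.simplyConnected.1.2 u v).some.1.foldl hZ.sys.push []

/-- By simple connectedness any path computes the normal form. -/
theorem nf_eq {u v : Z.V} {l : List Z.Dart} (h : IsPath u l v) :
    hZ.nf u v = l.foldl hZ.sys.push [] := by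
  have key : ∀ p q : Z.Path u v, p.Homotopic q →
      p.1.foldl hZ.sys.push [] = q.1.foldl hZ.sys.push [] := by
    intro p q hpq
    induction hpq with
    | rel p q h => exact hZ.foldl_eq_of_step SwapSystem.irreducible_nil h
    | refl => rfl
    | symm _ _ _ ih => exact ih.symm
    | trans _ _ _ _ _ ih ih' => exact ih.trans ih'
  exact key _ ⟨l, h⟩ ((HC.mk_eq_mk_iff _ _).1 (hZ.simplyConnected.hc_eq _ _))

theorem isPath_nf (u v : Z.V) : IsPath u (hZ.nf u v).reverse v :=
  hZ.isPath_foldl (s := []) rfl (hZ.simplyConnected.1.2 u v).some.2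

theorem nf_dtgt (u : Z.V) (d : Z.Dart) :
    hZ.nf u (dtgt d) = hZ.sys.push (hZ.nf u (dsrc d)) d := by
  obtain ⟨⟨l, hl⟩⟩ := hZ.simplyConnected.1.2 u (dsrc d)
  rw [hZ.nf_eq hl, hZ.nf_eq (hl.snoc d rfl), List.foldl_append]
  rfl

/-- The combinatorial distance, computed as the length of normal forms. -/
noncomputable def dist (u v : Z.V) : ℕ := (hZ.nf u v).length

theorem dist_le {u v : Z.V} {l : List Z.Dart} (h : IsPath u l v) : hZ.dist u v ≤ l.length := by
  have key : ∀ (l s : List Z.Dart), (l.foldl hZ.sys.push s).length ≤ s.length + l.length := by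
    intro l
    induction l with
    | nil => simp
    | cons d l ih =>
      intro s
      have h₁ := ih (hZ.sys.push s d)
      have h₂ := hZ.sys.length_push s d
      simp only [List.foldl_cons, List.length_cons]
      omega
  rw [dist, hZ.nf_eq h]
  simpa using key l []

theorem exists_geodesic (u v : Z.V) : ∃ l, IsPath u l v ∧ l.length = hZ.dist u v :=
  ⟨_, hZ.isPath_nf u v, List.length_reverse⟩

theorem dist_comm (u v : Z.V) : hZ.dist u v = hZ.dist v u := by
  have key : ∀ u v : Z.V, hZ.dist u v ≤ hZ.dist v u := by
    intro u v
    obtain ⟨l, hl, hlen⟩ := hZ.exists_geodesic v u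
    simpa [revList, hlen] using hZ.dist_le hl.rev
  exact le_antisymm (key u v) (key v u)

theorem dist_triangle (u v w : Z.V) : hZ.dist u w ≤ hZ.dist u v + hZ.dist v w := by
  obtain ⟨l, hl, hlen⟩ := hZ.exists_geodesic u v
  obtain ⟨l', hl', hlen'⟩ := hZ.exists_geodesic v w
  simpa [hlen, hlen'] using hZ.dist_le (hl.append hl')

@[simp] theorem dist_self (u : Z.V) : hZ.dist u u = 0 :=
  Nat.le_zero.1 (hZ.dist_le (l := []) rfl)

theorem eq_of_dist_eq_zero {u v : Z.V} (h : hZ.dist u v = 0) : u = v := by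
  obtain ⟨l, hl, hlen⟩ := hZ.exists_geodesic u v
  rw [h, List.length_eq_zero_iff] at hlen
  subst hlen
  exact hl

theorem dist_dart (u : Z.V) (d : Z.Dart) : hZ.dist u (dtgt d) = hZ.dist u (dsrc d) + 1 ∨
    hZ.dist u (dtgt d) + 1 = hZ.dist u (dsrc d) := by
  rw [dist, dist, hZ.nf_dtgt]
  exact hZ.sys.length_push _ d

theorem dist_dart' (u : Z.V) (d : Z.Dart) : hZ.dist (dtgt d) u = hZ.dist (dsrc d) u + 1 ∨
    hZ.dist (dtgt d) u + 1 = hZ.dist (dsrc d) u := by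
  rw [hZ.dist_comm _ u, hZ.dist_comm _ u]
  exact hZ.dist_dart u d

/-- The oriented edge `d` leads towards `u`. For fixed `d` these `u` form a halfspace. -/
def Toward (u : Z.V) (d : Z.Dart) : Prop := hZ.dist u (dtgt d) < hZ.dist u (dsrc d)

theorem toward_drev (u : Z.V) (d : Z.Dart) : hZ.Toward u (drev d) ↔ ¬ hZ.Toward u d := by
  have := hZ.dist_dart u d
  rw [Toward, Toward, dtgt_drev, dsrc_drev]
  omega

theorem not_toward_dsrc (d : Z.Dart) : ¬ hZ.Toward (dsrc d) d := by
  simp [Toward]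

theorem toward_dtgt (d : Z.Dart) : hZ.Toward (dtgt d) d := by
  rw [← drev_drev d, toward_drev, dtgt_drev]
  exact hZ.not_toward_dsrc _

theorem exists_toward {u p : Z.V} (h : u ≠ p) : ∃ d, dsrc d = p ∧ hZ.Toward u d := by
  obtain ⟨l, hl, hlen⟩ := hZ.exists_geodesic p u
  cases l with
  | nil => exact absurd (Eq.symm hl) h
  | cons d l =>
    refine ⟨d, hl.1, ?_⟩
    have := hZ.dist_le hl.2
    rw [Toward, hZ.dist_comm u, hZ.dist_comm u, hl.1, ← hlen, List.length_cons]
    omega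

/-- Two edges that lead from a vertex towards `u` span a square. -/
theorem cornered_of_toward {u : Z.V} {a b : Z.Dart} (hab : a ≠ b) (h : dsrc a = dsrc b)
    (ha : hZ.Toward u a) (hb : hZ.Toward u b) : Cornered a b := by
  rw [Toward, dist, dist, hZ.nf_dtgt] at ha hb
  rw [← h] at hb
  have key : ∀ a b : Z.Dart, (∃ d' t', hZ.sys.Swap (drev a) b d' t') → Cornered a b := by
    rintro a b ⟨_, _, s, k, h₁, h₂, -, -⟩
    exact ⟨(s, k), (cornerJoins_iff _ _ _ _).2 (Or.inl ⟨drev_injective h₁, h₂⟩)⟩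
  rcases SwapSystem.exists_swap_of_shorter hab ha hb with h' | h'
  · exact key a b h'
  · exact (key b a h').symm

/-- If the neighbours in a square of its `k`-th corner are closer to `u`, then the opposite corner
is still closer. -/
theorem dist_opposite (u : Z.V) (s : Z.S) (k : Fin 4)
    (h₁ : hZ.dist u (dsrc (Z.bdry s (k + 1))) < hZ.dist u (dsrc (Z.bdry s k)))
    (h₂ : hZ.dist u (dsrc (Z.bdry s (k + 3))) < hZ.dist u (dsrc (Z.bdry s k))) :
    hZ.dist u (dsrc (Z.bdry s (k + 2))) + 2 = hZ.dist u (dsrc (Z.bdry s k)) := by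
  have t₀ := dtgt_bdry s 0
  have t₁ := dtgt_bdry s 1
  have t₂ := dtgt_bdry s 2
  have t₃ := dtgt_bdry s 3
  simp only [Fin.isValue, Fin.reduceAdd] at t₀ t₁ t₂ t₃
  have eH : dtgt (cornerH s k) = dsrc (Z.bdry s (k + 1)) ∧
      dtgt (cornerV s k) = dsrc (Z.bdry s (k + 3)) ∧
      dtgt (cornerH s (k + 2)) = dsrc (Z.bdry s (k + 3)) ∨
      dtgt (cornerV s k) = dsrc (Z.bdry s (k + 1)) ∧
      dtgt (cornerH s k) = dsrc (Z.bdry s (k + 3)) ∧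
      dtgt (cornerH s (k + 2)) = dsrc (Z.bdry s (k + 1)) := by
    fin_cases k <;> simp [cornerH, cornerV, dtgt_drev, t₀, t₁, t₂, t₃]
  have hsw : hZ.sys.Swap (drev (cornerH s k)) (cornerV s k) (drev (cornerV s (k + 2)))
    (cornerH s (k + 2)) := ⟨s, k, rfl, rfl, rfl, rfl⟩
  have hH : hZ.Toward u (cornerH s k) := by
    rw [Toward, dsrc_cornerH]
    rcases eH with ⟨e, -, -⟩ | ⟨-, e, -⟩ <;> rw [e] <;> assumption
  have hV : hZ.Toward u (cornerV s k) := by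
    rw [Toward, dsrc_cornerV]
    rcases eH with ⟨-, e, -⟩ | ⟨e, -, -⟩ <;> rw [e] <;> assumption
  have hs := SwapSystem.shorter_of_square (s := hZ.nf u (dsrc (Z.bdry s k))) hsw
    (by
      change (hZ.sys.push _ (drev (drev (cornerH s k)))).length < _
      rw [drev_drev, ← dsrc_cornerH, ← hZ.nf_dtgt]
      exact hH)
    (by
      rw [← dsrc_cornerV, ← hZ.nf_dtgt]
      exact hV)
  have hend : dtgt (cornerV s k) = dsrc (drev (cornerH s (k + 2))) := by
    rw [dsrc_drev]
    rcases eH with ⟨-, e, e'⟩ | ⟨e, -, e'⟩ <;> rw [e, e']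
  change (hZ.sys.push (hZ.sys.push _ (cornerV s k)) (drev (cornerH s (k + 2)))).length <
    (hZ.sys.push _ (cornerV s k)).length at hs
  rw [← dsrc_cornerV, ← hZ.nf_dtgt, hend, ← hZ.nf_dtgt, ← hend, dtgt_drev, dsrc_cornerH] at hs
  have d₁ := hZ.dist_dart u (cornerV s k)
  have d₂ := hZ.dist_dart u (cornerH s (k + 2))
  rw [dsrc_cornerV] at d₁
  rw [dsrc_cornerH, ← dsrc_drev (cornerH s (k + 2)), ← hend] at d₂
  rw [Toward, dsrc_cornerV] at hV
  change hZ.dist _ _ < hZ.dist _ _ at hs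
  omega

/-- Opposite sides of a square lead towards the same vertices. -/
theorem toward_bdry (u : Z.V) (s : Z.S) (k : Fin 4) :
    hZ.Toward u (Z.bdry s k) ↔ ¬ hZ.Toward u (Z.bdry s (k + 2)) := by
  have d₀ := hZ.dist_dart u (Z.bdry s 0)
  have d₁ := hZ.dist_dart u (Z.bdry s 1)
  have d₂ := hZ.dist_dart u (Z.bdry s 2)
  have d₃ := hZ.dist_dart u (Z.bdry s 3)
  have o₀ := hZ.dist_opposite u s 0
  have o₁ := hZ.dist_opposite u s 1
  have o₂ := hZ.dist_opposite u s 2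
  have o₃ := hZ.dist_opposite u s 3
  simp only [dtgt_bdry, Fin.isValue, Fin.reduceAdd] at d₀ d₁ d₂ d₃ o₀ o₁ o₂ o₃
  fin_cases k <;> simp only [Toward, dtgt_bdry, Fin.isValue, Fin.reduceAdd, Fin.zero_eta,
    Fin.mk_one, Fin.reduceFinMk] <;> omega

/-- All edges dual to one hyperplane divide the vertices in the same way, up to orientation. -/
theorem toward_of_parallel {e e' : Z.E} (h : Parallel e e') :
    (∀ u, hZ.Toward u (e, true) ↔ hZ.Toward u (e', true)) ∨
      ∀ u, hZ.Toward u (e, true) ↔ ¬ hZ.Toward u (e', true) := by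
  have key : ∀ d : Z.Dart, (∀ u, hZ.Toward u d ↔ hZ.Toward u (d.1, true)) ∨
      ∀ u, hZ.Toward u d ↔ ¬ hZ.Toward u (d.1, true) := by
    rintro ⟨e, _ | _⟩
    · exact Or.inr fun u => hZ.toward_drev u (e, true)
    · exact Or.inl fun u => Iff.rfl
  induction h with
  | rel a b h =>
    obtain ⟨s, k, rfl, rfl⟩ := h
    have hb := fun u => hZ.toward_bdry u s k
    rcases key (Z.bdry s k) with h₁ | h₁ <;> rcases key (Z.bdry s (k + 2)) with h₂ | h₂
    · exact Or.inr fun u => by rw [← h₁, hb, h₂]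
    · exact Or.inl fun u => by rw [← h₁, hb, h₂, not_not]
    · exact Or.inl fun u => by rw [← not_iff_not, ← h₁, hb, h₂]
    · exact Or.inr fun u => by rw [← not_iff_not, ← h₁, hb, h₂]
  | refl => exact Or.inl fun _ => Iff.rfl
  | symm _ _ _ ih =>
    rcases ih with ih | ih
    · exact Or.inl fun u => (ih u).symm
    · exact Or.inr fun u => by rw [ih, not_not]
  | trans _ _ _ _ _ ih ih' =>
    rcases ih with ih | ih <;> rcases ih' with ih' | ih'
    · exact Or.inl fun u => (ih u).trans (ih' u)
    · exact Or.inr fun u => (ih u).trans (ih' u)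
    · exact Or.inr fun u => by rw [ih, ih']
    · exact Or.inl fun u => by rw [ih, ih', not_not]

theorem toward_of_parallel_dart {a b : Z.Dart} (h : Parallel a.1 b.1) :
    (∀ u, hZ.Toward u a ↔ hZ.Toward u b) ∨ ∀ u, hZ.Toward u a ↔ ¬ hZ.Toward u b := by
  rcases a with ⟨e, _ | _⟩ <;> rcases b with ⟨e', _ | _⟩ <;>
    rcases hZ.toward_of_parallel h with h | h <;>
    simp only [show ∀ e : Z.E, ((e, false) : Z.Dart) = drev (e, true) from fun _ => rfl,
      toward_drev, h, not_not] <;> tauto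

/-- An edge whose ends lie on different sides of a hyperplane is dual to it. -/
theorem parallel_of_toward {a e : Z.Dart} (h : hZ.Toward (dsrc e) a)
    (h' : ¬ hZ.Toward (dtgt e) a) : Parallel a.1 e.1 := by
  obtain ⟨n, hn⟩ : ∃ n, hZ.dist (dsrc e) (dtgt a) = n := ⟨_, rfl⟩
  induction n generalizing a with
  | zero =>
    have h₁ := hZ.eq_of_dist_eq_zero hn
    have h₂ : dtgt e = dsrc a := by
      have d₁ := hZ.dist_dart' (dtgt a) e
      have d₂ := hZ.dist_dart (dtgt e) a
      have d₃ := hZ.dist_dart' (dsrc a) e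
      have d₄ := hZ.dist_dart (dsrc e) a
      refine hZ.eq_of_dist_eq_zero ?_
      rw [Toward] at h h'
      omega
    have e₁ := hZ.nf_eq (isPath_single e)
    have e₂ := hZ.nf_eq (isPath_single (drev a))
    rw [dsrc_drev, dtgt_drev, ← h₁, ← h₂, e₁] at e₂
    simp only [List.foldl_cons, SwapSystem.push_nil, List.foldl_nil, List.cons.injEq,
      and_true] at e₂
    rw [e₂]
    exact Relation.EqvGen.refl _
  | succ n ih =>
    have d₁ := hZ.dist_dart' (dtgt a) e
    have d₂ := hZ.dist_dart (dtgt e) a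
    have d₃ := hZ.dist_dart' (dsrc a) e
    have d₄ := hZ.dist_dart (dsrc e) a
    have hT := h
    have hT' := h'
    rw [Toward] at h h'
    -- `c` is the first edge of a geodesic from `dsrc a` through `e`
    obtain ⟨c, hc, hcT⟩ := hZ.exists_toward (u := dtgt e) (p := dsrc a) (by
      intro heq
      have h₀ : hZ.dist (dtgt e) (dsrc a) = 0 := by rw [heq, dist_self]
      omega)
    have hca : a ≠ c := by
      rintro rfl
      exact hT' hcT
    have hcT' : hZ.Toward (dsrc e) c := by
      have d₅ := hZ.dist_dart' (dtgt c) e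
      have d₆ := hZ.dist_dart (dsrc e) c
      rw [Toward] at hcT ⊢
      rw [hc] at hcT d₆ ⊢
      omega
    obtain ⟨⟨s, k⟩, hsk⟩ := hZ.cornered_of_toward hca hc.symm hT hcT'
    rcases hsk with ⟨ha, hc'⟩ | ⟨hc', ha⟩
    · have hpar : Parallel a.1 (drev (Z.bdry s (k + 2))).1 :=
        Relation.EqvGen.rel _ _ ⟨s, k, by rw [← ha], rfl⟩
      have hb := fun u => hZ.toward_bdry u s k
      simp only at ha hc'
      rw [ha] at hb
      refine hpar.trans _ _ _ (ih (by rwa [toward_drev, ← hb]) (by rwa [toward_drev, ← hb]) ?_)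
      have e₁ : dsrc (drev (Z.bdry s (k + 2))) = dtgt c := by
        rw [dsrc_drev, ← hc', dtgt_drev, dtgt_bdry]
        congr 2
        fin_cases k <;> rfl
      have hT₂ : hZ.Toward (dsrc e) (drev (Z.bdry s (k + 2))) := by rwa [toward_drev, ← hb]
      have d₅ := hZ.dist_dart (dsrc e) (drev (Z.bdry s (k + 2)))
      have d₆ := hZ.dist_dart (dsrc e) c
      rw [Toward, e₁] at hT₂
      rw [e₁] at d₅
      rw [Toward, hc] at hcT'
      rw [hc] at d₆
      omega
    · have hpar : Parallel a.1 (Z.bdry s (k + 1)).1 := by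
        refine Relation.EqvGen.rel _ _ ⟨s, k - 1, by rw [← ha]; rfl, ?_⟩
        congr 2
        fin_cases k <;> rfl
      simp only at ha hc'
      have hb : ∀ u, hZ.Toward u a ↔ hZ.Toward u (Z.bdry s (k + 1)) := by
        intro u
        have := hZ.toward_bdry u s (k - 1)
        rw [← ha, toward_drev, this, not_not]
        have hk : k - 1 + 2 = k + 1 := by fin_cases k <;> rfl
        rw [hk]
      refine hpar.trans _ _ _ (ih (by rwa [← hb]) (by rwa [← hb]) ?_)
      have e₁ : dsrc (Z.bdry s (k + 1)) = dtgt c := by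
        rw [← hc', dtgt_bdry]
      have hT₂ : hZ.Toward (dsrc e) (Z.bdry s (k + 1)) := by rwa [← hb]
      have d₅ := hZ.dist_dart (dsrc e) (Z.bdry s (k + 1))
      have d₆ := hZ.dist_dart (dsrc e) c
      rw [Toward, e₁] at hT₂
      rw [e₁] at d₅
      rw [Toward, hc] at hcT'
      rw [hc] at d₆
      omega

/-- A path that does not cross the hyperplane of `a` stays on its side. -/
theorem toward_of_mem_side {u : Z.V} {a : Z.Dart} (h : u ∈ side a) : hZ.Toward u a := by
  obtain ⟨l, hl, hpar⟩ := h
  have key : ∀ (l : List Z.Dart) (v : Z.V), IsPath v l u → hZ.Toward v a →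
      (∀ d ∈ l, ¬ Parallel a.1 d.1) → hZ.Toward u a := by
    intro l
    induction l with
    | nil =>
      rintro v rfl hv -
      exact hv
    | cons d l ih =>
      rintro v ⟨rfl, hl⟩ hv hd
      refine ih _ hl ?_ fun d' hd' => hd d' (List.mem_cons_of_mem _ hd')
      by_contra hcon
      exact hd d List.mem_cons_self (hZ.parallel_of_toward hv hcon)
  exact key l _ hl (hZ.toward_dtgt a) hpar

/-- A geodesic from the end of `a` to a vertex on its side does not cross the hyperplane of `a`. -/
theorem mem_side_of_toward {u : Z.V} {a : Z.Dart} (h : hZ.Toward u a) : u ∈ side a := by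
  obtain ⟨l, hl, hlen⟩ := hZ.exists_geodesic (dtgt a) u
  refine ⟨l, hl, fun e he hpar => ?_⟩
  obtain ⟨l₁, l₂, rfl⟩ := List.append_of_mem he
  obtain ⟨v, h₁, rfl, h₂⟩ := hl.of_append
  have b₁ := hZ.dist_le h₁
  have b₂ := hZ.dist_le h₂
  have t₁ := hZ.dist_triangle (dtgt a) (dtgt e) u
  have t₂ := hZ.dist_triangle (dsrc a) (dtgt e) u
  have b₃ := hZ.dist_le (l := a :: l₁) ⟨rfl, h₁⟩
  simp only [List.length_append, List.length_cons] at hlen b₃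
  rw [Toward, hZ.dist_comm u, hZ.dist_comm u] at h
  -- both ends of `a` are farther from the end of `e` than from its beginning
  have n₁ : ¬ hZ.Toward (dtgt a) e := by
    rw [Toward]
    omega
  have n₂ : ¬ hZ.Toward (dsrc a) e := by
    rw [Toward]
    omega
  have t := hZ.toward_dtgt a
  have t' := hZ.not_toward_dsrc a
  rcases hZ.toward_of_parallel_dart hpar with hp | hp
  · exact n₁ ((hp _).1 t)
  · exact t' ((hp _).2 n₂)

/-- Halfspaces in terms of distances. -/
theorem mem_side_iff {u : Z.V} {a : Z.Dart} : u ∈ side a ↔ hZ.Toward u a :=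
  ⟨hZ.toward_of_mem_side, hZ.mem_side_of_toward⟩

end IsCAT0VH

end SquareComplex

/-! ### Ends of graphs -/

namespace SimpleGraph

variable {V W : Type}

/-- Two vertices are joined by a path that avoids `K`. -/
def JoinedOff (Γ : SimpleGraph V) (K : Set V) : V → V → Prop :=
  Relation.ReflTransGen fun a b => Γ.Adj a b ∧ a ∉ K ∧ b ∉ K

/-- Outside every finite set of vertices, all but finitely many vertices can be joined to each
other. For infinite, connected, locally finite graphs this is one-endedness. -/
def ConnectedAtInfinity (Γ : SimpleGraph V) : Prop :=
  ∀ K : Set V, K.Finite → ∃ K' : Set V, K'.Finite ∧ ∀ u v, u ∉ K' → v ∉ K' → Γ.JoinedOff K u v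

variable {Γ : SimpleGraph V}

theorem JoinedOff.symm {K : Set V} {u v : V} (h : Γ.JoinedOff K u v) : Γ.JoinedOff K v u := by
  induction h with
  | refl => exact Relation.ReflTransGen.refl
  | tail _ h ih => exact Relation.ReflTransGen.head ⟨h.1.symm, h.2.2, h.2.1⟩ ih

theorem JoinedOff.mono {K K' : Set V} (hK : K ⊆ K') {u v : V} (h : Γ.JoinedOff K' u v) :
    Γ.JoinedOff K u v := by
  induction h with
  | refl => exact Relation.ReflTransGen.refl
  | tail _ h ih => exact ih.tail ⟨h.1, fun h' => h.2.1 (hK h'), fun h' => h.2.2 (hK h')⟩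

theorem JoinedOff.componentComplMk_eq {K : Set V} {u v : V} (h : Γ.JoinedOff K u v) (hu : u ∉ K)
    (hv : v ∉ K) : Γ.componentComplMk hu = Γ.componentComplMk hv := by
  induction h with
  | refl => rfl
  | tail _ hbc ih => exact (ih hbc.2.1).trans (componentComplMk_eq_of_adj Γ hbc.2.1 hv hbc.1)

theorem joinedOff_of_componentComplMk_eq {K : Set V} {u v : V} {hu : u ∉ K} {hv : v ∉ K}
    (h : Γ.componentComplMk hu = Γ.componentComplMk hv) : Γ.JoinedOff K u v := by
  obtain ⟨w⟩ := ConnectedComponent.exact h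
  have key : ∀ {a b : ↥Kᶜ}, (Γ.induce Kᶜ).Walk a b → Γ.JoinedOff K a b := by
    intro a b w
    induction w with
    | nil => exact Relation.ReflTransGen.refl
    | @cons a b _ h _ ih => exact Relation.ReflTransGen.head ⟨h, a.2, b.2⟩ ih
  exact key w

theorem Walk.joinedOff {K : Set V} {u v : V} (w : Γ.Walk u v) (h : ∀ z ∈ w.support, z ∉ K) :
    Γ.JoinedOff K u v := by
  induction w with
  | nil => exact Relation.ReflTransGen.refl
  | cons hadj w ih =>
    refine Relation.ReflTransGen.head ⟨hadj, h _ (by simp), h _ (by simp)⟩ (ih fun z hz => ?_)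
    exact h z (by simp [hz])

theorem OneEnded.infinite (h : Γ.OneEnded) : Infinite V := by
  by_contra hfin
  rw [not_infinite_iff_finite] at hfin
  obtain ⟨ε, hε, -⟩ := h
  exact IsEmpty.false (α := Γ.end) ⟨ε, hε⟩

theorem ConnectedAtInfinity.oneEnded [Infinite V] (hfin : ∀ v, (Γ.neighborSet v).Finite)
    (hconn : Γ.Preconnected) (h : Γ.ConnectedAtInfinity) : Γ.OneEnded := by
  classical
  let _ : LocallyFinite Γ := fun v => (hfin v).fintype
  have : Fact Γ.Preconnected := ⟨hconn⟩
  obtain ⟨ε, hε⟩ := Γ.nonempty_ends_of_infinite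
  refine ⟨ε, hε, fun ε' hε' => funext fun K => ?_⟩
  obtain ⟨K', hK', hjoin⟩ := h K.unop (Finset.finite_toSet _)
  set L : (Finset V)ᵒᵖ := Opposite.op (K.unop ∪ hK'.toFinset) with hL
  have hKL : K.unop ⊆ L.unop := Finset.subset_union_left
  obtain ⟨v, hv, hεv⟩ := (ε L).exists_eq_mk
  obtain ⟨v', hv', hεv'⟩ := (ε' L).exists_eq_mk
  rw [Γ.end_hom_mk_of_mk hε (CategoryTheory.opHomOfLE hKL) hv hεv.symm,
    Γ.end_hom_mk_of_mk hε' (CategoryTheory.opHomOfLE hKL) hv' hεv'.symm]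
  refine JoinedOff.componentComplMk_eq (hjoin _ _ ?_ ?_) _ _
  · exact fun hm => hv' (by simp [hL, hm])
  · exact fun hm => hv (by simp [hL, hm])

/-- Every infinite component of the complement of a finite set contains an end, because the sets of
components are finite and hence form a Mittag-Leffler system. -/
theorem OneEnded.connectedAtInfinity (hfin : ∀ v, (Γ.neighborSet v).Finite)
    (hconn : Γ.Preconnected) (h : Γ.OneEnded) : Γ.ConnectedAtInfinity := by
  classical
  let _ : LocallyFinite Γ := fun v => (hfin v).fintype
  have : Fact Γ.Preconnected := ⟨hconn⟩
  have := h.infinite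
  intro K hK
  obtain ⟨K, rfl⟩ := hK.exists_finset_coe
  -- all finite components of the complement of `K` are thrown into the larger set
  set K' : Set V := K ∪ ⋃ C : {C : Γ.ComponentCompl (K : Set V) // C.supp.Finite}, C.1.supp
  have hK' : K'.Finite := K.finite_toSet.union (Set.finite_iUnion fun C => C.2)
  have hinf : ∀ v, v ∉ K' → ∃ hv : v ∉ (K : Set V), (Γ.componentComplMk hv).supp.Infinite := by
    intro v hv
    refine ⟨fun hm => hv (Or.inl hm), fun hf => hv (Or.inr ?_)⟩
    exact Set.mem_iUnion.2 ⟨⟨_, hf⟩, Γ.componentComplMk_mem _⟩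
  set F := Γ.componentComplFunctor
  have hML : F.IsMittagLeffler := F.isMittagLeffler_of_exists_finite_range fun j =>
    ⟨j, CategoryTheory.CategoryStruct.id j, Set.toFinite _⟩
  have := F.toEventualRanges_nonempty hML
  have hend : ∀ C : Γ.ComponentCompl (K : Set V), C.supp.Infinite →
      ∃ ε ∈ Γ.end, ε (Opposite.op K) = C := by
    intro C hC
    have hC' := (Γ.infinite_iff_in_eventualRange (K := Opposite.op K) C).1 hC
    obtain ⟨s, hs⟩ := F.toEventualRanges.eval_section_surjective_of_surjective
      (F.surjective_toEventualRanges hML) (Opposite.op K) ⟨C, hC'⟩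
    refine ⟨_, (F.toEventualRangesSectionsEquiv s).2, ?_⟩
    exact congrArg Subtype.val hs
  refine ⟨K', hK', fun u v hu hv => ?_⟩
  obtain ⟨hu', hui⟩ := hinf u hu
  obtain ⟨hv', hvi⟩ := hinf v hv
  obtain ⟨ε, hε, hεu⟩ := hend _ hui
  obtain ⟨ε', hε', hεv⟩ := hend _ hvi
  have : ε = ε' := h.unique hε hε'
  exact joinedOff_of_componentComplMk_eq (hεu.symm.trans (this ▸ hεv))

/-- A ray without repetitions determines an end. -/
theorem exists_end_of_ray {r : ℕ → V} (hadj : ∀ n, Γ.Adj (r n) (r (n + 1)))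
    (hinj : Function.Injective r) :
    ∃ ε ∈ Γ.end, ∀ K : Finset V, ∃ N, ∀ n ≥ N, ∃ h : r n ∉ K,
      ε (Opposite.op K) = Γ.componentComplMk h := by
  have hout : ∀ K : Finset V, ∃ N, ∀ n ≥ N, r n ∉ K := by
    intro K
    obtain ⟨N, hN⟩ := ((K.finite_toSet.preimage hinj.injOn).bddAbove)
    exact ⟨N + 1, fun n hn hm => absurd (hN hm) (by omega)⟩
  choose N hN using hout
  have hcomp : ∀ (K : Finset V) (n m : ℕ) (hn : N K ≤ n) (hnm : n ≤ m),
      Γ.componentComplMk (hN K n hn) = Γ.componentComplMk (hN K m (hn.trans hnm)) := by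
    intro K n m hn hnm
    induction m, hnm using Nat.le_induction with
    | base => rfl
    | succ m hnm ih =>
      exact ih.trans (componentComplMk_eq_of_adj Γ _ _ (hadj m))
  refine ⟨fun K => Γ.componentComplMk (hN K.unop _ le_rfl), ?_, fun K => ⟨N K, fun n hn =>
    ⟨hN K n hn, hcomp K _ _ le_rfl hn⟩⟩⟩
  intro K L f
  have hLK : L.unop ⊆ K.unop := CategoryTheory.le_of_op_hom f
  change Γ.componentComplMk (fun hm => hN K.unop _ le_rfl (hLK hm)) = _
  set n := max (N K.unop) (N L.unop)
  refine Eq.trans ?_ (hcomp L.unop (N L.unop) n le_rfl (le_max_right _ _)).symm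
  have h₁ := hcomp K.unop (N K.unop) n le_rfl (le_max_left _ _)
  exact (joinedOff_of_componentComplMk_eq h₁).mono hLK |>.componentComplMk_eq _ _

/-- The ball of radius `N` around a set of vertices. -/
def ballAround (Γ : SimpleGraph V) (N : ℕ) (S : Set V) : Set V :=
  {y | ∃ x ∈ S, ∃ w : Γ.Walk y x, w.length ≤ N}

theorem ballAround_finite (hfin : ∀ v, (Γ.neighborSet v).Finite) (N : ℕ) {S : Set V}
    (hS : S.Finite) : (Γ.ballAround N S).Finite := by
  induction N with
  | zero =>
    refine hS.subset ?_
    rintro y ⟨x, hx, w, hw⟩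
    exact (Walk.eq_of_length_eq_zero (Nat.le_zero.1 hw)) ▸ hx
  | succ N ih =>
    refine (ih.union (ih.biUnion fun v _ => hfin v)).subset ?_
    rintro y ⟨x, hx, w, hw⟩
    cases w with
    | nil => exact Or.inl ⟨_, hx, Walk.nil, Nat.zero_le _⟩
    | @cons _ z _ h w =>
      refine Or.inr (Set.mem_biUnion (x := z) ⟨_, hx, w, ?_⟩ h.symm)
      simpa using hw

theorem Walk.joinedOff_of_notMem_ballAround {K : Set V} {N : ℕ} {u v : V} (w : Γ.Walk u v)
    (hw : w.length ≤ N) (hu : u ∉ Γ.ballAround N K) : Γ.JoinedOff K u v := by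
  classical
  refine w.joinedOff fun z hz hzK => hu ⟨z, hzK, w.takeUntil z hz, ?_⟩
  exact (w.length_takeUntil_le_length hz).trans hw

/-- Connectedness at infinity passes along coarsely surjective Lipschitz maps with finite fibres. -/
theorem ConnectedAtInfinity.map {Γ' : SimpleGraph W} (h : Γ.ConnectedAtInfinity) (f : V → W)
    (N : ℕ) (hfin : ∀ v, (Γ'.neighborSet v).Finite) (hfib : ∀ y, (f ⁻¹' {y}).Finite)
    (hadj : ∀ a b, Γ.Adj a b → ∃ w : Γ'.Walk (f a) (f b), w.length ≤ N)
    (hdense : ∀ y, ∃ x, ∃ w : Γ'.Walk y (f x), w.length ≤ N) : Γ'.ConnectedAtInfinity := by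
  have hpre : ∀ S : Set W, S.Finite → (f ⁻¹' S).Finite := fun S hS => by
    rw [← Set.biUnion_preimage_singleton]
    exact hS.biUnion fun y _ => hfib y
  intro K hK
  have hB := ballAround_finite hfin N hK
  obtain ⟨K₁, hK₁, hjoin⟩ := h _ (hpre _ hB)
  refine ⟨_, hB.union (ballAround_finite hfin N (hK₁.image f)), fun u v hu hv => ?_⟩
  have hout : ∀ u, u ∉ Γ'.ballAround N K ∪ Γ'.ballAround N (f '' K₁) →
      ∃ x, x ∉ K₁ ∧ Γ'.JoinedOff K u (f x) := by
    intro u hu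
    obtain ⟨x, w, hw⟩ := hdense u
    exact ⟨x, fun hx => hu (Or.inr ⟨f x, ⟨x, hx, rfl⟩, w, hw⟩),
      w.joinedOff_of_notMem_ballAround hw fun hu' => hu (Or.inl hu')⟩
  obtain ⟨x, hx, hux⟩ := hout u hu
  obtain ⟨y, hy, hvy⟩ := hout v hv
  refine Relation.ReflTransGen.trans hux (Relation.ReflTransGen.trans ?_ hvy.symm)
  have key : ∀ x y, Γ.JoinedOff (f ⁻¹' Γ'.ballAround N K) x y → Γ'.JoinedOff K (f x) (f y) := by
    intro x y hxy
    induction hxy with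
    | refl => exact Relation.ReflTransGen.refl
    | tail _ hbc ih =>
      obtain ⟨w, hw⟩ := hadj _ _ hbc.1
      exact ih.trans (w.joinedOff_of_notMem_ballAround hw hbc.2.1)
  exact key x y (hjoin x y hx hy)

end SimpleGraph

/-! ### Straight rays, cut vertices and links -/

namespace SquareComplex

variable {Z : SquareComplex} {hor : Z.E → Prop}

theorem exists_dart_of_adj {u v : Z.V} (h : Z.skeleton.Adj u v) :
    ∃ d : Z.Dart, dsrc d = u ∧ dtgt d = v := by
  rw [skeleton, SimpleGraph.fromRel_adj] at h
  rcases h.2 with ⟨e, h₁, h₂⟩ | ⟨e, h₁, h₂⟩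
  · exact ⟨(e, true), h₁, h₂⟩
  · exact ⟨(e, false), h₂, h₁⟩

theorem adj_of_ne (d : Z.Dart) (h : dsrc d ≠ dtgt d) : Z.skeleton.Adj (dsrc d) (dtgt d) := by
  rw [skeleton, SimpleGraph.fromRel_adj]
  rcases d with ⟨e, _ | _⟩
  · exact ⟨h, Or.inr ⟨e, rfl, rfl⟩⟩
  · exact ⟨h, Or.inl ⟨e, rfl, rfl⟩⟩

theorem LocallyFinite.neighborSet_finite (h : Z.LocallyFinite) (v : Z.V) :
    (Z.skeleton.neighborSet v).Finite := by
  refine ((h v).1.image dtgt).subset ?_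
  intro u hu
  obtain ⟨d, h₁, h₂⟩ := exists_dart_of_adj hu
  exact ⟨d, h₁, h₂⟩

/-- An edge path gives a walk in the 1-skeleton that is not longer. -/
theorem exists_walk_of_isPath {u v : Z.V} {l : List Z.Dart} (h : IsPath u l v) :
    ∃ w : Z.skeleton.Walk u v, w.length ≤ l.length := by
  induction l generalizing u with
  | nil =>
    cases h
    exact ⟨SimpleGraph.Walk.nil, le_rfl⟩
  | cons d l ih =>
    obtain ⟨rfl, h⟩ := h
    obtain ⟨w, hw⟩ := ih h
    by_cases hd : dsrc d = dtgt d
    · rw [hd]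
      exact ⟨w, hw.trans (Nat.le_succ _)⟩
    · exact ⟨SimpleGraph.Walk.cons (adj_of_ne d hd) w, by simpa using hw⟩

theorem Connected.preconnected (h : Z.Connected) : Z.skeleton.Preconnected := fun u v => by
  obtain ⟨⟨l, hl⟩⟩ := h.2 u v
  exact ⟨(exists_walk_of_isPath hl).choose⟩

/-- At the end of every oriented edge there is one that continues it without a turn, that is, at
distance more than one in the link. -/
def Extendable (Z : SquareComplex) : Prop :=
  ∀ a : Z.Dart, ∃ b, dsrc b = dsrc a ∧ b ≠ a ∧ ¬ Cornered a b

/-- Every link stays connected when a set of pairwise adjacent vertices is removed from it. -/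
def PuncturedLinksConnected (Z : SquareComplex) : Prop :=
  ∀ (v : Z.V) (D : Set Z.Dart),
    (∀ a ∈ D, ∀ b ∈ D, a ≠ b → dsrc a = v → dsrc b = v → Cornered a b) →
    ∀ α β, dsrc α = v → dsrc β = v → α ∉ D → β ∉ D →
      Relation.ReflTransGen (fun a b => Cornered a b ∧ a ∉ D ∧ b ∉ D) α β

/-- A sequence of oriented edges that goes straight on at each vertex. -/
def IsStraight (D : ℕ → Z.Dart) : Prop :=
  ∀ n, dsrc (D (n + 1)) = dtgt (D n) ∧ D (n + 1) ≠ drev (D n) ∧ ¬ Cornered (drev (D n)) (D (n + 1))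

theorem Extendable.exists_straight (h : Extendable Z) (a : Z.Dart) :
    ∃ D : ℕ → Z.Dart, D 0 = a ∧ IsStraight D := by
  choose next h₁ h₂ h₃ using fun a : Z.Dart => h (drev a)
  refine ⟨fun n => n.rec a fun _ d => next d, rfl, fun n => ⟨?_, h₂ _, h₃ _⟩⟩
  exact (h₁ _).trans (dsrc_drev _)

theorem IsStraight.tail {D : ℕ → Z.Dart} (h : IsStraight D) (m : ℕ) :
    IsStraight fun n => D (m + n) := fun n => h (m + n)

namespace IsCAT0VH

variable (hZ : IsCAT0VH Z hor)

theorem dsrc_ne_dtgt (hZ : IsCAT0VH Z hor) (d : Z.Dart) : dsrc d ≠ dtgt d := fun h => by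
  have := hZ.dist_dart (dsrc d) d
  rw [← h] at this
  omega

theorem adj_dart (hZ : IsCAT0VH Z hor) (d : Z.Dart) : Z.skeleton.Adj (dsrc d) (dtgt d) :=
  adj_of_ne d (hZ.dsrc_ne_dtgt d)

theorem dist_le_length {u v : Z.V} (w : Z.skeleton.Walk u v) : hZ.dist u v ≤ w.length := by
  induction w with
  | nil => simp
  | cons h w ih =>
    obtain ⟨d, rfl, rfl⟩ := exists_dart_of_adj h
    have t := hZ.dist_triangle (dsrc d) (dtgt d) _ |>.trans (Nat.add_le_add_left ih _)
    have h₁ := hZ.dist_le (isPath_single d)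
    simp only [List.length_cons, List.length_nil, SimpleGraph.Walk.length_cons] at h₁ ⊢
    omega

/-- A straight ray whose first edge leads away from `u` moves away from `u` forever. -/
theorem dist_straight {D : ℕ → Z.Dart} (hD : IsStraight D) {u : Z.V} (h : ¬ hZ.Toward u (D 0))
    (n : ℕ) : hZ.dist u (dtgt (D n)) = hZ.dist u (dsrc (D 0)) + n + 1 := by
  have key : ∀ n, ¬ hZ.Toward u (D n) := by
    intro n
    induction n with
    | zero => exact h
    | succ n ih =>
      intro hT
      obtain ⟨h₁, h₂, h₃⟩ := hD n
      exact h₃ (hZ.cornered_of_toward h₂.symm ((dsrc_drev _).trans h₁.symm)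
        ((hZ.toward_drev _ _).2 ih) hT)
  have step : ∀ n, hZ.dist u (dtgt (D n)) = hZ.dist u (dsrc (D n)) + 1 := fun n => by
    have h₁ := key n
    have h₂ := hZ.dist_dart u (D n)
    rw [Toward] at h₁
    omega
  induction n with
  | zero => exact step 0
  | succ n ih => rw [step, (hD n).1, ih]; omega

/-- A straight ray stays in the halfspace that it enters with its first edge. -/
theorem toward_straight {D : ℕ → Z.Dart} (hD : IsStraight D) (n : ℕ) :
    hZ.Toward (dtgt (D n)) (D 0) := by
  have key : hZ.dist (dtgt (D 0)) (dtgt (D n)) ≤ n := by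
    induction n with
    | zero => simp
    | succ n ih =>
      refine (hZ.dist_triangle _ (dtgt (D n)) _).trans ?_
      have := hZ.dist_le (isPath_single (D (n + 1)))
      rw [(hD n).1] at this
      simp only [List.length_cons, List.length_nil] at this
      omega
  have := hZ.dist_straight hD (hZ.not_toward_dsrc (D 0)) n
  rw [dist_self] at this
  rw [Toward, hZ.dist_comm _ (dtgt (D 0)), hZ.dist_comm _ (dsrc (D 0))]
  omega

theorem straight_injective (hZ : IsCAT0VH Z hor) {D : ℕ → Z.Dart} (hD : IsStraight D) :
    Function.Injective fun n => dsrc (D n) := by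
  have key : ∀ m n, m < n → dsrc (D m) ≠ dsrc (D n) := by
    intro m n hmn heq
    have hn : dsrc (D n) = dtgt (D (m + (n - m - 1))) := by
      rw [← (hD _).1]
      congr 2
      omega
    have := hZ.dist_straight (hD.tail m) (hZ.not_toward_dsrc (D m)) (n - m - 1)
    rw [← hn, ← heq] at this
    simp at this
  intro m n h
  by_contra hne
  rcases Nat.lt_or_gt_of_ne hne with hlt | hlt
  · exact key m n hlt h
  · exact key n m hlt h.symm

/-- If edges can always be continued straight on, then no halfspace is shallow. -/
theorem essential (hZ : IsCAT0VH Z hor) (h : Extendable Z) : Z.Essential := by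
  rintro _ ⟨a, rfl⟩ ⟨R, hR⟩
  obtain ⟨D, hD₀, hD⟩ := h.exists_straight a
  obtain ⟨u, hu, hdist⟩ := hR (dtgt (D R)) (by
    rw [hZ.mem_side_iff, ← hD₀]
    exact hZ.toward_straight hD R)
  rw [Set.mem_compl_iff, hZ.mem_side_iff, ← hD₀] at hu
  have h₁ := hZ.dist_straight hD hu R
  obtain ⟨w, hw⟩ := SimpleGraph.exists_walk_of_edist_ne_top
    (ne_top_of_le_ne_top (ENat.natCast_ne_top R) hdist)
  have h₂ := hZ.dist_le_length w
  rw [← hw, Nat.cast_le] at hdist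
  omega

/-- Edges at `p` that are not joined in the link lead to parts of the complex that are not
adjacent to each other. -/
theorem not_adj_of_toward {u u' : Z.V} {d d' : Z.Dart} (hsrc : dsrc d = dsrc d') (hne : d ≠ d')
    (hc : ¬ Cornered d d') (hd : hZ.Toward u d) (hd' : hZ.Toward u' d') :
    ¬ Z.skeleton.Adj u u' := by
  intro hadj
  obtain ⟨e, rfl, rfl⟩ := exists_dart_of_adj hadj
  have n₁ : ¬ hZ.Toward (dsrc e) d' := fun h => hc (hZ.cornered_of_toward hne hsrc hd h)
  have n₂ : ¬ hZ.Toward (dtgt e) d := fun h => hc (hZ.cornered_of_toward hne hsrc h hd')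
  have a₁ := hZ.dist_dart' (dtgt d) e
  have a₂ := hZ.dist_dart' (dtgt d') e
  have a₃ := hZ.dist_dart' (dsrc d') e
  rw [Toward] at hd hd' n₁ n₂
  rw [hsrc] at hd n₂
  omega

/-- A vertex `p` at which two sets of edges are not joined in the link separates the parts to which
these lead, as long as only these directions occur. -/
theorem not_joinedOff {p : Z.V} {S K : Set Z.V} {Γ : SimpleGraph S}
    (hΓ : ∀ a b, Γ.Adj a b → Z.skeleton.Adj a b) {A B : Set Z.Dart}
    (hA : ∀ d ∈ A, dsrc d = p) (hB : ∀ d ∈ B, dsrc d = p)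
    (hAB : ∀ d ∈ A, ∀ d' ∈ B, d ≠ d' ∧ ¬ Cornered d d')
    (hcover : ∀ u ∈ S, u ∉ K → ∃ d ∈ A ∪ B, hZ.Toward u d) {u v : S}
    {d d' : Z.Dart} (hd : d ∈ A) (hd' : d' ∈ B) (hu : hZ.Toward u d) (hv : hZ.Toward v d') :
    ¬ Γ.JoinedOff (Subtype.val ⁻¹' K) u v := by
  intro h
  have key : ∀ w : S, Γ.JoinedOff (Subtype.val ⁻¹' K) u w → ∃ a ∈ A, hZ.Toward w a := by
    intro w hw
    induction hw with
    | refl => exact ⟨d, hd, hu⟩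
    | @tail b c _ hbc ih =>
      obtain ⟨a, ha, hba⟩ := ih
      obtain ⟨e, he | he, hce⟩ := hcover c c.2 hbc.2.2
      · exact ⟨e, he, hce⟩
      · obtain ⟨h₁, h₂⟩ := hAB a ha e he
        exact absurd (hΓ _ _ hbc.1)
          (hZ.not_adj_of_toward ((hA a ha).trans (hB e he).symm) h₁ h₂ hba hce)
  obtain ⟨a, ha, hva⟩ := key v h
  obtain ⟨h₁, h₂⟩ := hAB a ha d' hd'
  exact h₂ (hZ.cornered_of_toward h₁ ((hA a ha).trans (hB d' hd').symm) hva hv)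

theorem finite_setOf_dist_lt (hfin : Z.LocallyFinite) (p : Z.V) (r : ℕ) :
    {x | hZ.dist p x < r}.Finite := by
  refine (SimpleGraph.ballAround_finite hfin.neighborSet_finite r (Set.finite_singleton p)).subset
    fun x hx => ?_
  obtain ⟨l, hl, hlen⟩ := hZ.exists_geodesic x p
  obtain ⟨w, hw⟩ := exists_walk_of_isPath hl
  rw [hZ.dist_comm] at hlen
  rw [Set.mem_ofPred_eq] at hx
  exact ⟨p, rfl, w, by omega⟩

/-- Two edges of a square that lead away from `p` can be replaced by the two other sides, which lie
farther away from `p`. -/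
theorem joinedOff_of_cornered {p : Z.V} {a b : Z.Dart} (h : Cornered a b) (ha : ¬ hZ.Toward p a)
    (hb : ¬ hZ.Toward p b) :
    Z.skeleton.JoinedOff {x | hZ.dist p x < hZ.dist p (dsrc a) + 1} (dtgt a) (dtgt b) := by
  obtain ⟨⟨s, k⟩, hsk⟩ := h
  have t₀ := dtgt_bdry s 0
  have t₁ := dtgt_bdry s 1
  have t₂ := dtgt_bdry s 2
  have t₃ := dtgt_bdry s 3
  simp only [Fin.isValue, Fin.reduceAdd] at t₀ t₁ t₂ t₃
  have hk : ∀ k : Fin 4, dtgt (drev (Z.bdry s (k - 1))) = dsrc (Z.bdry s (k + 3)) ∧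
      dsrc (drev (Z.bdry s (k - 1))) = dsrc (Z.bdry s k) := by
    intro k
    have e₀ : (0 : Fin 4) - 1 = 3 := rfl
    have e₂ : (2 : Fin 4) - 1 = 1 := rfl
    have e₃ : (3 : Fin 4) - 1 = 2 := rfl
    fin_cases k <;> simp [dtgt_drev, dsrc_drev, t₀, t₁, t₂, t₃, e₀, e₂, e₃]
  have key : ¬ hZ.Toward p (Z.bdry s k) → ¬ hZ.Toward p (drev (Z.bdry s (k - 1))) →
      Z.skeleton.JoinedOff {x | hZ.dist p x < hZ.dist p (dsrc (Z.bdry s k)) + 1}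
        (dsrc (Z.bdry s (k + 1))) (dsrc (Z.bdry s (k + 3))) := by
    intro h₁ h₂
    rw [Toward, dtgt_bdry] at h₁
    rw [Toward, (hk k).1, (hk k).2] at h₂
    have d₀ := hZ.dist_dart p (Z.bdry s 0)
    have d₁ := hZ.dist_dart p (Z.bdry s 1)
    have d₂ := hZ.dist_dart p (Z.bdry s 2)
    have d₃ := hZ.dist_dart p (Z.bdry s 3)
    have o := hZ.dist_opposite p s (k + 1)
    have hk₁ : k + 1 + 1 = k + 2 := by fin_cases k <;> rfl
    have hk₂ : k + 1 + 2 = k + 3 := by fin_cases k <;> rfl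
    have hk₃ : k + 1 + 3 = k := by fin_cases k <;> rfl
    rw [hk₁, hk₂, hk₃] at o
    simp only [dtgt_bdry, Fin.isValue, Fin.reduceAdd] at d₀ d₁ d₂ d₃
    have far : hZ.dist p (dsrc (Z.bdry s k)) < hZ.dist p (dsrc (Z.bdry s (k + 1))) ∧
        hZ.dist p (dsrc (Z.bdry s k)) < hZ.dist p (dsrc (Z.bdry s (k + 2))) ∧
        hZ.dist p (dsrc (Z.bdry s k)) < hZ.dist p (dsrc (Z.bdry s (k + 3))) := by
      clear hsk hk hk₁ hk₂ hk₃
      fin_cases k <;> simp only [Fin.isValue, Fin.reduceAdd, Fin.zero_eta,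
        Fin.mk_one, Fin.reduceFinMk] at h₁ h₂ o ⊢ <;> omega
    have a₁ := hZ.adj_dart (Z.bdry s (k + 1))
    have a₂ := hZ.adj_dart (Z.bdry s (k + 2))
    rw [dtgt_bdry, hk₁] at a₁
    have hk₄ : k + 2 + 1 = k + 3 := by fin_cases k <;> rfl
    rw [dtgt_bdry, hk₄] at a₂
    refine (Relation.ReflTransGen.single ⟨a₁, ?_, ?_⟩).tail ⟨a₂, ?_, ?_⟩ <;>
      rw [Set.mem_ofPred_eq] <;> omega
  rcases hsk with ⟨rfl, rfl⟩ | ⟨rfl, rfl⟩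
  · rw [dtgt_bdry, (hk k).1]
    exact key ha hb
  · rw [dtgt_bdry, (hk k).1, (hk k).2]
    exact (key hb ha).symm

/-- If no link is disconnected by removing the empty set, a vertex or an edge, then the complex is
connected at infinity: paths can be pushed away from a given vertex through the links. -/
theorem connectedAtInfinity_of_links (hZ : IsCAT0VH Z hor) (hfin : Z.LocallyFinite)
    (hlink : PuncturedLinksConnected Z) :
    Z.skeleton.ConnectedAtInfinity := by
  obtain ⟨p⟩ := hZ.simplyConnected.1.1
  -- edges at one vertex that lead away from `p` end in the same piece of the next level set: the
  -- edges that lead towards `p` form a clique in the link, and the rest of the link is connected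
  have hup : ∀ α β : Z.Dart, dsrc α = dsrc β → ¬ hZ.Toward p α → ¬ hZ.Toward p β →
      Z.skeleton.JoinedOff {x | hZ.dist p x < hZ.dist p (dsrc α) + 1} (dtgt α) (dtgt β) := by
    intro α β hαβ hα hβ
    have h := hlink (dsrc α) {d | hZ.Toward p d}
      (fun a ha b hb hab h₁ h₂ => hZ.cornered_of_toward hab (h₁.trans h₂.symm) ha hb)
      α β rfl hαβ.symm hα hβ
    clear hβ hαβ
    have key : dsrc β = dsrc α ∧ Z.skeleton.JoinedOff
        {x | hZ.dist p x < hZ.dist p (dsrc α) + 1} (dtgt α) (dtgt β) := by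
      induction h with
      | refl => exact ⟨rfl, Relation.ReflTransGen.refl⟩
      | tail _ hbc ih =>
        obtain ⟨hbc, hb, hc⟩ := hbc
        refine ⟨hbc.dsrc_eq.symm.trans ih.1, ih.2.trans ?_⟩
        have := hZ.joinedOff_of_cornered hbc hb hc
        rwa [ih.1] at this
    exact key.2
  have hlevel : ∀ r u v, r ≤ hZ.dist p u → r ≤ hZ.dist p v →
      Z.skeleton.JoinedOff {x | hZ.dist p x < r} u v := by
    intro r
    induction r with
    | zero =>
      intro u v _ _
      obtain ⟨w⟩ := hZ.simplyConnected.1.preconnected u v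
      exact w.joinedOff (by simp)
    | succ r ih =>
      intro u v hu hv
      -- push the vertices at distance `r` on a path one step outwards
      have key : ∀ w, Z.skeleton.JoinedOff {x | hZ.dist p x < r} u w → r ≤ hZ.dist p w →
          (r + 1 ≤ hZ.dist p w → Z.skeleton.JoinedOff {x | hZ.dist p x < r + 1} u w) ∧
          (hZ.dist p w = r → ∃ d, dsrc d = w ∧ ¬ hZ.Toward p d ∧
            Z.skeleton.JoinedOff {x | hZ.dist p x < r + 1} u (dtgt d)) := by
        intro w hw hrw
        induction hw with
        | refl => exact ⟨fun _ => Relation.ReflTransGen.refl, fun h => by omega⟩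
        | @tail b c _ hbc ih' =>
          obtain ⟨hadj, hb, hc⟩ := hbc
          rw [Set.mem_ofPred_eq, not_lt] at hb hc
          obtain ⟨i₁, i₂⟩ := ih' hb
          obtain ⟨e, rfl, rfl⟩ := exists_dart_of_adj hadj
          have hd := hZ.dist_dart p e
          refine ⟨fun hc' => ?_, fun hc' => ?_⟩
          · by_cases hb' : hZ.dist p (dsrc e) = r
            · obtain ⟨d, h₁, h₂, h₃⟩ := i₂ hb'
              refine h₃.trans ?_
              have := hup d e h₁ h₂ (by rw [Toward]; omega)
              rwa [h₁, hb'] at this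
            · refine (i₁ (by omega)).tail ⟨hadj, ?_, ?_⟩ <;> rw [Set.mem_ofPred_eq] <;> omega
          · refine ⟨drev e, dsrc_drev e, ?_, ?_⟩
            · rw [toward_drev, not_not, Toward]
              omega
            · rw [dtgt_drev]
              exact i₁ (by omega)
      exact (key v (ih u v (by omega) (by omega)) (by omega)).1 hv
  intro K hK
  obtain ⟨r, hr⟩ := (hK.image (hZ.dist p)).bddAbove
  refine ⟨_, hZ.finite_setOf_dist_lt hfin p (r + 1), fun u v hu hv => ?_⟩
  rw [Set.mem_ofPred_eq, not_lt] at hu hv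
  refine (hlevel (r + 1) u v hu hv).mono fun x hx => ?_
  rw [Set.mem_ofPred_eq]
  exact Nat.lt_succ_of_le (hr ⟨x, hx, rfl⟩)

end IsCAT0VH

end SquareComplex

/-! ### Local structure of the universal cover -/

namespace SquareComplex

variable {X : SquareComplex} {x : X.V} {hor : X.E → Prop}

theorem IsVH.universalCover (h : IsVH X hor) :
    IsVH (X.universalCover x) fun e => hor (projE e) := by
  have key : ∀ (t : (X.universalCover x).S) (k : Fin 4),
      projE ((X.universalCover x).bdry t k).1 = (X.bdry (projS t) k).1 :=
    fun t k => congrArg Prod.fst (projD_bdry t k)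
  refine ⟨fun t => ?_, fun t => ?_, fun t => ?_, fun t => ?_⟩ <;> rw [key]
  exacts [h.hor_zero _, h.ver_one _, h.hor_two _, h.ver_three _]

theorem CornerJoins.proj {t : (X.universalCover x).S} {k : Fin 4}
    {D D' : (X.universalCover x).Dart} (h : CornerJoins (t, k) D D') :
    CornerJoins (projS t, k) (projD D) (projD D') := by
  rcases h with ⟨rfl, rfl⟩ | ⟨rfl, rfl⟩
  · exact Or.inl ⟨(projD_bdry t k).symm, by rw [projD_drev, projD_bdry]⟩
  · exact Or.inr ⟨(projD_bdry t k).symm, by rw [projD_drev, projD_bdry]⟩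

theorem Cornered.proj {D D' : (X.universalCover x).Dart} (h : Cornered D D') :
    Cornered (projD D) (projD D') := by
  obtain ⟨⟨t, k⟩, h⟩ := h
  exact ⟨_, h.proj⟩

/-- Squares of the universal cover are determined by their image and one corner. -/
theorem square_ext {t t' : (X.universalCover x).S} (h : projS t = projS t') {k : Fin 4}
    (hk : dsrc ((X.universalCover x).bdry t k) = dsrc ((X.universalCover x).bdry t' k)) :
    t = t' := by
  have step : ∀ k, dsrc ((X.universalCover x).bdry t k) = dsrc ((X.universalCover x).bdry t' k) →
      dsrc ((X.universalCover x).bdry t (k + 1)) =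
        dsrc ((X.universalCover x).bdry t' (k + 1)) := by
    intro k hk
    rw [← dtgt_bdry, ← dtgt_bdry, dart_ext hk (by rw [projD_bdry, projD_bdry, h])]
  have h₀ : dsrc ((X.universalCover x).bdry t 0) = dsrc ((X.universalCover x).bdry t' 0) := by
    fin_cases k
    exacts [hk, step 3 (step 2 (step 1 hk)), step 3 (step 2 hk), step 3 hk]
  rw [dsrc_bdry_zero, dsrc_bdry_zero] at h₀
  exact Subtype.ext (Prod.ext h₀ h)

theorem exists_lift_square (k : Fin 4) (s : X.S) (q : (X.universalCover x).V)
    (h : dsrc (X.bdry s k) = projV q) :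
    ∃ t, projS t = s ∧ dsrc ((X.universalCover x).bdry t k) = q := by
  have step : ∀ k : Fin 4, (∀ q : (X.universalCover x).V, dsrc (X.bdry s k) = projV q →
      ∃ t, projS t = s ∧ dsrc ((X.universalCover x).bdry t k) = q) →
      ∀ q : (X.universalCover x).V, dsrc (X.bdry s (k + 1)) = projV q →
      ∃ t, projS t = s ∧ dsrc ((X.universalCover x).bdry t (k + 1)) = q := by
    intro k ih q h
    rw [← dtgt_bdry, ← dsrc_drev] at h
    set D := lift q (drev (X.bdry s k)) h with hD
    have hproj : projD (drev D) = X.bdry s k := by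
      rw [projD_drev, hD, projD_lift, drev_drev]
    obtain ⟨t, rfl, ht⟩ := ih (dtgt D) (by
      rw [← dsrc_drev, ← dsrc_projD, hproj])
    refine ⟨t, rfl, ?_⟩
    have : (X.universalCover x).bdry t k = drev D :=
      dart_ext (ht.trans (dsrc_drev D).symm) ((projD_bdry t k).trans hproj.symm)
    rw [← dtgt_bdry, this, dtgt_drev, hD, dsrc_lift]
  have h₀ : ∀ q : (X.universalCover x).V, dsrc (X.bdry s 0) = projV q →
      ∃ t, projS t = s ∧ dsrc ((X.universalCover x).bdry t 0) = q :=
    fun q h => ⟨liftSquare q s h, rfl, dsrc_bdry_zero _⟩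
  revert q
  fin_cases k
  exacts [h₀, step 0 h₀, step 1 (step 0 h₀), step 2 (step 1 (step 0 h₀))]

/-- Links in the universal cover are those of the base. -/
theorem Cornered.of_proj {D D' : (X.universalCover x).Dart} (h : Cornered (projD D) (projD D'))
    (hsrc : dsrc D = dsrc D') : Cornered D D' := by
  obtain ⟨⟨s, k⟩, h⟩ := h
  have key : ∀ {D D' : (X.universalCover x).Dart}, dsrc D = dsrc D' →
      X.bdry s k = projD D ∧ drev (X.bdry s (k - 1)) = projD D' →
      ∃ t, (X.universalCover x).bdry t k = D ∧
        drev ((X.universalCover x).bdry t (k - 1)) = D' := by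
    rintro D D' hsrc ⟨h₁, h₂⟩
    obtain ⟨t, rfl, ht⟩ := exists_lift_square k s (dsrc D) (by rw [h₁, dsrc_projD])
    refine ⟨t, dart_ext ht ((projD_bdry t k).trans h₁), dart_ext ?_ ?_⟩
    · rw [dsrc_drev, dtgt_bdry, sub_add_cancel, ht, hsrc]
    · rw [projD_drev, projD_bdry, h₂]
  rcases h with h | h
  · obtain ⟨t, ht⟩ := key hsrc h
    exact ⟨(t, k), Or.inl ht⟩
  · obtain ⟨t, ht⟩ := key hsrc.symm h
    exact ⟨(t, k), Or.inr ht⟩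

theorem NonpositivelyCurved.universalCover (h : X.NonpositivelyCurved) :
    (X.universalCover x).NonpositivelyCurved := by
  refine ⟨fun ⟨t, k⟩ D hD => h.1 _ _ hD.proj, ?_, ?_⟩
  · rintro ⟨t, k⟩ ⟨t', k'⟩ D D' hc hc'
    have heq := h.2.1 _ _ _ _ hc.proj hc'.proj
    obtain ⟨h₁, rfl⟩ := Prod.mk.inj heq
    have hs : ∀ (t : (X.universalCover x).S), CornerJoins (t, k) D D' →
        dsrc ((X.universalCover x).bdry t k) = dsrc D := by
      rintro t (⟨rfl, -⟩ | ⟨h₁, h₂⟩)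
      · rfl
      · rw [← h₂, dsrc_drev, dtgt_bdry, sub_add_cancel]
    rw [square_ext h₁ ((hs t hc).trans (hs t' hc').symm)]
  · rintro ⟨⟨t₁, k₁⟩, ⟨t₂, k₂⟩, ⟨t₃, k₃⟩, D₁, D₂, D₃, h₁, h₂, h₃⟩
    exact h.2.2 ⟨_, _, _, _, _, _, h₁.proj, h₂.proj, h₃.proj⟩

theorem IsVH.isCAT0VH (h : IsVH X hor) (hX : X.NonpositivelyCurved) :
    IsCAT0VH (X.universalCover x) fun e => hor (projE e) :=
  ⟨universalCover_simplyConnected, hX.universalCover, h.universalCover⟩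

theorem universalCover_locallyFinite [Finite X.E] [Finite X.S] :
    (X.universalCover x).LocallyFinite := by
  refine fun v => ⟨Set.Finite.of_finite_image (f := projD) (Set.toFinite _) ?_,
    Set.Finite.of_finite_image (f := fun c => (projS c.1, c.2)) (Set.toFinite _) ?_⟩
  · exact fun D hD D' hD' h => dart_ext (Eq.trans hD (Eq.symm hD')) h
  · rintro ⟨t, k⟩ hc ⟨t', k'⟩ hc' h
    obtain ⟨h, hk⟩ := Prod.mk.inj h
    change k = k' at hk
    subst hk
    exact Prod.ext (square_ext h (Eq.trans hc (Eq.symm hc'))) rfl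

theorem Extendable.universalCover (h : Extendable X) : Extendable (X.universalCover x) := by
  intro a
  obtain ⟨b, h₁, h₂, h₃⟩ := h (projD a)
  refine ⟨lift (dsrc a) b (h₁.trans (dsrc_projD a)), dsrc_lift _ _ _, ?_, fun hc => h₃ ?_⟩
  · intro h
    exact h₂ ((projD_lift _ _ _).symm.trans (congrArg projD h))
  · simpa using hc.proj

theorem PuncturedLinksConnected.universalCover (h : PuncturedLinksConnected X) :
    PuncturedLinksConnected (X.universalCover x) := by
  intro q D hD α β hα hβ hαD hβD
  have key : ∀ E : (X.universalCover x).Dart, dsrc E = q →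
      projD E ∈ projD '' (D ∩ {E | dsrc E = q}) → E ∈ D := by
    rintro E hE ⟨E', ⟨h₁, h₂⟩, h₃⟩
    rwa [← dart_ext (Eq.trans h₂ (Eq.symm hE)) h₃]
  have hchain := h (projV q) (projD '' (D ∩ {E | dsrc E = q}))
    (by
      rintro _ ⟨a, ⟨ha, ha'⟩, rfl⟩ _ ⟨b, ⟨hb, hb'⟩, rfl⟩ hab - -
      exact (hD a ha b hb (fun e => hab (e ▸ rfl)) ha' hb').proj)
    (projD α) (projD β) (by rw [dsrc_projD, hα]) (by rw [dsrc_projD, hβ])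
    (fun hm => hαD (key α hα hm)) (fun hm => hβD (key β hβ hm))
  have hlift : ∀ b, Relation.ReflTransGen (fun a b => Cornered a b ∧
      a ∉ projD '' (D ∩ {E | dsrc E = q}) ∧ b ∉ projD '' (D ∩ {E | dsrc E = q})) (projD α) b →
      ∃ B, projD B = b ∧ dsrc B = q ∧
        Relation.ReflTransGen (fun a b => Cornered a b ∧ a ∉ D ∧ b ∉ D) α B := by
    intro b hb
    induction hb with
    | refl => exact ⟨α, rfl, hα, Relation.ReflTransGen.refl⟩
    | tail _ hbc ih =>
      obtain ⟨B, rfl, hB, hαB⟩ := ih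
      obtain ⟨hc, hb, hc'⟩ := hbc
      have hq := hc.dsrc_eq
      rw [dsrc_projD, hB] at hq
      refine ⟨lift q _ hq.symm, projD_lift _ _ _, dsrc_lift _ _ _, hαB.tail ⟨?_, ?_, ?_⟩⟩
      · exact Cornered.of_proj (by rwa [projD_lift]) (by rw [hB, dsrc_lift])
      · exact fun hm => hb ⟨B, ⟨hm, hB⟩, rfl⟩
      · exact fun hm => hc' ⟨_, ⟨hm, dsrc_lift _ _ _⟩, projD_lift _ _ _⟩
  obtain ⟨B, h₁, h₂, h₃⟩ := hlift _ hchain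
  rwa [dart_ext (h₂.trans hβ.symm) h₁] at h₃

end SquareComplex

/-! ### The folded complex -/

section Folded

open SquareComplex AmalgamVertex AmalgamEdge AmalgamSquare

variable {m n L : ℕ} (i j : Fin L)

/-- The choice of `i` as the representative of the rows `i` and `j`. -/
def rowRep (k : Fin L) : Fin L := if k = j then i else k

/-- The choice of a representative of the edges with a given image in the folded complex. -/
def edgeRep : AmalgamEdge m n L → AmalgamEdge m n L
  | rung₁ k => rung₁ (rowRep i j k)
  | e => e

/-- The choice of a representative of the vertices with a given image in the folded complex. -/
def vertexRep : AmalgamVertex L → AmalgamVertex L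
  | mid k => mid (rowRep i j k)
  | v => v

theorem rowRep_eq_iff {k l : Fin L} :
    rowRep i j k = rowRep i j l ↔ k = l ∨ (k = i ∧ l = j) ∨ (k = j ∧ l = i) := by
  unfold rowRep
  split_ifs with h₁ h₂ h₂ <;> subst_vars <;> simp_all [eq_comm]

@[simp] theorem rowRep_left : rowRep i j i = i := by simp [rowRep]

@[simp] theorem rowRep_right : rowRep i j j = i := by simp [rowRep]

theorem edgeRep_self (e : AmalgamEdge m n L) : edgeRep i i e = e := by
  cases e <;> simp [edgeRep, rowRep]
  exact fun h => h.symm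

theorem vertexRep_self (v : AmalgamVertex L) : vertexRep i i v = v := by
  cases v <;> simp [vertexRep, rowRep]
  exact fun h => h.symm

end Folded

section Folded

open SquareComplex AmalgamVertex AmalgamEdge AmalgamSquare

variable {m n L : ℕ} [NeZero L] (w₁ : Fin L → Fin m × Bool) (w₂ : Fin L → Fin n × Bool)
  (i j : Fin L)

/-- The image of an edge in the folded complex. -/
def foldE (e : AmalgamEdge m n L) : (foldedComplex w₁ w₂ i j).E := Quot.mk _ e

/-- The image of a vertex in the folded complex. -/
def foldV (v : AmalgamVertex L) : (foldedComplex w₁ w₂ i j).V := Quot.mk _ v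

theorem foldE_eq_iff {a b : AmalgamEdge m n L} :
    foldE w₁ w₂ i j a = foldE w₁ w₂ i j b ↔ edgeRep i j a = edgeRep i j b := by
  constructor
  · intro h
    refine congrArg (Quot.lift (edgeRep i j) ?_) h
    rintro _ _ ⟨rfl, rfl⟩
    simp [edgeRep]
  · have key : ∀ e, foldE w₁ w₂ i j e = foldE w₁ w₂ i j (edgeRep i j e) := by
      intro e
      cases e with
      | rung₁ k =>
        by_cases hk : k = j
        · subst hk
          simp only [edgeRep, rowRep_right]
          exact (Quot.sound ⟨rfl, rfl⟩ : foldE w₁ w₂ i k (rung₁ i) = _).symm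
        · simp [edgeRep, rowRep, hk]
      | _ => rfl
    intro h
    rw [key a, key b, h]

theorem foldV_eq_iff {a b : AmalgamVertex L} :
    foldV w₁ w₂ i j a = foldV w₁ w₂ i j b ↔ vertexRep i j a = vertexRep i j b := by
  constructor
  · intro h
    refine congrArg (Quot.lift (vertexRep i j) ?_) h
    rintro _ _ (⟨rfl, rfl⟩ | ⟨rfl, rfl⟩)
    · rfl
    · change vertexRep i j (mid i) = vertexRep i j (mid j)
      simp [vertexRep]
  · have key : ∀ v, foldV w₁ w₂ i j v = foldV w₁ w₂ i j (vertexRep i j v) := by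
      intro v
      cases v with
      | mid k =>
        by_cases hk : k = j
        · subst hk
          simp only [vertexRep, rowRep_right]
          exact (Quot.sound (Or.inr ⟨rfl, rfl⟩) : foldV w₁ w₂ i k (mid i) = _).symm
        · simp [vertexRep, rowRep, hk]
      | _ => rfl
    intro h
    rw [key a, key b, h]

theorem exists_foldE (e : (foldedComplex w₁ w₂ i j).E) : ∃ a, foldE w₁ w₂ i j a = e :=
  Quot.exists_rep e

theorem exists_foldV (v : (foldedComplex w₁ w₂ i j).V) : ∃ a, foldV w₁ w₂ i j a = v :=
  Quot.exists_rep v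

/-- The oriented edges of the folded complex. -/
def foldD (e : AmalgamEdge m n L) (b : Bool) : (foldedComplex w₁ w₂ i j).Dart :=
  (foldE w₁ w₂ i j e, b)

theorem exists_foldD (d : (foldedComplex w₁ w₂ i j).Dart) : ∃ e b, foldD w₁ w₂ i j e b = d := by
  obtain ⟨e, b⟩ := d
  obtain ⟨a, rfl⟩ := exists_foldE w₁ w₂ i j e
  exact ⟨a, b, rfl⟩

theorem foldD_eq_iff {a a' : AmalgamEdge m n L} {b b' : Bool} :
    foldD w₁ w₂ i j a b = foldD w₁ w₂ i j a' b' ↔ edgeRep i j a = edgeRep i j a' ∧ b = b' := by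
  rw [← foldE_eq_iff w₁ w₂]
  exact Prod.mk_inj

theorem dsrc_foldD (e : AmalgamEdge m n L) (b : Bool) : dsrc (foldD w₁ w₂ i j e b) =
    foldV w₁ w₂ i j (cond b ((amalgamComplex w₁ w₂).src e) ((amalgamComplex w₁ w₂).tgt e)) := by
  cases b <;> rfl

/-- The horizontal edges are those of the two columns of the annulus. -/
def rungEdge : AmalgamEdge m n L → Prop
  | rung₁ _ => True
  | rung₂ _ => True
  | _ => False

/-- The horizontal edges of the folded complex. -/
def foldedHor : (foldedComplex w₁ w₂ i j).E → Prop :=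
  Quot.lift rungEdge (by rintro _ _ ⟨rfl, rfl⟩; rfl)

theorem folded_isVH : IsVH (foldedComplex w₁ w₂ i j) (foldedHor w₁ w₂ i j) := by
  refine ⟨?_, ?_, ?_, ?_⟩ <;> rintro (r | r)
  exacts [trivial, trivial, id, id, trivial, trivial, id, id]

/-- The horizontal edge at a corner of the folded complex, before folding. -/
def cornerRung (m n : ℕ) : AmalgamSquare L → Fin 4 → AmalgamEdge m n L × Bool
  | sq₁ r => ![(rung₁ r, true), (rung₁ r, false), (rung₁ (r + 1), false), (rung₁ (r + 1), true)]
  | sq₂ r => ![(rung₂ r, true), (rung₂ r, false), (rung₂ (r + 1), false), (rung₂ (r + 1), true)]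

/-- The vertical edge at a corner of the folded complex. -/
def cornerVert : AmalgamSquare L → Fin 4 → AmalgamEdge m n L × Bool
  | sq₁ r => ![(petal₁ (w₁ r).1, (w₁ r).2), (core r, true), (core r, false),
      (petal₁ (w₁ r).1, !(w₁ r).2)]
  | sq₂ r => ![(core r, true), (petal₂ (w₂ r).1, (w₂ r).2), (petal₂ (w₂ r).1, !(w₂ r).2),
      (core r, false)]

theorem cornerH_folded (s : (foldedComplex w₁ w₂ i j).S) (k : Fin 4) :
    cornerH s k =
      foldD w₁ w₂ i j (cornerRung m n s k).1 (cornerRung m n s k).2 := by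
  rcases s with r | r <;> fin_cases k <;> rfl

theorem cornerV_folded (s : (foldedComplex w₁ w₂ i j).S) (k : Fin 4) :
    cornerV s k =
      foldD w₁ w₂ i j (cornerVert w₁ w₂ s k).1 (cornerVert w₁ w₂ s k).2 := by
  rcases s with r | r <;> fin_cases k <;>
    simp [cornerVert, cornerV, foldD, drev, foldedComplex, glueEdges, amalgamComplex, foldE]

theorem folded_cornered_iff {e e' : AmalgamEdge m n L} {b b' : Bool} (he : rungEdge e) :
    Cornered (foldD w₁ w₂ i j e b) (foldD w₁ w₂ i j e' b') ↔ ∃ (s : AmalgamSquare L) (k : Fin 4),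
      (edgeRep i j e = edgeRep i j (cornerRung m n s k).1 ∧
        b = (cornerRung m n s k).2) ∧
      (edgeRep i j e' = edgeRep i j (cornerVert w₁ w₂ s k).1 ∧ b' = (cornerVert w₁ w₂ s k).2) := by
  rw [(folded_isVH w₁ w₂ i j).cornered_iff (show foldedHor w₁ w₂ i j (foldD w₁ w₂ i j e b).1 from he)]
  simp only [cornerH_folded, cornerV_folded, foldD_eq_iff]
  rfl

variable {w₁ w₂ i j}

/-- Consecutive letters of a cyclically reduced word do not cancel. -/
theorem ne_inv_of_isCyclicallyReduced {p : ℕ} {w : Fin L → Fin p × Bool}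
    (h : FreeGroup.IsCyclicallyReduced (List.ofFn w)) (k : Fin L) :
    w (k + 1) ≠ ((w k).1, !(w k).2) := by
  have hL : 0 < L := Nat.pos_of_ne_zero (NeZero.ne L)
  have key : (w k).1 = (w (k + 1)).1 → (w k).2 = (w (k + 1)).2 := by
    by_cases hk : (k : ℕ) + 1 < L
    · have hk' : k + 1 = ⟨k + 1, hk⟩ := by
        ext
        have : (1 : Fin L).val = 1 % L := rfl
        rw [Fin.val_add, this, Nat.add_mod_mod, Nat.mod_eq_of_lt hk]
      have := List.isChain_iff_getElem.1 h.1 k (by simpa using hk)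
      simpa [hk'] using this
    · have hk₀ : (k : ℕ) + 1 = L := by omega
      have hk' : k + 1 = 0 := by
        ext
        have : (1 : Fin L).val = 1 % L := rfl
        rw [Fin.val_add, this, Nat.add_mod_mod, hk₀, Nat.mod_self]
        rfl
      rw [hk']
      refine h.2 (w k) ?_ (w 0) ?_
      · rw [Option.mem_def, List.getLast?_eq_getElem?, List.length_ofFn, List.getElem?_eq_getElem
          (by simp; omega)]
        simp only [List.getElem_ofFn]
        congr 2
        ext
        simp
        omega
      · rw [Option.mem_def, List.head?_eq_getElem?, List.getElem?_eq_getElem (by simpa using hL)]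
        simp only [List.getElem_ofFn]
        rfl
  intro heq
  rw [heq] at key
  simp at key

/-- The conditions on the words under which the folded complex is non-positively curved. The case
`i = j`, in which nothing is folded, is included. -/
structure FoldingWords (w₁ : Fin L → Fin m × Bool) (w₂ : Fin L → Fin n × Bool) (i j : Fin L) :
    Prop where
  red₁ : ∀ k, w₁ (k + 1) ≠ ((w₁ k).1, !(w₁ k).2)
  red₂ : ∀ k, w₂ (k + 1) ≠ ((w₂ k).1, !(w₂ k).2)
  disjoint : i = j ∨ Disjoint (rowLetters w₁ i) (rowLetters w₁ j)

theorem FoldingData.foldingWords (h : FoldingData w₁ w₂ i j) : FoldingWords w₁ w₂ i j :=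
  ⟨ne_inv_of_isCyclicallyReduced h.reduced₁, ne_inv_of_isCyclicallyReduced h.reduced₂,
    Or.inr h.disjoint⟩

/-- Horizontal edges of the left column with the same image in the folded complex whose squares
contain a common oriented petal are equal. -/
theorem FoldingWords.row_eq (h : FoldingWords w₁ w₂ i j) {k l : Fin L} {a : Fin m × Bool}
    (hkl : rowRep i j k = rowRep i j l) (hk : a ∈ rowLetters w₁ k) (hl : a ∈ rowLetters w₁ l) :
    k = l := by
  rcases (rowRep_eq_iff i j).1 hkl with h' | ⟨rfl, rfl⟩ | ⟨rfl, rfl⟩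
  · exact h'
  · rcases h.disjoint with h' | h'
    · exact h'
    · exact absurd hl (Set.disjoint_left.1 h' hk)
  · rcases h.disjoint with h' | h'
    · exact h'.symm
    · exact absurd hk (Set.disjoint_left.1 h' hl)

theorem FoldingWords.nonpositivelyCurved (h : FoldingWords w₁ w₂ i j) :
    (foldedComplex w₁ w₂ i j).NonpositivelyCurved := by
  refine (folded_isVH w₁ w₂ i j).nonpositivelyCurved ?_
  have up : ∀ k, w₁ k ∈ rowLetters w₁ k := fun k => Or.inl rfl
  have down : ∀ k, ((w₁ k).1, !(w₁ k).2) ∈ rowLetters w₁ (k + 1) := fun k => by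
    simp [rowLetters]
  intro s k s' k' hH hV
  simp only [cornerH_folded, cornerV_folded, foldD_eq_iff] at hH hV
  rcases s with r | r <;> rcases s' with r' | r' <;> fin_cases k <;> fin_cases k' <;>
    simp [cornerRung, cornerVert, edgeRep] at hH hV ⊢
  -- a pair of corners remains for each letter that two corners with the same rung may share
  · rw [h.row_eq hH (up r) (Prod.ext hV.1 hV.2 ▸ up r')]
  · have hw : w₁ r = ((w₁ r').1, !(w₁ r').2) := Prod.ext hV.1 hV.2
    have hr := h.row_eq hH (up r) (hw ▸ down r')
    exact absurd (hr ▸ hw) (h.red₁ r')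
  · rw [hV]
  · rw [hV]
  · have hw : w₁ r' = ((w₁ r).1, !(w₁ r).2) :=
      Prod.ext hV.1.symm (by rw [hV.2, Bool.not_not])
    have hr := h.row_eq hH (hw ▸ down r) (hw ▸ up r')
    exact absurd (hr ▸ hw) (h.red₁ r)
  · have hw : w₁ r = w₁ r' := Prod.ext hV.1 hV.2
    rw [add_right_cancel (h.row_eq hH (down r) (hw ▸ down r'))]
  · rw [hH]
  · rw [hH]
  · exact absurd (hH ▸ Prod.ext hV.1 hV.2) (h.red₂ r')
  · refine absurd (hH ▸ Prod.ext hV.1.symm ?_) (h.red₂ r)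
    rw [hV.2, Bool.not_not]
  · rw [hH]
  · rw [hH]

instance : Finite (AmalgamEdge m n L) :=
  Finite.of_surjective (α := Fin m ⊕ Fin n ⊕ Fin L ⊕ Fin L ⊕ Fin L)
    (Sum.elim petal₁ (Sum.elim petal₂ (Sum.elim rung₁ (Sum.elim rung₂ core)))) fun e => by
      cases e with
      | petal₁ a => exact ⟨Sum.inl a, rfl⟩
      | petal₂ a => exact ⟨Sum.inr (Sum.inl a), rfl⟩
      | rung₁ k => exact ⟨Sum.inr (Sum.inr (Sum.inl k)), rfl⟩
      | rung₂ k => exact ⟨Sum.inr (Sum.inr (Sum.inr (Sum.inl k))), rfl⟩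
      | core k => exact ⟨Sum.inr (Sum.inr (Sum.inr (Sum.inr k))), rfl⟩

instance : Finite (AmalgamVertex L) :=
  Finite.of_surjective (α := Unit ⊕ Unit ⊕ Fin L)
    (Sum.elim (fun _ => left) (Sum.elim (fun _ => right) mid)) fun e => by
      cases e with
      | left => exact ⟨Sum.inl (), rfl⟩
      | right => exact ⟨Sum.inr (Sum.inl ()), rfl⟩
      | mid k => exact ⟨Sum.inr (Sum.inr k), rfl⟩

instance : Finite (AmalgamSquare L) :=
  Finite.of_surjective (α := Fin L ⊕ Fin L) (Sum.elim sq₁ sq₂) fun e => by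
      cases e with
      | sq₁ k => exact ⟨Sum.inl k, rfl⟩
      | sq₂ k => exact ⟨Sum.inr k, rfl⟩

instance : Finite (foldedComplex w₁ w₂ i j).V :=
  Finite.of_surjective (foldV w₁ w₂ i j) (exists_foldV w₁ w₂ i j)

instance : Finite (foldedComplex w₁ w₂ i j).E :=
  Finite.of_surjective (foldE w₁ w₂ i j) (exists_foldE w₁ w₂ i j)

instance : Finite (foldedComplex w₁ w₂ i j).S :=
  inferInstanceAs (Finite (AmalgamSquare L))

/-- Edges of the folded complex can be continued straight on, with the possible exception of the
folded edge at the vertex of the left rose. -/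
theorem folded_extendable (hL : 2 ≤ L) (h : ∃ b, dsrc b = foldV w₁ w₂ i j left ∧
      b ≠ foldD w₁ w₂ i j (rung₁ i) true ∧ ¬ Cornered (foldD w₁ w₂ i j (rung₁ i) true) b) :
    Extendable (foldedComplex w₁ w₂ i j) := by
  have key : ∀ (e e' : AmalgamEdge m n L) (b b' : Bool), (rungEdge e ↔ rungEdge e') →
      cond b' ((amalgamComplex w₁ w₂).src e') ((amalgamComplex w₁ w₂).tgt e') =
        cond b ((amalgamComplex w₁ w₂).src e) ((amalgamComplex w₁ w₂).tgt e) →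
      ¬ (edgeRep i j e' = edgeRep i j e ∧ b' = b) →
      ∃ d, dsrc d = dsrc (foldD w₁ w₂ i j e b) ∧ d ≠ foldD w₁ w₂ i j e b ∧
        ¬ Cornered (foldD w₁ w₂ i j e b) d := by
    intro e e' b b' h₁ h₂ h₃
    refine ⟨foldD w₁ w₂ i j e' b', ?_, fun h => h₃ ((foldD_eq_iff w₁ w₂ i j).1 h),
      (folded_isVH w₁ w₂ i j).not_cornered_of_same h₁⟩
    rw [dsrc_foldD, dsrc_foldD]
    exact congrArg (foldV w₁ w₂ i j) h₂
  have hne : ∀ k : Fin L, k + 1 ≠ k := by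
    intro k hk
    have h1 : (1 : Fin L) = 0 := by simpa using hk
    have : (1 : Fin L).val = 0 := by rw [h1]; rfl
    have h2 : (1 : Fin L).val = 1 % L := rfl
    rw [h2, Nat.mod_eq_of_lt (by omega)] at this
    omega
  intro a
  obtain ⟨e, b, rfl⟩ := exists_foldD w₁ w₂ i j a
  cases e with
  | petal₁ a => exact key _ (petal₁ a) b (!b) Iff.rfl (by cases b <;> rfl) (by simp)
  | petal₂ a => exact key _ (petal₂ a) b (!b) Iff.rfl (by cases b <;> rfl) (by simp)
  | core k =>
    cases b with
    | true => exact key _ (core (k - 1)) true false Iff.rfl (by simp [amalgamComplex]) (by simp)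
    | false => exact key _ (core (k + 1)) false true Iff.rfl (by simp [amalgamComplex]) (by simp)
  | rung₂ k =>
    cases b with
    | true => exact key _ (rung₁ k) true false Iff.rfl (by simp [amalgamComplex]) (by simp)
    | false =>
      exact key _ (rung₂ (k + 1)) false false Iff.rfl (by simp [amalgamComplex])
        (by simpa [edgeRep] using hne k)
  | rung₁ k =>
    cases b with
    | false => exact key _ (rung₂ k) false true Iff.rfl (by simp [amalgamComplex]) (by simp)
    | true =>
      by_cases hk : edgeRep (m := m) (n := n) i j (rung₁ k) = edgeRep i j (rung₁ i)
      · rw [(foldD_eq_iff w₁ w₂ i j).2 ⟨hk, rfl⟩, dsrc_foldD]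
        exact h
      · exact key _ (rung₁ i) true true Iff.rfl (by simp [amalgamComplex])
          fun h => hk h.1.symm

/-- The edges that leave the core circle in row `k` along this circle and to the right. -/
def coreStar (w₁ : Fin L → Fin m × Bool) (w₂ : Fin L → Fin n × Bool) (i j k : Fin L) :
    Set (foldedComplex w₁ w₂ i j).Dart :=
  {foldD w₁ w₂ i j (core k) true, foldD w₁ w₂ i j (core (k - 1)) false,
    foldD w₁ w₂ i j (rung₂ k) true}

/-- The edges at the folded vertex of the core circle. -/
theorem mem_coreStar_of_dsrc {d : (foldedComplex w₁ w₂ i j).Dart}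
    (h : dsrc d = foldV w₁ w₂ i j (mid i)) : d = foldD w₁ w₂ i j (rung₁ i) false ∨
      d ∈ coreStar w₁ w₂ i j i ∨ d ∈ coreStar w₁ w₂ i j j := by
  have hrep : ∀ k, rowRep i j k = i → k = i ∨ k = j := by
    intro k hk
    have : rowRep i j k = rowRep i j i := by rw [hk, rowRep_left]
    rw [rowRep_eq_iff] at this
    tauto
  obtain ⟨e, b, rfl⟩ := exists_foldD w₁ w₂ i j d
  rw [dsrc_foldD, foldV_eq_iff] at h
  cases e <;> cases b <;> simp [amalgamComplex, vertexRep] at h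
  · exact Or.inl ((foldD_eq_iff w₁ w₂ i j).2 (by simp [edgeRep, h]))
  · rcases hrep _ h with rfl | rfl
    · exact Or.inr (Or.inl (Or.inr (Or.inr rfl)))
    · exact Or.inr (Or.inr (Or.inr (Or.inr rfl)))
  · rename_i k
    rcases hrep _ h with h | h
    · exact Or.inr (Or.inl (Or.inr (Or.inl (by rw [← h, add_sub_cancel_right]))))
    · exact Or.inr (Or.inr (Or.inr (Or.inl (by rw [← h, add_sub_cancel_right]))))
  · rcases hrep _ h with rfl | rfl
    · exact Or.inr (Or.inl (Or.inl rfl))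
    · exact Or.inr (Or.inr (Or.inl rfl))

/-- The link of the folded vertex falls apart when the folded edge is removed from it. -/
theorem not_cornered_of_mem_coreStar (hij : i ≠ j) {d d' : (foldedComplex w₁ w₂ i j).Dart}
    (h : d ∈ coreStar w₁ w₂ i j i) (h' : d' ∈ coreStar w₁ w₂ i j j) :
    d ≠ d' ∧ ¬ Cornered d d' := by
  have hcore : ∀ k l : Fin L, k ≠ l → ∀ b,
      ¬ Cornered (foldD w₁ w₂ i j (rung₂ k) true) (foldD w₁ w₂ i j (core (cond b l (l - 1))) b) := by
    intro k l hkl b hc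
    rw [folded_cornered_iff w₁ w₂ i j (show rungEdge (rung₂ k) from trivial)] at hc
    obtain ⟨s, c, ⟨h₁, h₂⟩, h₃, h₄⟩ := hc
    rcases s with r | r <;> fin_cases c <;> cases b <;>
      simp [cornerRung, cornerVert, edgeRep] at h₁ h₂ h₃ h₄
    · exact hkl (h₁.trans h₃.symm)
    · exact hkl (by rw [h₁, ← h₃, sub_add_cancel])
  have hv : ∀ k l : Fin L, ∀ b b' : Bool,
      ¬ Cornered (foldD w₁ w₂ i j (core k) b) (foldD w₁ w₂ i j (core l) b') :=
    fun _ _ _ _ => (folded_isVH w₁ w₂ i j).not_cornered_of_same Iff.rfl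
  have hh : ∀ k l : Fin L, ∀ b b' : Bool,
      ¬ Cornered (foldD w₁ w₂ i j (rung₂ k) b) (foldD w₁ w₂ i j (rung₂ l) b') :=
    fun _ _ _ _ => (folded_isVH w₁ w₂ i j).not_cornered_of_same Iff.rfl
  rcases h with rfl | rfl | rfl <;> rcases h' with rfl | rfl | rfl <;>
    refine ⟨fun he => ?_, fun hc => ?_⟩ <;>
    first
    | (exfalso; exact hv _ _ _ _ hc)
    | (exfalso; exact hh _ _ _ _ hc)
    | (exfalso; exact hcore _ _ hij true hc)
    | (exfalso; exact hcore _ _ hij false hc)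
    | (exfalso; exact hcore _ _ hij.symm true hc.symm)
    | (exfalso; exact hcore _ _ hij.symm false hc.symm)
    | (rw [foldD_eq_iff] at he; simp [edgeRep, hij] at he)

end Folded

/-! ### Developing the universal cover over a group -/

namespace SquareComplex

variable {X : SquareComplex} {x : X.V} {G : Type} [Group G]

/-- Left translation of the universal cover by the fundamental group. -/
def translate (γ : X.HC x x) (q : X.CoverVertex x) : X.CoverVertex x := ⟨q.1, HC.comp γ q.2⟩

theorem translate_mul (γ δ : X.HC x x) (q : X.CoverVertex x) :
    translate (γ * δ) q = translate γ (translate δ q) :=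
  Sigma.ext rfl (heq_of_eq (HC.assoc γ δ q.2))

theorem translate_one (q : X.CoverVertex x) : translate 1 q = q :=
  Sigma.ext rfl (heq_of_eq (HC.one_comp (X := X) q.2))

theorem translate_move (γ : X.HC x x) (q : X.CoverVertex x) (d : X.Dart) (h : dsrc d = q.1) :
    (translate γ q).move d h = translate γ (q.move d h) := by
  refine (move_eq _ _ _).trans (Eq.trans ?_ (congrArg (translate γ) (move_eq q d h)).symm)
  exact Sigma.ext rfl (heq_of_eq (HC.assoc γ q.2 _))

/-- The label of an oriented edge, for a labelling of the edges by group elements. -/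
def dartLabel (φ : X.E → G) (d : X.Dart) : G := cond d.2 (φ d.1) (φ d.1)⁻¹

theorem dartLabel_drev (φ : X.E → G) (d : X.Dart) : dartLabel φ (drev d) = (dartLabel φ d)⁻¹ := by
  rcases d with ⟨e, _ | _⟩ <;> simp [dartLabel, drev]

/-- The label of an edge path. -/
def pathLabel (φ : X.E → G) (l : List X.Dart) : G := (l.map (dartLabel φ)).prod

theorem pathLabel_append (φ : X.E → G) (l l' : List X.Dart) :
    pathLabel φ (l ++ l') = pathLabel φ l * pathLabel φ l' := by simp [pathLabel]

/-- Edge labels whose product around every square is trivial. -/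
def IsFlat (φ : X.E → G) : Prop := ∀ s, dartLabel φ (X.bdry s 0) * dartLabel φ (X.bdry s 1) *
  dartLabel φ (X.bdry s 2) * dartLabel φ (X.bdry s 3) = 1

theorem IsFlat.pathLabel_eq {φ : X.E → G} (h : IsFlat φ) {l l' : List X.Dart}
    (hs : X.HomotopyStep l l') : pathLabel φ l = pathLabel φ l' := by
  cases hs with
  | backtrack l₁ l₂ d => simp [pathLabel, dartLabel_drev]
  | square l₁ l₂ s =>
    have := h s
    simp only [pathLabel, List.map_append, List.prod_append, List.map_cons, List.prod_cons]
    rw [← mul_assoc (dartLabel φ _) (dartLabel φ _), ← mul_assoc (_ * _), ← mul_assoc (_ * _), this,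
      one_mul]

/-- The label of a homotopy class of paths. -/
def hcLabel {φ : X.E → G} (h : IsFlat φ) {u v : X.V} : X.HC u v → G :=
  Quot.lift (fun p => pathLabel φ p.1) fun _ _ hs => h.pathLabel_eq hs

theorem hcLabel_comp {φ : X.E → G} (h : IsFlat φ) {u v w : X.V} (a : X.HC u v) (b : X.HC v w) :
    hcLabel h (a.comp b) = hcLabel h a * hcLabel h b := by
  obtain ⟨l, hl, rfl⟩ := a.exists_mk
  obtain ⟨l', hl', rfl⟩ := b.exists_mk
  exact pathLabel_append φ l l'

/-- The label of a vertex of the universal cover. -/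
def coverLabel {φ : X.E → G} (h : IsFlat φ) (q : X.CoverVertex x) : G :=
  hcLabel h (u := x) (v := q.1) q.2

theorem coverLabel_move {φ : X.E → G} (h : IsFlat φ) (q : X.CoverVertex x) (d : X.Dart)
    (hd : dsrc d = q.1) : coverLabel h (q.move d hd) = coverLabel h q * dartLabel φ d := by
  rw [move_eq]
  refine (hcLabel_comp h _ _).trans (congrArg (coverLabel h q * ·) ?_)
  change pathLabel φ [d] = _
  simp [pathLabel]

theorem coverLabel_translate {φ : X.E → G} (h : IsFlat φ) (γ : X.HC x x) (q : X.CoverVertex x) :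
    coverLabel h (translate γ q) = hcLabel h γ * coverLabel h q :=
  hcLabel_comp h _ _

variable (X x G) in
/-- Data that identify the fundamental group of `X` with `G`: a flat labelling of the edges by
elements of `G`, a homomorphism `G → π₁(X, x)` that is a section of the labelling, and a choice
of lifts of the vertices that is compatible with both. -/
structure Development where
  φ : X.E → G
  flat : IsFlat φ
  ψ : G →* X.HC x x
  label_ψ : ∀ g, hcLabel flat (ψ g) = g
  T : X.V → X.CoverVertex x
  T_fst : ∀ v, (T v).1 = v
  T_base : T x = coverBase X x
  T_move : ∀ e, (T (X.src e)).move (e, true) (T_fst _).symm = translate (ψ (φ e)) (T (X.tgt e))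

namespace Development

variable (P : Development X x G)

theorem move_dart (d : X.Dart) : (P.T (dsrc d)).move d (P.T_fst _).symm =
    translate (P.ψ (dartLabel P.φ d)) (P.T (dtgt d)) := by
  rcases d with ⟨e, _ | _⟩
  · have h := P.T_move e
    have h' := (P.T (X.src e)).move_move_drev (e, true) (P.T_fst _).symm
    have h'' : (translate (P.ψ (P.φ e)) (P.T (X.tgt e))).move (e, false) (P.T_fst _).symm =
        P.T (X.src e) := by
      rw [← h']
      exact move_congr h.symm rfl _
    replace h'' := (translate_move _ _ _ _).symm.trans h''
    change (P.T (X.tgt e)).move (e, false) _ = translate (P.ψ (P.φ e)⁻¹) (P.T (X.src e))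
    rw [← h'', ← translate_mul, ← map_mul, inv_mul_cancel, map_one]
    exact (translate_one _).symm
  · exact P.T_move e

/-- Every vertex of the universal cover is a translate of a chosen lift. -/
theorem eq_translate (q : (X.universalCover x).V) :
    q = translate (P.ψ (coverLabel P.flat q)) (P.T (projV q)) := by
  have key : ∀ (L : List (X.universalCover x).Dart) (r : (X.universalCover x).V), IsPath r L q →
      r = translate (P.ψ (coverLabel P.flat r)) (P.T (projV r)) →
      q = translate (P.ψ (coverLabel P.flat q)) (P.T (projV q)) := by
    intro L
    induction L with
    | nil =>
      rintro r rfl hr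
      exact hr
    | cons D L ih =>
      rintro r ⟨rfl, hL⟩ hr
      refine ih _ hL ?_
      have hD := dtgt_eq_move D
      have h₁ := P.move_dart (projD D)
      have h₂ : CoverVertex.move (dsrc D) (projD D) (dsrc_projD D) =
          (translate (P.ψ (coverLabel P.flat (dsrc D))) (P.T (dsrc (projD D)))).move (projD D)
            (P.T_fst _).symm :=
        move_congr (hr.trans (by rw [dsrc_projD])) rfl _
      replace h₂ := h₂.trans ((translate_move _ _ _ _).trans (congrArg (translate _) h₁))
      rw [← translate_mul, ← map_mul] at h₂
      have h₃ := coverLabel_move P.flat (dsrc D) (projD D) (dsrc_projD D)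
      rw [← hD] at h₂ h₃
      refine h₂.trans ?_
      rw [h₃, dtgt_projD]
  obtain ⟨L, hL⟩ := exists_path_from_base q
  refine key L _ hL ?_
  have h₁ : coverLabel P.flat (coverBase X x) = 1 := rfl
  rw [h₁, map_one, translate_one]
  exact P.T_base.symm

theorem coverLabel_translate_ψ (g : G) (q : X.CoverVertex x) :
    coverLabel P.flat (translate (P.ψ g) q) = g * coverLabel P.flat q := by
  rw [coverLabel_translate, P.label_ψ]

/-- Left translation of the edges of the universal cover. -/
def translateE (γ : X.HC x x) (a : X.CoverEdge x) : X.CoverEdge x :=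
  ⟨(translate γ a.1.1, a.1.2), a.2⟩

/-- Left translation of the squares of the universal cover. -/
def translateS (γ : X.HC x x) (t : (X.universalCover x).S) : (X.universalCover x).S :=
  ⟨(translate γ t.1.1, t.1.2), t.2⟩

/-- Left translation of the oriented edges of the universal cover. -/
def translateD (γ : X.HC x x) (D : (X.universalCover x).Dart) : (X.universalCover x).Dart :=
  (translateE γ D.1, D.2)

theorem coverTgt_translateE (γ : X.HC x x) (a : X.CoverEdge x) :
    coverTgt (translateE γ a) = translate γ (coverTgt a) := translate_move γ _ _ _

theorem dsrc_translateD (γ : X.HC x x) (D : (X.universalCover x).Dart) :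
    dsrc (translateD γ D) = translate γ (dsrc D) := by
  rcases D with ⟨a, _ | _⟩
  · exact coverTgt_translateE γ a
  · rfl

theorem dtgt_translateD (γ : X.HC x x) (D : (X.universalCover x).Dart) :
    dtgt (translateD γ D) = translate γ (dtgt D) := by
  rw [← dsrc_drev, ← dsrc_drev]
  exact dsrc_translateD γ (drev D)

theorem bdry_translateS (γ : X.HC x x) (t : (X.universalCover x).S) (k : Fin 4) :
    (X.universalCover x).bdry (translateS γ t) k =
      translateD γ ((X.universalCover x).bdry t k) := by
  have step : ∀ k, dsrc ((X.universalCover x).bdry (translateS γ t) k) =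
      translate γ (dsrc ((X.universalCover x).bdry t k)) →
      (X.universalCover x).bdry (translateS γ t) k =
        translateD γ ((X.universalCover x).bdry t k) := fun k hk =>
    dart_ext (hk.trans (dsrc_translateD γ _).symm)
      ((projD_bdry (translateS γ t) k).trans (projD_bdry t k).symm)
  have next : ∀ k, dsrc ((X.universalCover x).bdry (translateS γ t) k) =
      translate γ (dsrc ((X.universalCover x).bdry t k)) →
      dsrc ((X.universalCover x).bdry (translateS γ t) (k + 1)) =
        translate γ (dsrc ((X.universalCover x).bdry t (k + 1))) := fun k hk => by
    refine (dtgt_bdry (translateS γ t) k).symm.trans ?_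
    rw [← dtgt_bdry, step k hk, dtgt_translateD]
  have h₀ : dsrc ((X.universalCover x).bdry (translateS γ t) 0) =
      translate γ (dsrc ((X.universalCover x).bdry t 0)) := by
    exact (dsrc_bdry_zero (translateS γ t)).trans
      (congrArg (translate γ) (dsrc_bdry_zero t)).symm
  refine step k ?_
  fin_cases k
  exacts [h₀, next 0 h₀, next 1 (next 0 h₀), next 2 (next 1 (next 0 h₀))]

theorem isPath_translate (γ : X.HC x x) {q r : (X.universalCover x).V}
    {L : List (X.universalCover x).Dart} (h : IsPath q L r) :
    IsPath (X := X.universalCover x) (translate γ q) (L.map (translateD γ)) (translate γ r) := by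
  induction L generalizing q with
  | nil => exact congrArg (translate γ) h
  | cons D L ih =>
    obtain ⟨rfl, h⟩ := h
    refine ⟨dsrc_translateD γ D, ?_⟩
    rw [dtgt_translateD]
    exact ih h

/-- The action of `G` on the universal cover by deck transformations. -/
noncomputable def action : CellularAction G (X.universalCover x) where
  onV := MonoidHom.toHomPerm
    { toFun := fun g => translate (P.ψ g)
      map_one' := funext fun q => by rw [map_one]; exact translate_one q
      map_mul' := fun g h => funext fun q => by rw [map_mul]; exact translate_mul _ _ q }
  onE := MonoidHom.toHomPerm
    { toFun := fun g => translateE (P.ψ g)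
      map_one' := funext fun a => Subtype.ext (Prod.ext (by
        rw [map_one]; exact translate_one _) rfl)
      map_mul' := fun g h => funext fun a => Subtype.ext (Prod.ext (by
        rw [map_mul]; exact translate_mul _ _ _) rfl) }
  onS := MonoidHom.toHomPerm
    { toFun := fun g => translateS (P.ψ g)
      map_one' := funext fun a => Subtype.ext (Prod.ext (by
        rw [map_one]; exact translate_one _) rfl)
      map_mul' := fun g h => funext fun a => Subtype.ext (Prod.ext (by
        rw [map_mul]; exact translate_mul _ _ _) rfl) }
  map_src _ _ := rfl
  map_tgt g e := coverTgt_translateE (P.ψ g) e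
  map_bdry g s k := bdry_translateS (P.ψ g) s k

theorem isDeckAction : P.action.IsDeckAction := by
  refine ⟨fun _ _ => rfl, fun _ _ => rfl, fun _ _ => rfl, fun u v huv => ?_⟩
  refine ⟨coverLabel P.flat v * (coverLabel P.flat u)⁻¹, ?_, fun g hg => ?_⟩
  · change translate (P.ψ _) u = v
    refine (congrArg (translate _) (P.eq_translate u)).trans ?_
    rw [← translate_mul, ← map_mul, inv_mul_cancel_right, huv]
    exact (P.eq_translate v).symm
  · have hg' : translate (P.ψ g) u = v := hg
    have := P.coverLabel_translate_ψ g u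
    rw [hg'] at this
    rw [this, mul_inv_cancel_right]

theorem proper : P.action.Proper := by
  intro v
  refine (Set.finite_singleton (1 : G)).subset fun g hg => ?_
  have hg' : translate (P.ψ g) v = v := hg
  have := P.coverLabel_translate_ψ g v
  rw [hg'] at this
  exact (mul_eq_right.1 this.symm)

theorem cocompact [Finite X.V] [Finite X.E] [Finite X.S] : P.action.Cocompact := by
  refine ⟨⟨Set.range P.T, Set.finite_range _, fun q => ?_⟩,
    ⟨Set.range fun e => (⟨(P.T (X.src e), e), (P.T_fst _).symm⟩ : X.CoverEdge x),
      Set.finite_range _, fun a => ?_⟩,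
    ⟨Set.range fun s => (⟨(P.T (dsrc (X.bdry s 0)), s), (P.T_fst _).symm⟩ : X.CoverSquare x),
      Set.finite_range _, fun t => ?_⟩⟩
  · exact ⟨_, ⟨projV q, rfl⟩, coverLabel P.flat q, (P.eq_translate q).symm⟩
  · refine ⟨_, ⟨a.1.2, rfl⟩, coverLabel P.flat a.1.1, Subtype.ext (Prod.ext ?_ rfl)⟩
    refine Eq.trans ?_ (P.eq_translate a.1.1).symm
    exact congrArg (fun v => translate _ (P.T v)) a.2
  · refine ⟨_, ⟨t.1.2, rfl⟩, coverLabel P.flat t.1.1, Subtype.ext (Prod.ext ?_ rfl)⟩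
    refine Eq.trans ?_ (P.eq_translate t.1.1).symm
    exact congrArg (fun v => translate _ (P.T v)) t.2

end Development

end SquareComplex

/-! ### Ends of a group and of a developed universal cover -/

namespace SimpleGraph

variable {G : Type} [Group G] {T : Set G}

theorem mulCayley_neighborSet_finite (hT : T.Finite) (g : G) :
    ((mulCayley T).neighborSet g).Finite := by
  refine ((hT.image fun t => g * t).union (hT.image fun t => g * t⁻¹)).subset fun b hb => ?_
  obtain ⟨-, t, ht, h | h⟩ := (mulCayley_adj' T g b).1 hb
  · exact Or.inl ⟨t, ht, h⟩
  · exact Or.inr ⟨t, ht, by simp [h]⟩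

theorem mulCayley_preconnected (hT : Subgroup.closure T = ⊤) : (mulCayley T).Preconnected := by
  have key : ∀ g a : G, (mulCayley T).Reachable a (a * g) := by
    intro g
    have hg : g ∈ Subgroup.closure T := hT ▸ Subgroup.mem_top g
    induction hg using Subgroup.closure_induction with
    | mem t ht =>
      intro a
      by_cases h : a = a * t
      · rw [← h]
      · exact Adj.reachable ((mulCayley_adj' T _ _).2 ⟨h, t, ht, Or.inl rfl⟩)
    | one => intro a; rw [mul_one]
    | mul g h _ _ hg hh => intro a; rw [← mul_assoc]; exact (hg a).trans (hh _)
    | inv g _ hg => intro a; simpa using (hg (a * g⁻¹)).symm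
  intro a b
  simpa using key (a⁻¹ * b) a

end SimpleGraph

namespace SquareComplex

namespace Development

variable {X : SquareComplex} {x : X.V} {G : Type} [Group G]

theorem coverLabel_translate_base (P : Development X x G) (g : G) :
    coverLabel P.flat (translate (P.ψ g) (coverBase X x)) = g :=
  (P.coverLabel_translate_ψ g _).trans (mul_one g)

theorem coverLabel_projV_injective (P : Development X x G) :
    Function.Injective fun q : (X.universalCover x).V => (coverLabel P.flat q, projV q) := by
  intro q r h
  obtain ⟨h₁, h₂⟩ := Prod.mk.inj h
  rw [P.eq_translate q, P.eq_translate r, h₁, h₂]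

theorem exists_walk_translate (P : Development X x G) (g : G) {q r : (X.universalCover x).V}
    {L : List (X.universalCover x).Dart} (h : IsPath q L r) :
    ∃ w : (X.universalCover x).skeleton.Walk (translate (P.ψ g) q) (translate (P.ψ g) r),
      w.length ≤ L.length := by
  obtain ⟨w, hw⟩ := exists_walk_of_isPath (isPath_translate (P.ψ g) h)
  exact ⟨w, by simpa using hw⟩

theorem infinite (P : Development X x G) (h : IsOneEndedGroup G) :
    Infinite (X.universalCover x).V := by
  obtain ⟨T, -, -, hT⟩ := h
  have := hT.infinite
  exact Infinite.of_injective (fun g => translate (P.ψ g) (coverBase X x))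
    (Function.LeftInverse.injective P.coverLabel_translate_base)

/-- The orbit map carries one-endedness from the group to the universal cover. -/
theorem connectedAtInfinity (P : Development X x G) [Finite X.V]
    (hfin : (X.universalCover x).LocallyFinite)
    (h : IsOneEndedGroup G) : (X.universalCover x).skeleton.ConnectedAtInfinity := by
  obtain ⟨S, hS, hclos, hone⟩ := h
  have hinf := hone.connectedAtInfinity (SimpleGraph.mulCayley_neighborSet_finite hS)
    (SimpleGraph.mulCayley_preconnected hclos)
  have hpath := (universalCover_connected (X := X) (x := x)).2
  have hpath' : ∀ u v : (X.universalCover x).V, ∃ L, IsPath u L v := fun u v =>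
    ⟨_, (hpath u v).some.2⟩
  choose L hL using hpath'
  set o := coverBase X x with ho
  have hcopy : ∀ {u u' v v' : (X.universalCover x).V} {N : ℕ}, u = u' → v = v' →
      ∀ w : (X.universalCover x).skeleton.Walk u v, w.length ≤ N →
      ∃ w' : (X.universalCover x).skeleton.Walk u' v', w'.length ≤ N := by
    rintro u _ v _ N rfl rfl w hw
    exact ⟨w, hw⟩
  -- `N₁` bounds the displacement of the base vertex by the generators, `N₂` the distance of any
  -- vertex from the orbit of the base vertex
  obtain ⟨N₁, hN₁⟩ := (hS.image fun t => (L o (translate (P.ψ t) o)).length).bddAbove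
  obtain ⟨N₂, hN₂⟩ := (Set.finite_range fun v => (L (P.T v) o).length).bddAbove
  refine hinf.map (fun g => translate (P.ψ g) o) (max N₁ N₂) hfin.neighborSet_finite ?_ ?_ ?_
  · intro y
    refine (Set.finite_singleton (coverLabel P.flat y)).subset ?_
    rintro g rfl
    exact (P.coverLabel_translate_base g).symm
  · have step : ∀ a t, t ∈ S → ∃ w : (X.universalCover x).skeleton.Walk
        (translate (P.ψ a) o) (translate (P.ψ (a * t)) o), w.length ≤ max N₁ N₂ := by
      intro a t ht
      obtain ⟨w, hw⟩ := P.exists_walk_translate a (hL o (translate (P.ψ t) o))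
      have ht' : translate (P.ψ a) (translate (P.ψ t) o) = translate (P.ψ (a * t)) o := by
        rw [map_mul]
        exact (translate_mul _ _ _).symm
      exact hcopy rfl ht' w (hw.trans ((hN₁ ⟨t, ht, rfl⟩).trans (le_max_left _ _)))
    intro a b hab
    obtain ⟨-, t, ht, rfl | rfl⟩ := (SimpleGraph.mulCayley_adj' S a b).1 hab
    · exact step a t ht
    · obtain ⟨w, hw⟩ := step b t ht
      exact ⟨w.reverse, (SimpleGraph.Walk.length_reverse _).le.trans hw⟩
  · intro y
    refine ⟨coverLabel P.flat y, ?_⟩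
    obtain ⟨w, hw⟩ := P.exists_walk_translate (coverLabel P.flat y) (hL (P.T (projV y)) o)
    exact hcopy (P.eq_translate y).symm rfl w
      (hw.trans ((hN₂ ⟨projV y, rfl⟩).trans (le_max_right _ _)))

/-- The labelling of the vertices carries one-endedness from the universal cover to the group. -/
theorem isOneEndedGroup (P : Development X x G) [Finite X.V] [Finite X.E]
    [Infinite (X.universalCover x).V]
    (h : (X.universalCover x).skeleton.ConnectedAtInfinity) : IsOneEndedGroup G := by
  have hclos : Subgroup.closure (Set.range P.φ) = ⊤ := by
    refine (Subgroup.eq_top_iff' _).2 fun g => ?_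
    rw [← P.label_ψ g]
    obtain ⟨l, hl, hg⟩ := (P.ψ g).exists_mk
    rw [hg]
    refine Subgroup.list_prod_mem _ fun y hy => ?_
    obtain ⟨⟨e, b⟩, -, rfl⟩ := List.mem_map.1 hy
    have he : P.φ e ∈ Subgroup.closure (Set.range P.φ) := Subgroup.subset_closure ⟨e, rfl⟩
    cases b
    · exact inv_mem he
    · exact he
  have hS := Set.finite_range P.φ
  refine ⟨Set.range P.φ, hS, hclos, ?_⟩
  have : Infinite G := by
    by_contra hG
    rw [not_infinite_iff_finite] at hG
    exact not_finite_iff_infinite.2 ‹_› (Finite.of_injective _ P.coverLabel_projV_injective)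
  refine SimpleGraph.ConnectedAtInfinity.oneEnded (SimpleGraph.mulCayley_neighborSet_finite hS)
    (SimpleGraph.mulCayley_preconnected hclos) ?_
  refine h.map (coverLabel P.flat) 1 (SimpleGraph.mulCayley_neighborSet_finite hS) ?_ ?_ ?_
  · intro g
    refine Set.Finite.of_finite_image (f := projV) (Set.toFinite _) ?_
    intro q hq r hr hqr
    exact P.coverLabel_projV_injective (Prod.ext (hq.trans hr.symm) hqr)
  · intro a b hab
    obtain ⟨D, rfl, rfl⟩ := exists_dart_of_adj hab
    have hD : coverLabel P.flat (dtgt D) = coverLabel P.flat (dsrc D) * dartLabel P.φ (projD D) := by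
      rw [dtgt_eq_move]
      exact coverLabel_move P.flat _ _ _
    by_cases heq : coverLabel P.flat (dsrc D) = coverLabel P.flat (dtgt D)
    · rw [heq]
      exact ⟨SimpleGraph.Walk.nil, Nat.zero_le _⟩
    · refine ⟨SimpleGraph.Adj.toWalk ((SimpleGraph.mulCayley_adj' _ _ _).2
        ⟨heq, P.φ (projE D.1), ⟨_, rfl⟩, ?_⟩), by simp⟩
      rcases D with ⟨a, _ | _⟩
      · right
        rw [hD]
        simp [dartLabel, projD]
      · exact Or.inl hD.symm
  · intro g
    rw [← P.coverLabel_translate_base g]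
    exact ⟨_, SimpleGraph.Walk.nil, Nat.zero_le _⟩

end Development

end SquareComplex

/-! ### The fundamental group of the folded complex -/

section PartialProducts

variable {H : Type} [Group H] {L : ℕ}

theorem Fin.partialProd_last (f : Fin L → H) :
    Fin.partialProd f (Fin.last L) = (List.ofFn f).prod := by
  rw [Fin.partialProd, List.take_of_length_le (by simp)]

theorem Fin.map_partialProd {H' : Type} [Group H'] (ψ : H →* H') (f : Fin L → H)
    (k : Fin (L + 1)) : ψ (Fin.partialProd f k) = Fin.partialProd (fun r => ψ (f r)) k := by
  induction k using Fin.induction with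
  | zero => simp
  | succ k ih => rw [Fin.partialProd_succ, Fin.partialProd_succ, map_mul, ih]

theorem FreeGroup.lift_map_mk_ofFn {A B : Type} (f : B → H) (ι : A → B) (w : Fin L → A × Bool) :
    FreeGroup.lift f (FreeGroup.map ι (FreeGroup.mk (List.ofFn w))) =
      Fin.partialProd (fun k => cond (w k).2 (f (ι (w k).1)) (f (ι (w k).1))⁻¹) (Fin.last L) := by
  rw [Fin.partialProd_last, FreeGroup.map.mk, FreeGroup.lift_mk, List.map_ofFn, List.map_ofFn]
  rfl

variable [NeZero L]

/-- A ladder of commuting squares compares the partial products along its two sides. -/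
theorem Fin.partialProd_ladder {f g c : Fin L → H} (h : ∀ k, f k * c (k + 1) = c k * g k)
    (k : Fin (L + 1)) : Fin.partialProd f k * c (Fin.ofNat L k) = c 0 * Fin.partialProd g k := by
  induction k using Fin.induction with
  | zero =>
    have : Fin.ofNat L (0 : Fin (L + 1)) = 0 := by ext; simp
    rw [this]
    simp
  | succ k ih =>
    have h₁ : Fin.ofNat L k.castSucc = k := by ext; simp
    have h₂ : Fin.ofNat L k.succ = k + 1 := by ext; simp [Fin.val_add]
    rw [h₁] at ih
    rw [h₂, Fin.partialProd_succ, Fin.partialProd_succ, mul_assoc, h, ← mul_assoc, ih, mul_assoc]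

/-- The ladder with sides `f` and `g` closes up when the full products agree. -/
theorem Fin.exists_ladder {f g : Fin L → H}
    (h : Fin.partialProd f (Fin.last L) = Fin.partialProd g (Fin.last L)) (k : Fin L) :
    f k * ((Fin.partialProd f (k + 1).castSucc)⁻¹ * Fin.partialProd g (k + 1).castSucc) =
      (Fin.partialProd f k.castSucc)⁻¹ * Fin.partialProd g k.castSucc * g k := by
  have key : (Fin.partialProd f (k + 1).castSucc)⁻¹ * Fin.partialProd g (k + 1).castSucc =
      (Fin.partialProd f k.succ)⁻¹ * Fin.partialProd g k.succ := by
    by_cases hk : (k : ℕ) + 1 < L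
    · have : (k + 1).castSucc = k.succ := by
        ext
        simp [Fin.val_add, Nat.mod_eq_of_lt hk]
      rw [this]
    · have hk' : (k : ℕ) + 1 = L := by have := k.2; omega
      have h₁ : (k + 1).castSucc = 0 := by
        ext
        simp [Fin.val_add, hk']
      have h₂ : k.succ = Fin.last L := by
        ext
        simp [hk']
      rw [h₁, h₂, h]
      simp
  rw [key, Fin.partialProd_succ, Fin.partialProd_succ]
  group

end PartialProducts

namespace SquareComplex

/-- The two ways around a square are homotopic. -/
theorem HC.mk_square {X : SquareComplex} {u v : X.V} (s : X.S)
    (h : IsPath u [X.bdry s 0, X.bdry s 1] v)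
    (h' : IsPath u [drev (X.bdry s 3), drev (X.bdry s 2)] v) :
    HC.mk _ h = HC.mk _ h' := by
  have h₂ : IsPath v [X.bdry s 2, drev (X.bdry s 2)] v := by
    refine ⟨(dtgt_bdry s 1).symm.trans h.2.2, dsrc_drev _, ?_⟩
    exact (dtgt_drev _).trans ((dtgt_bdry s 1).symm.trans h.2.2)
  have h₃ : IsPath u [X.bdry s 0, X.bdry s 1, X.bdry s 2, drev (X.bdry s 2)] v := h.append h₂
  have h₄ : IsPath u [X.bdry s 0, X.bdry s 1, X.bdry s 2, X.bdry s 3, drev (X.bdry s 3),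
      drev (X.bdry s 2)] v := by
    refine ⟨h₃.1, h₃.2.1, h₃.2.2.1, (dtgt_bdry s 2).symm, dsrc_drev _, ?_, h'.2.2⟩
    exact (dsrc_drev _).trans ((dtgt_bdry s 2).trans (dtgt_drev _).symm)
  rw [HC.mk_eq_of_step h h₃ (HomotopyStep.backtrack [_, _] [] (X.bdry s 2)),
    HC.mk_eq_of_step h₃ h₄ (HomotopyStep.backtrack [_, _, _] [_] (X.bdry s 3))]
  exact (HC.mk_eq_of_step h' h₄ (HomotopyStep.square [] _ s)).symm

end SquareComplex

section Folded

open SquareComplex AmalgamVertex AmalgamEdge AmalgamSquare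

variable {m n L : ℕ} (w₁ : Fin L → Fin m × Bool) (w₂ : Fin L → Fin n × Bool)

/-- The element of the amalgam given by a letter of the first word. -/
def letter₁ (d : Fin m × Bool) : CyclicAmalgam w₁ w₂ :=
  cond d.2 (PresentedGroup.of (Sum.inl d.1)) (PresentedGroup.of (Sum.inl d.1))⁻¹

/-- The element of the amalgam given by a letter of the second word. -/
def letter₂ (d : Fin n × Bool) : CyclicAmalgam w₁ w₂ :=
  cond d.2 (PresentedGroup.of (Sum.inr d.1)) (PresentedGroup.of (Sum.inr d.1))⁻¹

/-- The defining relation of the amalgam, as an equality of products of letters. -/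
theorem partialProd_letter_eq :
    Fin.partialProd (fun k => letter₁ w₁ w₂ (w₁ k)) (Fin.last L) =
      Fin.partialProd (fun k => letter₂ w₁ w₂ (w₂ k)) (Fin.last L) := by
  have h := PresentedGroup.one_of_mem (rels := ({FreeGroup.map Sum.inl (FreeGroup.mk (List.ofFn w₁)) *
    (FreeGroup.map Sum.inr (FreeGroup.mk (List.ofFn w₂)))⁻¹} :
      Set (FreeGroup (Fin m ⊕ Fin n)))) rfl
  have hl : ∀ y, PresentedGroup.mk ({FreeGroup.map Sum.inl (FreeGroup.mk (List.ofFn w₁)) *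
    (FreeGroup.map Sum.inr (FreeGroup.mk (List.ofFn w₂)))⁻¹} :
      Set (FreeGroup (Fin m ⊕ Fin n))) y = FreeGroup.lift
        (fun a => (PresentedGroup.of a : CyclicAmalgam w₁ w₂)) y := fun y =>
    FreeGroup.lift_unique _ fun a => rfl
  rw [map_mul, map_inv, mul_inv_eq_one, hl, hl, FreeGroup.lift_map_mk_ofFn,
    FreeGroup.lift_map_mk_ofFn] at h
  exact h

variable [NeZero L] (i j : Fin L)

/-- The group element carried by the edge of the right column in row `k`: it compares the initial
segments of length `k` of the two words. -/
def rungLabel (k : Fin L) : CyclicAmalgam w₁ w₂ :=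
  (Fin.partialProd (fun k => letter₁ w₁ w₂ (w₁ k)) k.castSucc)⁻¹ *
    Fin.partialProd (fun k => letter₂ w₁ w₂ (w₂ k)) k.castSucc

/-- The rung labels are compatible with the squares of the right column. In the last row this uses
the defining relation. -/
theorem letter_mul_rungLabel (k : Fin L) :
    letter₁ w₁ w₂ (w₁ k) * rungLabel w₁ w₂ (k + 1) =
      rungLabel w₁ w₂ k * letter₂ w₁ w₂ (w₂ k) :=
  Fin.exists_ladder (partialProd_letter_eq w₁ w₂) k

theorem rungLabel_zero : rungLabel w₁ w₂ 0 = 1 := by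
  have : (0 : Fin L).castSucc = 0 := rfl
  simp [rungLabel, this]

/-- The labelling of the edges of the folded complex by elements of the amalgam. -/
def foldedLabel : (foldedComplex w₁ w₂ i j).E → CyclicAmalgam w₁ w₂ :=
  Quot.lift
    (fun e => match e with
      | petal₁ a => PresentedGroup.of (Sum.inl a)
      | petal₂ b => PresentedGroup.of (Sum.inr b)
      | rung₁ _ => 1
      | rung₂ k => rungLabel w₁ w₂ k
      | core k => letter₁ w₁ w₂ (w₁ k))
    (by rintro _ _ ⟨rfl, rfl⟩; rfl)

theorem foldedLabel_isFlat : IsFlat (foldedLabel w₁ w₂ i j) := by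
  have hinv₁ : ∀ d : Fin m × Bool, dartLabel (foldedLabel w₁ w₂ i j)
      (foldD w₁ w₂ i j (petal₁ d.1) (!d.2)) = (letter₁ w₁ w₂ d)⁻¹ := by
    rintro ⟨a, _ | _⟩
    · exact (inv_inv _).symm
    · rfl
  have h₂ : ∀ d : Fin n × Bool, dartLabel (foldedLabel w₁ w₂ i j)
      (foldD w₁ w₂ i j (petal₂ d.1) d.2) = letter₂ w₁ w₂ d := by
    rintro ⟨a, _ | _⟩ <;> rfl
  rintro (k | k)
  · change 1 * letter₁ w₁ w₂ (w₁ k) * 1⁻¹ * dartLabel (foldedLabel w₁ w₂ i j)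
      (foldD w₁ w₂ i j (petal₁ (w₁ k).1) (!(w₁ k).2)) = 1
    rw [hinv₁]
    simp
  · change rungLabel w₁ w₂ k * dartLabel (foldedLabel w₁ w₂ i j)
      (foldD w₁ w₂ i j (petal₂ (w₂ k).1) (w₂ k).2) * (rungLabel w₁ w₂ (k + 1))⁻¹ *
      (letter₁ w₁ w₂ (w₁ k))⁻¹ = 1
    rw [h₂, ← letter_mul_rungLabel]
    group

/-- The homotopy class of an oriented petal of the left rose. -/
def loop₁ (d : Fin m × Bool) :
    (foldedComplex w₁ w₂ i j).HC (foldV w₁ w₂ i j left) (foldV w₁ w₂ i j left) :=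
  HC.mk [foldD w₁ w₂ i j (petal₁ d.1) d.2] (by rcases d with ⟨a, _ | _⟩ <;> exact ⟨rfl, rfl⟩)

/-- The homotopy class of an oriented petal of the right rose. -/
def loop₂ (d : Fin n × Bool) :
    (foldedComplex w₁ w₂ i j).HC (foldV w₁ w₂ i j right) (foldV w₁ w₂ i j right) :=
  HC.mk [foldD w₁ w₂ i j (petal₂ d.1) d.2] (by rcases d with ⟨a, _ | _⟩ <;> exact ⟨rfl, rfl⟩)

/-- The homotopy class of an edge of the left column. -/
def rungClass₁ (k : Fin L) :
    (foldedComplex w₁ w₂ i j).HC (foldV w₁ w₂ i j left) (foldV w₁ w₂ i j (mid k)) :=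
  HC.mk [foldD w₁ w₂ i j (rung₁ k) true] ⟨rfl, rfl⟩

/-- The homotopy class of an edge of the right column. -/
def rungClass₂ (k : Fin L) :
    (foldedComplex w₁ w₂ i j).HC (foldV w₁ w₂ i j (mid k)) (foldV w₁ w₂ i j right) :=
  HC.mk [foldD w₁ w₂ i j (rung₂ k) true] ⟨rfl, rfl⟩

/-- The homotopy class of an edge of the core circle. -/
def coreClass (k : Fin L) :
    (foldedComplex w₁ w₂ i j).HC (foldV w₁ w₂ i j (mid k)) (foldV w₁ w₂ i j (mid (k + 1))) :=
  HC.mk [foldD w₁ w₂ i j (core k) true] ⟨rfl, rfl⟩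

theorem rungClass₁_comp_coreClass (k : Fin L) :
    (rungClass₁ w₁ w₂ i j k).comp (coreClass w₁ w₂ i j k) =
      (loop₁ w₁ w₂ i j (w₁ k)).comp (rungClass₁ w₁ w₂ i j (k + 1)) := by
  have h : IsPath (foldV w₁ w₂ i j left) [foldD w₁ w₂ i j (petal₁ (w₁ k).1) (!!(w₁ k).2),
      foldD w₁ w₂ i j (rung₁ (k + 1)) true] (foldV w₁ w₂ i j (mid (k + 1))) := by
    generalize w₁ k = d
    rcases d with ⟨a, _ | _⟩ <;> exact ⟨rfl, rfl, rfl⟩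
  refine (HC.mk_square (X := foldedComplex w₁ w₂ i j) (sq₁ k) ⟨rfl, rfl, rfl⟩ h).trans ?_
  exact HC.mk_congr _ (congrArg (fun b => [foldD w₁ w₂ i j (petal₁ (w₁ k).1) b,
    foldD w₁ w₂ i j (rung₁ (k + 1)) true]) (Bool.not_not _))

theorem rungClass₂_comp_loop₂ (k : Fin L) :
    (rungClass₂ w₁ w₂ i j k).comp (loop₂ w₁ w₂ i j (w₂ k)) =
      (coreClass w₁ w₂ i j k).comp (rungClass₂ w₁ w₂ i j (k + 1)) := by
  have h : IsPath (foldV w₁ w₂ i j (mid k)) [foldD w₁ w₂ i j (rung₂ k) true,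
      foldD w₁ w₂ i j (petal₂ (w₂ k).1) (w₂ k).2] (foldV w₁ w₂ i j right) := by
    generalize w₂ k = d
    rcases d with ⟨a, _ | _⟩ <;> exact ⟨rfl, rfl, rfl⟩
  exact HC.mk_square (X := foldedComplex w₁ w₂ i j) (sq₂ k) h ⟨rfl, rfl, rfl⟩

/-- The homotopy class of the edge path from left to right through row `k`. -/
def rowClass (k : Fin L) :
    (foldedComplex w₁ w₂ i j).HC (foldV w₁ w₂ i j left) (foldV w₁ w₂ i j right) :=
  (rungClass₁ w₁ w₂ i j k).comp (rungClass₂ w₁ w₂ i j k)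

/-- The two squares between the rows `k` and `k + 1` slide a path through one row to the other. -/
theorem loop₁_comp_rowClass (k : Fin L) :
    (loop₁ w₁ w₂ i j (w₁ k)).comp (rowClass w₁ w₂ i j (k + 1)) =
      (rowClass w₁ w₂ i j k).comp (loop₂ w₁ w₂ i j (w₂ k)) := by
  rw [rowClass, rowClass, HC.assoc, rungClass₂_comp_loop₂, ← HC.assoc, ← HC.assoc,
    rungClass₁_comp_coreClass]

/-- An oriented petal of the right rose, based at the vertex of the left rose via row `0`. -/
noncomputable def loop₂' (d : Fin n × Bool) :
    (foldedComplex w₁ w₂ i j).HC (foldV w₁ w₂ i j left) (foldV w₁ w₂ i j left) :=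
  ((rowClass w₁ w₂ i j 0).comp (loop₂ w₁ w₂ i j d)).comp (rowClass w₁ w₂ i j 0).inv

theorem loop₁_false (a : Fin m) : loop₁ w₁ w₂ i j (a, false) = (loop₁ w₁ w₂ i j (a, true))⁻¹ :=
  eq_inv_of_mul_eq_one_right (HC.mk_comp_rev (X := foldedComplex w₁ w₂ i j) _)

theorem loop₂'_false (b : Fin n) :
    loop₂' w₁ w₂ i j (b, false) = (loop₂' w₁ w₂ i j (b, true))⁻¹ := by
  have h : (loop₂ w₁ w₂ i j (b, true)).comp (loop₂ w₁ w₂ i j (b, false)) = HC.one _ :=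
    HC.mk_comp_rev (X := foldedComplex w₁ w₂ i j) _
  refine eq_inv_of_mul_eq_one_right ?_
  rw [HC.mul_def, loop₂', loop₂', HC.assoc, HC.assoc, HC.assoc, HC.inv_comp_cancel,
    ← HC.assoc (loop₂ _ _ _ _ _), h, HC.one_comp, HC.comp_inv]
  rfl

/-- The homotopy classes that correspond to the generators of the amalgam. -/
noncomputable def generatorLoop :
    Fin m ⊕ Fin n → (foldedComplex w₁ w₂ i j).HC (foldV w₁ w₂ i j left) (foldV w₁ w₂ i j left) :=
  Sum.elim (fun a => loop₁ w₁ w₂ i j (a, true)) (fun b => loop₂' w₁ w₂ i j (b, true))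

/-- The comparison of the paths through the rows `k` and `0`. -/
noncomputable def rowLoop (k : Fin L) :
    (foldedComplex w₁ w₂ i j).HC (foldV w₁ w₂ i j left) (foldV w₁ w₂ i j left) :=
  (rowClass w₁ w₂ i j k).comp (rowClass w₁ w₂ i j 0).inv

theorem rowLoop_zero : rowLoop w₁ w₂ i j 0 = 1 := HC.comp_inv _

theorem loop₁_mul_rowLoop (k : Fin L) :
    loop₁ w₁ w₂ i j (w₁ k) * rowLoop w₁ w₂ i j (k + 1) =
      rowLoop w₁ w₂ i j k * loop₂' w₁ w₂ i j (w₂ k) := by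
  rw [HC.mul_def, HC.mul_def, rowLoop, rowLoop, loop₂', ← HC.assoc, loop₁_comp_rowClass]
  simp only [HC.assoc, HC.inv_comp_cancel]

theorem partialProd_loop (k : Fin (L + 1)) :
    Fin.partialProd (fun k => loop₁ w₁ w₂ i j (w₁ k)) k * rowLoop w₁ w₂ i j (Fin.ofNat L k) =
      Fin.partialProd (fun k => loop₂' w₁ w₂ i j (w₂ k)) k := by
  rw [Fin.partialProd_ladder (loop₁_mul_rowLoop w₁ w₂ i j), rowLoop_zero, one_mul]

theorem cond_loop₁ (d : Fin m × Bool) : cond d.2 (loop₁ w₁ w₂ i j (d.1, true))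
    (loop₁ w₁ w₂ i j (d.1, true))⁻¹ = loop₁ w₁ w₂ i j d := by
  rcases d with ⟨a, _ | _⟩
  · exact (loop₁_false w₁ w₂ i j a).symm
  · rfl

theorem cond_loop₂' (d : Fin n × Bool) : cond d.2 (loop₂' w₁ w₂ i j (d.1, true))
    (loop₂' w₁ w₂ i j (d.1, true))⁻¹ = loop₂' w₁ w₂ i j d := by
  rcases d with ⟨a, _ | _⟩
  · exact (loop₂'_false w₁ w₂ i j a).symm
  · rfl

/-- The loops satisfy the defining relation, as the annulus closes up after the last row. -/
theorem generatorLoop_rel (r : FreeGroup (Fin m ⊕ Fin n))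
    (hr : r ∈ ({FreeGroup.map Sum.inl (FreeGroup.mk (List.ofFn w₁)) *
      (FreeGroup.map Sum.inr (FreeGroup.mk (List.ofFn w₂)))⁻¹} :
        Set (FreeGroup (Fin m ⊕ Fin n)))) : FreeGroup.lift (generatorLoop w₁ w₂ i j) r = 1 := by
  rw [Set.mem_singleton_iff] at hr
  rw [hr, map_mul, map_inv, mul_inv_eq_one, FreeGroup.lift_map_mk_ofFn, FreeGroup.lift_map_mk_ofFn]
  have h := partialProd_loop w₁ w₂ i j (Fin.last L)
  have h₀ : Fin.ofNat L (Fin.last L) = 0 := by ext; simp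
  rw [h₀, rowLoop_zero, mul_one] at h
  refine Eq.trans ?_ (h.trans ?_)
  · exact congrArg (fun f => Fin.partialProd f _) (funext fun k => cond_loop₁ w₁ w₂ i j (w₁ k))
  · exact congrArg (fun f => Fin.partialProd f _)
      (funext fun k => (cond_loop₂' w₁ w₂ i j (w₂ k)).symm)

/-- The homomorphism from the amalgam to the fundamental group of the folded complex. -/
noncomputable def foldedHom : CyclicAmalgam w₁ w₂ →*
    (foldedComplex w₁ w₂ i j).HC (foldV w₁ w₂ i j left) (foldV w₁ w₂ i j left) :=
  PresentedGroup.toGroup (generatorLoop_rel w₁ w₂ i j)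

theorem foldedHom_of (y : Fin m ⊕ Fin n) :
    foldedHom w₁ w₂ i j (PresentedGroup.of y) = generatorLoop w₁ w₂ i j y :=
  PresentedGroup.toGroup.of _

theorem foldedHom_letter₁ (d : Fin m × Bool) :
    foldedHom w₁ w₂ i j (letter₁ w₁ w₂ d) = loop₁ w₁ w₂ i j d := by
  rw [← cond_loop₁]
  rcases d with ⟨a, _ | _⟩
  · exact (map_inv _ _).trans (congrArg _ (foldedHom_of w₁ w₂ i j (Sum.inl a)))
  · exact foldedHom_of w₁ w₂ i j (Sum.inl a)

theorem foldedHom_letter₂ (d : Fin n × Bool) :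
    foldedHom w₁ w₂ i j (letter₂ w₁ w₂ d) = loop₂' w₁ w₂ i j d := by
  rw [← cond_loop₂']
  rcases d with ⟨a, _ | _⟩
  · exact (map_inv _ _).trans (congrArg _ (foldedHom_of w₁ w₂ i j (Sum.inr a)))
  · exact foldedHom_of w₁ w₂ i j (Sum.inr a)

theorem foldedHom_rungLabel (k : Fin L) :
    foldedHom w₁ w₂ i j (rungLabel w₁ w₂ k) = rowLoop w₁ w₂ i j k := by
  have h := partialProd_loop w₁ w₂ i j k.castSucc
  have hk : Fin.ofNat L k.castSucc = k := by ext; simp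
  rw [hk] at h
  rw [rungLabel, map_mul, map_inv, Fin.map_partialProd, Fin.map_partialProd]
  simp only [foldedHom_letter₁, foldedHom_letter₂]
  rw [← h, inv_mul_cancel_left]

/-- Reading labels inverts the homomorphism to the fundamental group. -/
theorem label_foldedHom (g : CyclicAmalgam w₁ w₂) :
    hcLabel (foldedLabel_isFlat w₁ w₂ i j) (foldedHom w₁ w₂ i j g) = g := by
  have key : ∀ d, hcLabel (foldedLabel_isFlat w₁ w₂ i j) (loop₁ w₁ w₂ i j (d, true)) =
      PresentedGroup.of (Sum.inl d) := fun d => mul_one _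
  have key₂ : ∀ d, hcLabel (foldedLabel_isFlat w₁ w₂ i j) (loop₂ w₁ w₂ i j (d, true)) =
      PresentedGroup.of (Sum.inr d) := fun d => mul_one _
  have hrow : hcLabel (foldedLabel_isFlat w₁ w₂ i j) (rowClass w₁ w₂ i j 0) = 1 := by
    change 1 * (rungLabel w₁ w₂ 0 * 1) = 1
    rw [rungLabel_zero, mul_one, mul_one]
  have hrow' : hcLabel (foldedLabel_isFlat w₁ w₂ i j) (rowClass w₁ w₂ i j 0).inv = 1 := by
    have := hcLabel_comp (foldedLabel_isFlat w₁ w₂ i j) (rowClass w₁ w₂ i j 0)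
      (rowClass w₁ w₂ i j 0).inv
    rw [HC.comp_inv, hrow, one_mul] at this
    exact this.symm
  let label : (foldedComplex w₁ w₂ i j).HC (foldV w₁ w₂ i j left) (foldV w₁ w₂ i j left) →*
      CyclicAmalgam w₁ w₂ :=
    { toFun := hcLabel (foldedLabel_isFlat w₁ w₂ i j)
      map_one' := rfl
      map_mul' := hcLabel_comp _ }
  have : label.comp (foldedHom w₁ w₂ i j) = MonoidHom.id _ := by
    refine PresentedGroup.ext fun y => ?_
    change hcLabel (foldedLabel_isFlat w₁ w₂ i j) (foldedHom w₁ w₂ i j (PresentedGroup.of y)) = _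
    rw [foldedHom_of]
    rcases y with a | b
    · exact key a
    · change hcLabel (foldedLabel_isFlat w₁ w₂ i j) (loop₂' w₁ w₂ i j (b, true)) = _
      rw [loop₂', hcLabel_comp, hcLabel_comp, hrow, hrow', key₂, one_mul, mul_one]
      rfl
  exact DFunLike.congr_fun this g

/-- The chosen lifts of the vertices of the folded complex. -/
def foldedLift : (foldedComplex w₁ w₂ i j).V →
    (foldedComplex w₁ w₂ i j).CoverVertex (foldedBase w₁ w₂ i j) :=
  Quot.lift
    (fun v => match v with
      | left => ⟨foldV w₁ w₂ i j left, HC.one _⟩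
      | mid k => ⟨foldV w₁ w₂ i j (mid k), rungClass₁ w₁ w₂ i j k⟩
      | right => ⟨foldV w₁ w₂ i j right, rowClass w₁ w₂ i j 0⟩)
    (by
      have hmid : foldV w₁ w₂ i j (mid i) = foldV w₁ w₂ i j (mid j) := Quot.sound (Or.inr ⟨rfl, rfl⟩)
      have hrung : foldD w₁ w₂ i j (rung₁ i) true = foldD w₁ w₂ i j (rung₁ j) true :=
        congrArg (·, true) (Quot.sound ⟨rfl, rfl⟩ : foldE w₁ w₂ i j _ = foldE w₁ w₂ i j _)
      have key : ∀ (u v u' : (foldedComplex w₁ w₂ i j).V) (d d' : (foldedComplex w₁ w₂ i j).Dart)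
          (h : IsPath u [d] v) (h' : IsPath u [d'] u'), v = u' → d = d' →
          (⟨v, HC.mk [d] h⟩ : (foldedComplex w₁ w₂ i j).CoverVertex u) = ⟨u', HC.mk [d'] h'⟩ := by
        rintro u v _ d _ h h' rfl rfl
        rfl
      rintro _ _ (⟨rfl, rfl⟩ | ⟨rfl, rfl⟩)
      · rfl
      · exact key _ _ _ _ _ _ _ hmid hrung)

/-- The fundamental group of the folded complex is the amalgam. -/
noncomputable def foldedDevelopment :
    Development (foldedComplex w₁ w₂ i j) (foldedBase w₁ w₂ i j) (CyclicAmalgam w₁ w₂) where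
  φ := foldedLabel w₁ w₂ i j
  flat := foldedLabel_isFlat w₁ w₂ i j
  ψ := foldedHom w₁ w₂ i j
  label_ψ := label_foldedHom w₁ w₂ i j
  T := foldedLift w₁ w₂ i j
  T_fst := by
    rintro ⟨v⟩
    cases v <;> rfl
  T_base := rfl
  T_move := by
    rintro ⟨e⟩
    cases e with
    | petal₁ a =>
      have h : loop₁ w₁ w₂ i j (a, true) = (foldedHom w₁ w₂ i j (PresentedGroup.of (Sum.inl a))).comp
          (HC.one (foldV w₁ w₂ i j left)) := by
        rw [HC.comp_one, foldedHom_of]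
        rfl
      exact (move_eq _ _ _).trans (Sigma.ext rfl (heq_of_eq h))
    | petal₂ b =>
      have h : (rowClass w₁ w₂ i j 0).comp (loop₂ w₁ w₂ i j (b, true)) =
          (foldedHom w₁ w₂ i j (PresentedGroup.of (Sum.inr b))).comp (rowClass w₁ w₂ i j 0) := by
        rw [foldedHom_of]
        change _ = (loop₂' w₁ w₂ i j (b, true)).comp _
        rw [loop₂', HC.assoc _ _ (rowClass w₁ w₂ i j 0), HC.inv_comp, HC.comp_one]
      exact (move_eq _ _ _).trans (Sigma.ext rfl (heq_of_eq h))
    | rung₁ k =>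
      have h : rungClass₁ w₁ w₂ i j k = (foldedHom w₁ w₂ i j 1).comp (rungClass₁ w₁ w₂ i j k) := by
        rw [map_one]
        exact (HC.one_comp _).symm
      exact (move_eq _ _ _).trans (Sigma.ext rfl (heq_of_eq h))
    | rung₂ k =>
      have h : (rungClass₁ w₁ w₂ i j k).comp (rungClass₂ w₁ w₂ i j k) =
          (foldedHom w₁ w₂ i j (rungLabel w₁ w₂ k)).comp (rowClass w₁ w₂ i j 0) := by
        rw [foldedHom_rungLabel, rowLoop, HC.assoc, HC.inv_comp, HC.comp_one]
        rfl
      exact (move_eq _ _ _).trans (Sigma.ext rfl (heq_of_eq h))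
    | core k =>
      have h : (rungClass₁ w₁ w₂ i j k).comp (coreClass w₁ w₂ i j k) =
          (foldedHom w₁ w₂ i j (letter₁ w₁ w₂ (w₁ k))).comp (rungClass₁ w₁ w₂ i j (k + 1)) := by
        rw [foldedHom_letter₁]
        exact rungClass₁_comp_coreClass w₁ w₂ i j k
      exact (move_eq _ _ _).trans (Sigma.ext rfl (heq_of_eq h))

end Folded

/-! ### Straight rays along the core circle -/

namespace SquareComplex

variable {X : SquareComplex} {x : X.V}

/-- An infinite edge path lifts to the universal cover. -/
theorem exists_lift_ray {d : ℕ → X.Dart} (hd : ∀ n, dsrc (d (n + 1)) = dtgt (d n))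
    (q : (X.universalCover x).V) (hq : dsrc (d 0) = projV q) :
    ∃ D : ℕ → (X.universalCover x).Dart, dsrc (D 0) = q ∧ (∀ n, projD (D n) = d n) ∧
      ∀ n, dsrc (D (n + 1)) = dtgt (D n) := by
  let V : (n : ℕ) → {v : (X.universalCover x).V // dsrc (d n) = projV v} := fun n =>
    n.rec ⟨q, hq⟩ fun n v => ⟨dtgt (lift v.1 (d n) v.2), by
      rw [← dtgt_projD, projD_lift, hd]⟩
  refine ⟨fun n => lift (V n).1 (d n) (V n).2, dsrc_lift _ _ _, fun n => projD_lift _ _ _,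
    fun n => dsrc_lift _ _ _⟩

theorem dsrc_lift_ray_congr {D D' : ℕ → (X.universalCover x).Dart} {N : ℕ}
    (h₀ : dsrc (D 0) = dsrc (D' 0)) (hD : ∀ n, dsrc (D (n + 1)) = dtgt (D n))
    (hD' : ∀ n, dsrc (D' (n + 1)) = dtgt (D' n)) (h : ∀ n < N, projD (D n) = projD (D' n)) :
    dsrc (D N) = dsrc (D' N) := by
  induction N with
  | zero => exact h₀
  | succ N ih => rw [hD, hD', dart_ext (ih fun n hn => h n (hn.trans N.lt_succ_self))
      (h N N.lt_succ_self)]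

theorem isStraight_of_projD {D : ℕ → (X.universalCover x).Dart}
    (hD : ∀ n, dsrc (D (n + 1)) = dtgt (D n))
    (h : ∀ n, projD (D (n + 1)) ≠ drev (projD (D n)) ∧
      ¬ Cornered (drev (projD (D n))) (projD (D (n + 1)))) : IsStraight D := fun n =>
  ⟨hD n, fun he => (h n).1 (by rw [he, projD_drev]), fun hc => (h n).2 hc.proj⟩

end SquareComplex

namespace SquareComplex

variable {Z : SquareComplex} {hor : Z.E → Prop}

/-- A square at the edge `a` moves an edge at the initial vertex of `a` to a parallel edge at the
terminal vertex. -/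
theorem IsCAT0VH.exists_transport (hZ : IsCAT0VH Z hor) {a b : Z.Dart} (h : Cornered a b) :
    ∃ b', dsrc b' = dtgt a ∧ b' ≠ drev a ∧ ∀ u, hZ.Toward u b → hZ.Toward u b' := by
  obtain ⟨⟨s, k⟩, ⟨rfl, rfl⟩ | ⟨rfl, rfl⟩⟩ := h
  · refine ⟨Z.bdry s (k + 1), (dtgt_bdry s k).symm, fun he => ?_, fun u hu => ?_⟩
    · refine hZ.npc.1 (s, k + 1) (Z.bdry s (k + 1)) (Or.inl ⟨rfl, ?_⟩)
      rw [he]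
      simp
    · rw [hZ.toward_drev] at hu
      rw [hZ.toward_bdry]
      have : k + 1 + 2 = k - 1 := by fin_cases k <;> rfl
      rwa [this]
  · have hk : k - 1 = k - 2 + 1 := by fin_cases k <;> rfl
    refine ⟨drev (Z.bdry s (k - 2)), ?_, fun he => ?_, fun u hu => ?_⟩
    · rw [dsrc_drev, dtgt_drev, dtgt_bdry, hk]
    · rw [drev_drev] at he
      refine hZ.npc.1 (s, k - 1) (Z.bdry s (k - 1)) (Or.inl ⟨rfl, ?_⟩)
      have : k - 1 - 1 = k - 2 := by fin_cases k <;> rfl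
      rw [this, he]
    · rw [hZ.toward_drev]
      rw [hZ.toward_bdry] at hu
      have : k + 2 = k - 2 := by fin_cases k <;> rfl
      rwa [this] at hu

end SquareComplex

section Folded

open SquareComplex AmalgamVertex AmalgamEdge AmalgamSquare

variable {m n L : ℕ} [NeZero L] {w₁ : Fin L → Fin m × Bool} {w₂ : Fin L → Fin n × Bool}
  {i j : Fin L} {x : (foldedComplex w₁ w₂ i j).V}

theorem add_ofNat_zero (k : Fin L) : k + Fin.ofNat L 0 = k := by
  have : Fin.ofNat L 0 = 0 := by ext; simp
  rw [this, add_zero]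

theorem add_ofNat_succ (k : Fin L) (t : ℕ) :
    k + Fin.ofNat L (t + 1) = k + Fin.ofNat L t + 1 := by
  have : Fin.ofNat L (t + 1) = Fin.ofNat L t + 1 := by ext; simp [Fin.val_add]
  rw [this, add_assoc]

theorem add_ofNat_mul (k : Fin L) (t : ℕ) : k + Fin.ofNat L (t * L) = k := by
  have : Fin.ofNat L (t * L) = 0 := by ext; simp
  rw [this, add_zero]

/-- A straight ray that winds around the core circle through the rows `c 0`, `c 1`, … . -/
def IsCoreRay (c : ℕ → Fin L) (D : ℕ → ((foldedComplex w₁ w₂ i j).universalCover x).Dart) : Prop :=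
  (∀ n, projD (D n) = foldD w₁ w₂ i j (core (c n)) true) ∧
    ∀ n, dsrc (D (n + 1)) = dtgt (D n)

theorem exists_isCoreRay (c : ℕ → Fin L)
    (hc : ∀ n, foldV w₁ w₂ i j (mid (c (n + 1))) = foldV w₁ w₂ i j (mid (c n + 1)))
    (q : ((foldedComplex w₁ w₂ i j).universalCover x).V)
    (hq : projV q = foldV w₁ w₂ i j (mid (c 0))) :
    ∃ D : ℕ → ((foldedComplex w₁ w₂ i j).universalCover x).Dart,
      dsrc (D 0) = q ∧ IsCoreRay c D := by
  obtain ⟨D, h₀, h₁, h₂⟩ := exists_lift_ray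
    (d := fun n => foldD w₁ w₂ i j (core (c n)) true) hc q hq.symm
  exact ⟨D, h₀, h₁, h₂⟩

theorem IsCoreRay.isStraight {c : ℕ → Fin L}
    {D : ℕ → ((foldedComplex w₁ w₂ i j).universalCover x).Dart} (h : IsCoreRay c D) :
    IsStraight D := by
  refine isStraight_of_projD h.2 fun n => ?_
  rw [h.1, h.1]
  refine ⟨fun he => ?_, (folded_isVH w₁ w₂ i j).not_cornered_of_same Iff.rfl⟩
  exact Bool.noConfusion (congrArg Prod.snd he)

/-- The lifts at the vertex `p` of the edges that leave the core circle in row `k`. -/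
def liftStar (p : ((foldedComplex w₁ w₂ i j).universalCover x).V) (k : Fin L) :
    Set ((foldedComplex w₁ w₂ i j).universalCover x).Dart :=
  {D | dsrc D = p ∧ projD D ∈ coreStar w₁ w₂ i j k}

theorem liftStar_separated (hij : i ≠ j) (p : ((foldedComplex w₁ w₂ i j).universalCover x).V) :
    ∀ d ∈ liftStar p i, ∀ d' ∈ liftStar p j, d ≠ d' ∧ ¬ Cornered d d' := by
  intro d hd d' hd'
  obtain ⟨h₁, h₂⟩ := not_cornered_of_mem_coreStar hij hd.2 hd'.2
  exact ⟨fun h => h₁ (congrArg projD h), fun h => h₂ h.proj⟩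

/-- At a lift of the folded vertex the only edge outside the two stars is the folded edge itself. -/
theorem mem_liftStar_of_dsrc {p : ((foldedComplex w₁ w₂ i j).universalCover x).V}
    (hp : projV p = foldV w₁ w₂ i j (mid i))
    {d : ((foldedComplex w₁ w₂ i j).universalCover x).Dart} (hd : dsrc d = p) :
    projD d = foldD w₁ w₂ i j (rung₁ i) false ∨ d ∈ liftStar p i ∪ liftStar p j := by
  have h := mem_coreStar_of_dsrc ((dsrc_projD d).trans ((congrArg projV hd).trans hp))
  rcases h with h | h | h
  · exact Or.inl h
  · exact Or.inr (Or.inl ⟨hd, h⟩)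
  · exact Or.inr (Or.inr ⟨hd, h⟩)

theorem foldV_mid_eq : foldV w₁ w₂ i j (mid i) = foldV w₁ w₂ i j (mid j) :=
  Quot.sound (Or.inr ⟨rfl, rfl⟩)

/-- If the folded edge could not be continued straight on at the left vertex, then the complex
would fall apart into two unbounded pieces when the two ends of this edge are removed. -/
theorem exists_straight_partner (hij : i ≠ j)
    {hor : ((foldedComplex w₁ w₂ i j).universalCover (foldedBase w₁ w₂ i j)).E → Prop}
    (hZ : IsCAT0VH ((foldedComplex w₁ w₂ i j).universalCover (foldedBase w₁ w₂ i j)) hor)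
    (hend : ((foldedComplex w₁ w₂ i j).universalCover
      (foldedBase w₁ w₂ i j)).skeleton.ConnectedAtInfinity) :
    ∃ b, dsrc b = foldV w₁ w₂ i j left ∧ b ≠ foldD w₁ w₂ i j (rung₁ i) true ∧
      ¬ Cornered (foldD w₁ w₂ i j (rung₁ i) true) b := by
  by_contra! hbad
  set Z := (foldedComplex w₁ w₂ i j).universalCover (foldedBase w₁ w₂ i j) with hZdef
  set q : Z.V := coverBase _ _
  set ρ : Z.Dart := lift q (foldD w₁ w₂ i j (rung₁ i) true) rfl with hρ
  have hρq : dsrc ρ = q := dsrc_lift _ _ _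
  have hρp : projD ρ = foldD w₁ w₂ i j (rung₁ i) true := projD_lift _ _ _
  have hp : projV (dtgt ρ) = foldV w₁ w₂ i j (mid i) := by
    rw [← dtgt_projD, hρp]
    rfl
  have hrev : ∀ d : Z.Dart, dsrc d = dtgt ρ →
      projD d = foldD w₁ w₂ i j (rung₁ i) false → d = drev ρ := fun d h₁ h₂ =>
    dart_ext (h₁.trans (dsrc_drev ρ).symm) (by rw [h₂, projD_drev, hρp]; rfl)
  have hcover : ∀ u : Z.V, u ∉ ({dtgt ρ, q} : Set Z.V) →
      ∃ d ∈ liftStar (dtgt ρ) i ∪ liftStar (dtgt ρ) j, hZ.Toward u d := by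
    intro u hu
    simp only [Set.mem_insert_iff, Set.mem_singleton_iff, not_or] at hu
    obtain ⟨d, hd, hud⟩ := hZ.exists_toward hu.1
    rcases mem_liftStar_of_dsrc hp hd with h | h
    · -- `u` lies on the side of `q`: leave `q` towards `u` and cross a square at `ρ`
      rw [hrev d hd h, hZ.toward_drev] at hud
      obtain ⟨d', hd', hud'⟩ := hZ.exists_toward hu.2
      have hc : Cornered ρ d' := by
        refine Cornered.of_proj ?_ (hρq.trans hd'.symm)
        rw [hρp]
        refine hbad _ (by rw [dsrc_projD, hd']; rfl) fun he => hud ?_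
        rw [dart_ext (hρq.trans hd'.symm) (hρp.trans he.symm)]
        exact hud'
      obtain ⟨b, hb₁, hb₂, hb₃⟩ := hZ.exists_transport hc
      rcases mem_liftStar_of_dsrc hp hb₁ with h' | h'
      · exact absurd (hrev b hb₁ h') hb₂
      · exact ⟨b, h', hb₃ u hud'⟩
    · exact ⟨d, h, hud⟩
  obtain ⟨K, hK, hjoin⟩ := hend {dtgt ρ, q} (Set.toFinite _)
  -- both pieces of the complement contain rays along the core circle, hence are unbounded
  have hray : ∀ k, projV (dtgt ρ) = foldV w₁ w₂ i j (mid k) →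
      ∃ d ∈ liftStar (dtgt ρ) k, ∃ u, u ∉ K ∧ hZ.Toward u d := by
    intro k hk
    obtain ⟨D, hD₀, hD⟩ := exists_isCoreRay (fun n => k + Fin.ofNat L n) (fun n => by
      rw [add_ofNat_succ]) (dtgt ρ) (hk.trans (by rw [add_ofNat_zero]))
    have hinj := hZ.straight_injective hD.isStraight
    obtain ⟨N, hN⟩ := (hK.preimage hinj.injOn).bddAbove
    refine ⟨D 0, ⟨hD₀, ?_⟩, dtgt (D N), fun hm => ?_, hZ.toward_straight hD.isStraight N⟩
    · rw [hD.1]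
      dsimp only
      rw [add_ofNat_zero]
      exact Or.inl rfl
    · have : N + 1 ≤ N := hN (by
        change dsrc (D (N + 1)) ∈ K
        rw [hD.2]
        exact hm)
      omega
  obtain ⟨d, hd, u, hu, hud⟩ := hray i hp
  obtain ⟨d', hd', v, hv, hvd'⟩ := hray j (hp.trans foldV_mid_eq)
  refine hZ.not_joinedOff (S := Set.univ) (K := {dtgt ρ, q})
    (Γ := Z.skeleton.comap Subtype.val) (fun _ _ h => h) (fun d hd => hd.1) (fun d hd => hd.1)
    (liftStar_separated hij (dtgt ρ)) (fun u _ => hcover u) hd hd'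
    (u := ⟨u, trivial⟩) (v := ⟨v, trivial⟩) hud hvd' ?_
  have huniv : ∀ u v : Z.V, Z.skeleton.JoinedOff {dtgt ρ, q} u v →
      (Z.skeleton.comap (Subtype.val : ↥(Set.univ : Set Z.V) → Z.V)).JoinedOff
        (Subtype.val ⁻¹' {dtgt ρ, q}) ⟨u, trivial⟩ ⟨v, trivial⟩ := by
    intro u v h
    induction h with
    | refl => exact Relation.ReflTransGen.refl
    | tail _ h ih => exact ih.tail h
  exact huniv u v (hjoin u v hu hv)

end Folded

/-! ### A halfspace with infinitely many ends -/

section Folded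

open SquareComplex AmalgamVertex AmalgamEdge AmalgamSquare

variable {m n L : ℕ} [NeZero L] {w₁ : Fin L → Fin m × Bool} {w₂ : Fin L → Fin n × Bool}
  {i j : Fin L} {x : (foldedComplex w₁ w₂ i j).V}

/-- The edges of the left column that meet a core ray at consecutive vertices are opposite edges of
a square. -/
theorem toward_rung_step
    {hor : ((foldedComplex w₁ w₂ i j).universalCover x).E → Prop}
    (hZ : IsCAT0VH ((foldedComplex w₁ w₂ i j).universalCover x) hor) {k : Fin L}
    {E δ δ' : ((foldedComplex w₁ w₂ i j).universalCover x).Dart}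
    (hE : projD E = foldD w₁ w₂ i j (core k) true)
    (hδ : projD δ = foldD w₁ w₂ i j (rung₁ k) false)
    (hδ' : projD δ' = foldD w₁ w₂ i j (rung₁ (k + 1)) false)
    (h : dsrc δ = dsrc E) (h' : dsrc δ' = dtgt E)
    (u : ((foldedComplex w₁ w₂ i j).universalCover x).V) : hZ.Toward u δ ↔ hZ.Toward u δ' := by
  obtain ⟨t, ht, hts⟩ := exists_lift_square (X := foldedComplex w₁ w₂ i j) (x := x) 1 (sq₁ k)
    (dsrc E) ((congrArg dsrc hE.symm).trans (dsrc_projD E))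
  have hb : ∀ l, projD (((foldedComplex w₁ w₂ i j).universalCover x).bdry t l) =
      (foldedComplex w₁ w₂ i j).bdry (sq₁ k) l := fun l =>
    (projD_bdry t l).trans (congrArg (fun s => (foldedComplex w₁ w₂ i j).bdry s l) ht)
  have e₁ : ((foldedComplex w₁ w₂ i j).universalCover x).bdry t 1 = E :=
    dart_ext hts ((hb 1).trans hE.symm)
  have e₀ : drev (((foldedComplex w₁ w₂ i j).universalCover x).bdry t 0) = δ := by
    refine dart_ext ?_ ?_
    · rw [dsrc_drev, dtgt_bdry, h]
      exact hts
    · rw [projD_drev, hb, hδ]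
      rfl
  have e₂ : ((foldedComplex w₁ w₂ i j).universalCover x).bdry t 2 = δ' := by
    refine dart_ext ?_ ((hb 2).trans hδ'.symm)
    rw [h', ← e₁]
    exact (dtgt_bdry t 1).symm
  rw [← e₀, ← e₂, hZ.toward_drev, hZ.toward_bdry u t 0, not_not]
  rfl

/-- The core ray through the rows `i`, `i + 1`, … has all the edges of the left column along it in
one hyperplane. -/
theorem IsCoreRay.toward_rung
    {hor : ((foldedComplex w₁ w₂ i j).universalCover x).E → Prop}
    (hZ : IsCAT0VH ((foldedComplex w₁ w₂ i j).universalCover x) hor) {c : ℕ → Fin L}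
    {D : ℕ → ((foldedComplex w₁ w₂ i j).universalCover x).Dart} (hD : IsCoreRay c D) {N : ℕ}
    (hc : ∀ n < N, c n = i + Fin.ofNat L n)
    {ρ δ : ((foldedComplex w₁ w₂ i j).universalCover x).Dart} (hρ : dtgt ρ = dsrc (D 0))
    (hρi : projD ρ = foldD w₁ w₂ i j (rung₁ i) true) (hδ : dsrc δ = dsrc (D N))
    (hδi : projD δ = foldD w₁ w₂ i j (rung₁ (i + Fin.ofNat L N)) false)
    (u : ((foldedComplex w₁ w₂ i j).universalCover x).V) : hZ.Toward u δ ↔ ¬ hZ.Toward u ρ := by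
  induction N generalizing δ with
  | zero =>
    rw [add_ofNat_zero] at hδi
    have : δ = drev ρ := dart_ext (by rw [dsrc_drev, hρ, hδ]) (by
      rw [hδi, projD_drev, hρi]
      rfl)
    rw [this, hZ.toward_drev]
  | succ N ih =>
    have hN : dtgt (projD (D N)) = foldV w₁ w₂ i j (mid (i + Fin.ofNat L N + 1)) := by
      rw [hD.1, hc N N.lt_succ_self]
      rfl
    have hsrc : dsrc (foldD w₁ w₂ i j (rung₁ (i + Fin.ofNat L N)) false) = projV (dsrc (D N)) := by
      rw [← dsrc_projD, hD.1, hc N N.lt_succ_self]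
      rfl
    rw [← ih (fun n hn => hc n (hn.trans N.lt_succ_self)) (dsrc_lift (dsrc (D N)) _ hsrc)
      (projD_lift _ _ _)]
    rw [add_ofNat_succ] at hδi
    refine (toward_rung_step hZ ?_ (projD_lift _ _ _) hδi (dsrc_lift _ _ _)
      (hδ.trans (hD.2 N)) u).symm
    rw [hD.1, hc N N.lt_succ_self]

/-- The sequence of rows `i`, `i + 1`, … that is continued by `j`, `j + 1`, … after `k` turns around
the core circle. -/
def turnRows (i j : Fin L) (k t : ℕ) : Fin L :=
  if t < k * L then i + Fin.ofNat L t else j + Fin.ofNat L t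

/-- Each core edge ends where the next one starts. At the change from `i` to `j` this is due to the
folding. -/
theorem foldV_turnRows (k t : ℕ) : foldV w₁ w₂ i j (mid (turnRows i j k (t + 1))) =
    foldV w₁ w₂ i j (mid (turnRows i j k t + 1)) := by
  unfold turnRows
  split_ifs with h₁ h₂ h₂
  · rw [add_ofNat_succ]
  · omega
  · have : t + 1 = k * L := by omega
    rw [← add_ofNat_succ, this, add_ofNat_mul, add_ofNat_mul]
    exact foldV_mid_eq.symm
  · rw [add_ofNat_succ]

/-- In a halfspace of the left column, rays that leave a core line after different numbers of turns
are separated by single vertices. -/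
theorem exists_infiniteEnded_halfspace (hij : i ≠ j)
    (hZ : IsCAT0VH ((foldedComplex w₁ w₂ i j).universalCover (foldedBase w₁ w₂ i j))
      fun e => foldedHor w₁ w₂ i j (projE e)) :
    ∃ h : Set ((foldedComplex w₁ w₂ i j).universalCover (foldedBase w₁ w₂ i j)).V,
      IsHalfspace h ∧ (((foldedComplex w₁ w₂ i j).universalCover
        (foldedBase w₁ w₂ i j)).skeleton.induce h).InfiniteEnded := by
  set Z := (foldedComplex w₁ w₂ i j).universalCover (foldedBase w₁ w₂ i j) with hZdef
  set ρ : Z.Dart := lift (coverBase _ _) (foldD w₁ w₂ i j (rung₁ i) true) rfl with hρ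
  have hρp : projD ρ = foldD w₁ w₂ i j (rung₁ i) true := projD_lift _ _ _
  have hp : projV (dtgt ρ) = foldV w₁ w₂ i j (mid i) := by
    rw [← dtgt_projD, hρp]
    rfl
  refine ⟨side ρ, ⟨ρ, rfl⟩, ?_⟩
  have hray : ∀ k, ∃ D : ℕ → Z.Dart, dsrc (D 0) = dtgt ρ ∧ IsCoreRay (turnRows i j k) D := by
    intro k
    refine exists_isCoreRay _ (foldV_turnRows k) _ (hp.trans ?_)
    unfold turnRows
    split_ifs <;> rw [add_ofNat_zero]
    exact foldV_mid_eq
  choose D hD₀ hD using hray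
  have hmem : ∀ k t, dsrc (D k t) ∈ side ρ := by
    intro k t
    induction t with
    | zero =>
      rw [hD₀, hZ.mem_side_iff]
      exact hZ.toward_dtgt ρ
    | succ t ih =>
      rw [hZ.mem_side_iff] at ih ⊢
      rw [(hD k).2]
      -- the ray consists of vertical edges, and the hyperplane of `ρ` is dual to horizontal ones
      by_contra hn
      have hpar := hZ.vh.parallel (hZ.parallel_of_toward ih hn)
      have h₁ : projE ρ.1 = foldE w₁ w₂ i j (rung₁ i) := congrArg Prod.fst hρp
      have h₂ : projE (D k t).1 = foldE w₁ w₂ i j (core (turnRows i j k t)) :=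
        congrArg Prod.fst ((hD k).1 t)
      rw [h₁, h₂] at hpar
      exact hpar.1 trivial
  have hend : ∀ k, ∃ ε ∈ (Z.skeleton.induce (side ρ)).end, ∀ K : Finset ↥(side ρ),
      ∃ N, ∀ t ≥ N, ∃ h : (⟨dsrc (D k t), hmem k t⟩ : side ρ) ∉ K,
        ε (Opposite.op K) = (Z.skeleton.induce (side ρ)).componentComplMk h := by
    intro k
    refine SimpleGraph.exists_end_of_ray (fun t => ?_) fun s t hst => ?_
    · have := hZ.adj_dart (D k t)
      rw [← (hD k).2] at this
      exact this
    · exact hZ.straight_injective (hD k).isStraight (congrArg Subtype.val hst)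
  choose ε hε hεK using hend
  have hagree : ∀ k l, k < l → dsrc (D k (k * L)) = dsrc (D l (k * L)) := by
    intro k l hkl
    refine dsrc_lift_ray_congr ((hD₀ k).trans (hD₀ l).symm) (hD k).2 (hD l).2 fun t ht => ?_
    have ht' : t < l * L := ht.trans_le (Nat.mul_le_mul_right L hkl.le)
    rw [(hD k).1, (hD l).1, turnRows, turnRows, if_pos ht, if_pos ht']
  have hcover : ∀ k, ∀ u ∈ side ρ, u ∉ ({dsrc (D k (k * L))} : Set Z.V) →
      ∃ d ∈ liftStar (dsrc (D k (k * L))) i ∪ liftStar (dsrc (D k (k * L))) j,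
        hZ.Toward u d := by
    intro k u hu hne
    obtain ⟨d, hd, hud⟩ := hZ.exists_toward hne
    have hproj : projV (dsrc (D k (k * L))) = foldV w₁ w₂ i j (mid i) := by
      rw [← dsrc_projD, (hD k).1, turnRows, if_neg (lt_irrefl _), add_ofNat_mul]
      exact foldV_mid_eq.symm
    rcases mem_liftStar_of_dsrc hproj hd with h | h
    -- the folded edge is dual to the hyperplane of `ρ` and leads out of the halfspace
    · have := ((hD k).toward_rung hZ (N := k * L) (fun t ht => if_pos ht) (hD₀ k).symm hρp hd
        (by rw [add_ofNat_mul, h]) u).1 hud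
      exact absurd (hZ.mem_side_iff.1 hu) this
    · exact ⟨d, h, hud⟩
  have hne : ∀ k l, k < l → ε k ≠ ε l := by
    intro k l hkl heq
    have hL : 0 < L := Nat.pos_of_neZero L
    -- the two rays part at `P`, one along row `j` and one along row `i`, and `P` separates them
    set P := dsrc (D k (k * L)) with hP
    set K : Finset ↥(side ρ) := {⟨P, hmem k _⟩} with hK
    obtain ⟨N, hN⟩ := hεK k K
    obtain ⟨N', hN'⟩ := hεK l K
    obtain ⟨h₁, h₂⟩ := hN (k * L + (N + N') + 1) (by omega)
    obtain ⟨h₁', h₂'⟩ := hN' (k * L + (N + N') + 1) (by omega)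
    have hjoin := SimpleGraph.joinedOff_of_componentComplMk_eq (h₂'.symm.trans (heq ▸ h₂))
    have hsub : (Subtype.val ⁻¹' {P} : Set ↥(side ρ)) ⊆ (K : Set ↥(side ρ)) := by
      intro y hy
      simp only [hK, Finset.coe_singleton, Set.mem_singleton_iff]
      exact Subtype.ext hy
    have hTk : hZ.Toward (dsrc (D k (k * L + (N + N') + 1))) (D k (k * L)) := by
      rw [(hD k).2]
      exact hZ.toward_straight ((hD k).isStraight.tail (k * L)) (N + N')
    have hTl : hZ.Toward (dsrc (D l (k * L + (N + N') + 1))) (D l (k * L)) := by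
      rw [(hD l).2]
      exact hZ.toward_straight ((hD l).isStraight.tail (k * L)) (N + N')
    refine hZ.not_joinedOff (S := side ρ) (K := {P}) (fun _ _ h => h) (fun d hd => hd.1)
      (fun d hd => hd.1) (liftStar_separated hij P) (hcover k) (d := D l (k * L))
      (d' := D k (k * L)) ⟨(hagree k l hkl).symm, ?_⟩ ⟨rfl, ?_⟩ hTl hTk (hjoin.mono hsub)
    · have : k * L < l * L := Nat.mul_lt_mul_of_pos_right hkl hL
      rw [(hD l).1, turnRows, if_pos this, add_ofNat_mul]
      exact Or.inl rfl
    · rw [(hD k).1, turnRows, if_neg (lt_irrefl _), add_ofNat_mul]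
      exact Or.inl rfl
  refine Set.infinite_of_injective_forall_mem (f := ε) (fun k l h => ?_) hε
  by_contra hkl
  rcases Nat.lt_or_gt_of_ne hkl with hlt | hlt
  · exact hne k l hlt h
  · exact hne l k hlt h.symm

end Folded

/-! ### Links that are cycles -/

namespace SquareComplex

variable {Z : SquareComplex}

/-- A cycle stays connected when a set of pairwise adjacent vertices is removed from it. -/
theorem punctured_cycle_connected {M : ℕ} [NeZero M] {C : Fin M → Z.Dart}
    (hadj : ∀ a, Cornered (C a) (C (a + 1)))
    (hnon : ∀ a b, a ≠ b → b ≠ a + 1 → a ≠ b + 1 → C a ≠ C b ∧ ¬ Cornered (C a) (C b))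
    {D : Set Z.Dart} (hD : ∀ a b, C a ∈ D → C b ∈ D → C a ≠ C b → Cornered (C a) (C b))
    {a b : Fin M} (ha : C a ∉ D) (hb : C b ∉ D) :
    Relation.ReflTransGen (fun x y => Cornered x y ∧ x ∉ D ∧ y ∉ D) (C a) (C b) := by
  have hrev : ∀ {x y}, Relation.ReflTransGen (fun x y => Cornered x y ∧ x ∉ D ∧ y ∉ D) x y →
      Relation.ReflTransGen (fun x y => Cornered x y ∧ x ∉ D ∧ y ∉ D) y x := by
    intro x y h
    induction h with
    | refl => exact Relation.ReflTransGen.refl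
    | tail _ h ih => exact Relation.ReflTransGen.head ⟨h.1.symm, h.2.2, h.2.1⟩ ih
  have hmod : ∀ p q, p < q → q < p + M → Fin.ofNat M p ≠ Fin.ofNat M q := by
    intro p q h₁ h₂ he
    have he' : p % M = q % M := congrArg Fin.val he
    have h := Nat.sub_mod_eq_zero_of_mod_eq he'.symm
    rw [Nat.mod_eq_of_lt (by omega)] at h
    omega
  have hsucc : ∀ p, Fin.ofNat M (p + 1) = Fin.ofNat M p + 1 := fun p => by
    ext; simp [Fin.val_add]
  have hval : ∀ a : Fin M, Fin.ofNat M a.val = a := fun a => by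
    ext; simp
  have harc : ∀ s k, (∀ r ≤ k, C (Fin.ofNat M (s + r)) ∉ D) →
      Relation.ReflTransGen (fun x y => Cornered x y ∧ x ∉ D ∧ y ∉ D) (C (Fin.ofNat M s))
        (C (Fin.ofNat M (s + k))) := by
    intro s k
    induction k with
    | zero => exact fun _ => Relation.ReflTransGen.refl
    | succ k ih =>
      intro h
      refine (ih fun r hr => h r (hr.trans k.le_succ)).tail ⟨?_, h k k.le_succ, h _ le_rfl⟩
      rw [← add_assoc, hsucc]
      exact hadj _
  have key : ∀ a b : Fin M, a ≤ b → C a ∉ D → C b ∉ D →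
      Relation.ReflTransGen (fun x y => Cornered x y ∧ x ∉ D ∧ y ∉ D) (C a) (C b) := by
    intro a b hab ha hb
    have hab' : a.val ≤ b.val := hab
    have hM : Fin.ofNat M (a.val + M) = a := by ext; simp [Nat.mod_eq_of_lt a.2]
    by_cases h : ∀ r ≤ b.val - a.val, C (Fin.ofNat M (a.val + r)) ∉ D
    · have := harc a.val (b.val - a.val) h
      rwa [Nat.add_sub_cancel' hab', hval, hval] at this
    · push Not at h
      obtain ⟨p, hp, hpD⟩ := h
      -- a vertex of `D` between `a` and `b` is not adjacent to any vertex on the other arc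
      have h' : ∀ r ≤ a.val + M - b.val, C (Fin.ofNat M (b.val + r)) ∉ D := by
        intro r hr hrD
        have hb' := b.2
        have h₁ : p ≠ 0 := by
          rintro rfl
          rw [add_zero, hval] at hpD
          exact ha hpD
        have h₂ : a.val + p ≠ b.val := fun h => by
          rw [h, hval] at hpD
          exact hb hpD
        have h₃ : r ≠ 0 := by
          rintro rfl
          rw [add_zero, hval] at hrD
          exact hb hrD
        have h₄ : b.val + r ≠ a.val + M := fun h => by
          rw [h, hM] at hrD
          exact ha hrD
        have n₁ := hmod (a.val + p) (b.val + r) (by omega) (by omega)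
        have n₂ := hmod (a.val + p + 1) (b.val + r) (by omega) (by omega)
        have n₃ := hmod (a.val + p) (b.val + r + 1) (by omega) (by omega)
        rw [hsucc] at n₂ n₃
        obtain ⟨h₅, h₆⟩ := hnon _ _ n₁ n₂.symm n₃
        exact h₆ (hD _ _ hpD hrD h₅)
      have := harc b.val (a.val + M - b.val) h'
      have hb' := b.2
      rw [Nat.add_sub_cancel' (by omega), hval, hM] at this
      exact hrev this
  rcases le_total a b with h | h
  · exact key a b h ha hb
  · exact hrev (key b a h hb ha)

end SquareComplex

section Folded

open SquareComplex AmalgamVertex AmalgamEdge AmalgamSquare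

section

variable {m n L : ℕ} [NeZero L] (w₁ : Fin L → Fin m × Bool) (w₂ : Fin L → Fin n × Bool)
  (i : Fin L)

theorem cornered_rung₁_true {k : Fin L} {e : AmalgamEdge m n L} {b : Bool} :
    Cornered (foldD w₁ w₂ i i (rung₁ k) true) (foldD w₁ w₂ i i e b) ↔
      (e = petal₁ (w₁ k).1 ∧ b = (w₁ k).2) ∨
        (e = petal₁ (w₁ (k - 1)).1 ∧ b = !(w₁ (k - 1)).2) := by
  rw [folded_cornered_iff w₁ w₂ i i (show rungEdge (rung₁ k) from trivial)]
  simp only [edgeRep_self]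
  constructor
  · rintro ⟨s | s, c, ⟨h₁, h₂⟩, h₃, h₄⟩ <;> fin_cases c <;>
      simp [cornerRung, cornerVert] at h₁ h₂ h₃ h₄
    · subst h₁; exact Or.inl ⟨h₃, h₄⟩
    · subst h₁; right; simpa using ⟨h₃, h₄⟩
  · rintro (h | h)
    · exact ⟨sq₁ k, 0, ⟨rfl, rfl⟩, h⟩
    · exact ⟨sq₁ (k - 1), 3, ⟨by simp [cornerRung], rfl⟩, h⟩

theorem cornered_rung₁_false {k : Fin L} {e : AmalgamEdge m n L} {b : Bool} :
    Cornered (foldD w₁ w₂ i i (rung₁ k) false) (foldD w₁ w₂ i i e b) ↔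
      (e = core k ∧ b = true) ∨ (e = core (k - 1) ∧ b = false) := by
  rw [folded_cornered_iff w₁ w₂ i i (show rungEdge (rung₁ k) from trivial)]
  simp only [edgeRep_self]
  constructor
  · rintro ⟨s | s, c, ⟨h₁, h₂⟩, h₃, h₄⟩ <;> fin_cases c <;>
      simp [cornerRung, cornerVert] at h₁ h₂ h₃ h₄
    · subst h₁; exact Or.inl ⟨h₃, h₄⟩
    · subst h₁; right; simpa using ⟨h₃, h₄⟩
  · rintro (h | h)
    · exact ⟨sq₁ k, 1, ⟨rfl, rfl⟩, h⟩
    · exact ⟨sq₁ (k - 1), 2, ⟨by simp [cornerRung], rfl⟩, h⟩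

theorem cornered_rung₂_true {k : Fin L} {e : AmalgamEdge m n L} {b : Bool} :
    Cornered (foldD w₁ w₂ i i (rung₂ k) true) (foldD w₁ w₂ i i e b) ↔
      (e = core k ∧ b = true) ∨ (e = core (k - 1) ∧ b = false) := by
  rw [folded_cornered_iff w₁ w₂ i i (show rungEdge (rung₂ k) from trivial)]
  simp only [edgeRep_self]
  constructor
  · rintro ⟨s | s, c, ⟨h₁, h₂⟩, h₃, h₄⟩ <;> fin_cases c <;>
      simp [cornerRung, cornerVert] at h₁ h₂ h₃ h₄
    · subst h₁; exact Or.inl ⟨h₃, h₄⟩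
    · subst h₁; right; simpa using ⟨h₃, h₄⟩
  · rintro (h | h)
    · exact ⟨sq₂ k, 0, ⟨rfl, rfl⟩, h⟩
    · exact ⟨sq₂ (k - 1), 3, ⟨by simp [cornerRung], rfl⟩, h⟩

theorem cornered_rung₂_false {k : Fin L} {e : AmalgamEdge m n L} {b : Bool} :
    Cornered (foldD w₁ w₂ i i (rung₂ k) false) (foldD w₁ w₂ i i e b) ↔
      (e = petal₂ (w₂ k).1 ∧ b = (w₂ k).2) ∨
        (e = petal₂ (w₂ (k - 1)).1 ∧ b = !(w₂ (k - 1)).2) := by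
  rw [folded_cornered_iff w₁ w₂ i i (show rungEdge (rung₂ k) from trivial)]
  simp only [edgeRep_self]
  constructor
  · rintro ⟨s | s, c, ⟨h₁, h₂⟩, h₃, h₄⟩ <;> fin_cases c <;>
      simp [cornerRung, cornerVert] at h₁ h₂ h₃ h₄
    · subst h₁; exact Or.inl ⟨h₃, h₄⟩
    · subst h₁; right; simpa using ⟨h₃, h₄⟩
  · rintro (h | h)
    · exact ⟨sq₂ k, 1, ⟨rfl, rfl⟩, h⟩
    · exact ⟨sq₂ (k - 1), 2, ⟨by simp [cornerRung], rfl⟩, h⟩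

end

/-! ### The double of the punctured torus group -/

/-- The commutator `a b a⁻¹ b⁻¹`. -/
def commutatorWord : Fin 4 → Fin 2 × Bool := ![(0, true), (1, true), (0, false), (1, false)]

/-- The oriented edges at the left vertex, in the cyclic order of the link. -/
def leftLink : Fin 8 → AmalgamEdge 2 2 4 × Bool :=
  ![(petal₁ 0, true), (rung₁ 0, true), (petal₁ 1, true), (rung₁ 1, true),
    (petal₁ 0, false), (rung₁ 2, true), (petal₁ 1, false), (rung₁ 3, true)]

/-- The oriented edges at the right vertex, in the cyclic order of the link. -/
def rightLink : Fin 8 → AmalgamEdge 2 2 4 × Bool :=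
  ![(petal₂ 0, true), (rung₂ 0, false), (petal₂ 1, true), (rung₂ 1, false),
    (petal₂ 0, false), (rung₂ 2, false), (petal₂ 1, false), (rung₂ 3, false)]

/-- The oriented edges at a vertex of the core circle, in the cyclic order of the link. -/
def midLink (k : Fin 4) : Fin 4 → AmalgamEdge 2 2 4 × Bool :=
  ![(rung₁ k, false), (core k, true), (rung₂ k, true), (core (k - 1), false)]

/-- All links of the unfolded complex are cycles, of length eight at the vertices of the roses and
of length four on the core circle. -/
theorem commutator_puncturedLinksConnected :
    PuncturedLinksConnected (foldedComplex commutatorWord commutatorWord 0 0) := by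
  have key : ∀ (M : ℕ) [NeZero M] (v : AmalgamVertex 4) (C : Fin M → AmalgamEdge 2 2 4 × Bool),
      (∀ a, dsrc (foldD commutatorWord commutatorWord 0 0 (C a).1 (C a).2) =
        foldV commutatorWord commutatorWord 0 0 v) →
      (∀ a, Cornered (foldD commutatorWord commutatorWord 0 0 (C a).1 (C a).2)
        (foldD commutatorWord commutatorWord 0 0 (C (a + 1)).1 (C (a + 1)).2)) →
      (∀ a b, a ≠ b → b ≠ a + 1 → a ≠ b + 1 → C a ≠ C b ∧
        ¬ Cornered (foldD commutatorWord commutatorWord 0 0 (C a).1 (C a).2)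
          (foldD commutatorWord commutatorWord 0 0 (C b).1 (C b).2)) →
      (∀ e b, cond b ((amalgamComplex commutatorWord commutatorWord).src e)
        ((amalgamComplex commutatorWord commutatorWord).tgt e) = v → ∃ a, C a = (e, b)) →
      ∀ D : Set (foldedComplex commutatorWord commutatorWord 0 0).Dart,
      (∀ a ∈ D, ∀ b ∈ D, a ≠ b → dsrc a = foldV commutatorWord commutatorWord 0 0 v →
        dsrc b = foldV commutatorWord commutatorWord 0 0 v → Cornered a b) →
      ∀ α β, dsrc α = foldV commutatorWord commutatorWord 0 0 v →
        dsrc β = foldV commutatorWord commutatorWord 0 0 v → α ∉ D → β ∉ D →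
        Relation.ReflTransGen (fun a b => Cornered a b ∧ a ∉ D ∧ b ∉ D) α β := by
    intro M _ v C hC hadj hnon hall D hD α β hα hβ hαD hβD
    have hex : ∀ d, dsrc d = foldV commutatorWord commutatorWord 0 0 v →
        ∃ a, foldD commutatorWord commutatorWord 0 0 (C a).1 (C a).2 = d := by
      intro d hd
      obtain ⟨e, b, rfl⟩ := exists_foldD commutatorWord commutatorWord 0 0 d
      rw [dsrc_foldD, foldV_eq_iff, vertexRep_self, vertexRep_self] at hd
      obtain ⟨a, ha⟩ := hall e b hd
      exact ⟨a, by rw [ha]⟩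
    obtain ⟨a, rfl⟩ := hex α hα
    obtain ⟨b, rfl⟩ := hex β hβ
    refine punctured_cycle_connected
      (C := fun a => foldD commutatorWord commutatorWord 0 0 (C a).1 (C a).2) hadj
      (fun a b h₁ h₂ h₃ => ?_) (fun a b ha hb hab => hD _ ha _ hb hab (hC a) (hC b)) hαD hβD
    refine ⟨fun he => (hnon a b h₁ h₂ h₃).1 ?_, (hnon a b h₁ h₂ h₃).2⟩
    rw [foldD_eq_iff, edgeRep_self, edgeRep_self] at he
    exact Prod.ext he.1 he.2
  have hsame : ∀ (e e' : AmalgamEdge 2 2 4) (b b' : Bool), (rungEdge e ↔ rungEdge e') →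
      ¬ Cornered (foldD commutatorWord commutatorWord 0 0 e b)
        (foldD commutatorWord commutatorWord 0 0 e' b') := fun e e' b b' h =>
    (folded_isVH commutatorWord commutatorWord 0 0).not_cornered_of_same h
  intro v D hD α β
  obtain ⟨v, rfl⟩ := exists_foldV commutatorWord commutatorWord 0 0 v
  cases v with
  | left =>
    refine key 8 left leftLink ?_ ?_ ?_ ?_ D hD α β
    · intro a; fin_cases a <;> rfl
    · intro a
      fin_cases a <;> first
        | exact (cornered_rung₁_true _ _ _).2 (by simp [leftLink, commutatorWord])
        | exact ((cornered_rung₁_true _ _ _).2 (by simp [leftLink, commutatorWord])).symm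
    · intro a b h₁ h₂ h₃
      fin_cases a <;> fin_cases b <;> first
        | (exfalso; revert h₁ h₂ h₃; decide)
        | exact ⟨by simp [leftLink], hsame _ _ _ _ Iff.rfl⟩
        | exact ⟨by simp [leftLink], fun h => absurd ((cornered_rung₁_true _ _ _).1 h)
            (by simp [leftLink, commutatorWord])⟩
        | exact ⟨by simp [leftLink], fun h => absurd ((cornered_rung₁_true _ _ _).1 h.symm)
            (by simp [leftLink, commutatorWord])⟩
    · intro e b h
      cases e with
      | petal₁ a =>
        fin_cases a <;> cases b
        exacts [⟨4, rfl⟩, ⟨0, rfl⟩, ⟨6, rfl⟩, ⟨2, rfl⟩]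
      | rung₁ k =>
        cases b
        · exact absurd h (by simp [amalgamComplex])
        · fin_cases k
          exacts [⟨1, rfl⟩, ⟨3, rfl⟩, ⟨5, rfl⟩, ⟨7, rfl⟩]
      | _ => cases b <;> exact absurd h (by simp [amalgamComplex])
  | right =>
    refine key 8 right rightLink ?_ ?_ ?_ ?_ D hD α β
    · intro a; fin_cases a <;> rfl
    · intro a
      fin_cases a <;> first
        | exact (cornered_rung₂_false _ _ _).2 (by simp [rightLink, commutatorWord])
        | exact ((cornered_rung₂_false _ _ _).2 (by simp [rightLink, commutatorWord])).symm
    · intro a b h₁ h₂ h₃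
      fin_cases a <;> fin_cases b <;> first
        | (exfalso; revert h₁ h₂ h₃; decide)
        | exact ⟨by simp [rightLink], hsame _ _ _ _ Iff.rfl⟩
        | exact ⟨by simp [rightLink], fun h => absurd ((cornered_rung₂_false _ _ _).1 h)
            (by simp [rightLink, commutatorWord])⟩
        | exact ⟨by simp [rightLink], fun h => absurd ((cornered_rung₂_false _ _ _).1 h.symm)
            (by simp [rightLink, commutatorWord])⟩
    · intro e b h
      cases e with
      | petal₂ a =>
        fin_cases a <;> cases b
        exacts [⟨4, rfl⟩, ⟨0, rfl⟩, ⟨6, rfl⟩, ⟨2, rfl⟩]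
      | rung₂ k =>
        cases b
        · fin_cases k
          exacts [⟨1, rfl⟩, ⟨3, rfl⟩, ⟨5, rfl⟩, ⟨7, rfl⟩]
        · exact absurd h (by simp [amalgamComplex])
      | _ => cases b <;> exact absurd h (by simp [amalgamComplex])
  | mid k =>
    refine key 4 (mid k) (midLink k) ?_ ?_ ?_ ?_ D hD α β
    · intro a
      rw [dsrc_foldD]
      fin_cases a <;> simp [midLink, amalgamComplex]
    · intro a
      fin_cases a
      · exact (cornered_rung₁_false _ _ _).2 (Or.inl ⟨rfl, rfl⟩)
      · exact ((cornered_rung₂_true _ _ _).2 (Or.inl ⟨rfl, rfl⟩)).symm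
      · exact (cornered_rung₂_true _ _ _).2 (Or.inr ⟨rfl, rfl⟩)
      · exact ((cornered_rung₁_false _ _ _).2 (Or.inr ⟨rfl, rfl⟩)).symm
    · intro a b h₁ h₂ h₃
      fin_cases a <;> fin_cases b <;> first
        | (exfalso; revert h₁ h₂ h₃; decide)
        | exact ⟨by simp [midLink], hsame _ _ _ _ Iff.rfl⟩
    · intro e b h
      cases e <;> cases b <;> simp [amalgamComplex] at h
      · exact ⟨0, by rw [← h]; rfl⟩
      · exact ⟨2, by rw [← h]; rfl⟩
      · exact ⟨3, congrArg (fun l => (core l, false)) (by rw [← h, add_sub_cancel_right])⟩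
      · exact ⟨1, by rw [← h]; rfl⟩

theorem commutator_foldingWords : FoldingWords commutatorWord commutatorWord 0 0 where
  red₁ := by decide
  red₂ := by decide
  disjoint := Or.inl rfl

theorem commutator_isOneEndedGroup :
    IsOneEndedGroup (CyclicAmalgam commutatorWord commutatorWord) := by
  set x := foldedBase commutatorWord commutatorWord 0 0
  have hZ := (folded_isVH commutatorWord commutatorWord 0 0).isCAT0VH
    commutator_foldingWords.nonpositivelyCurved (x := x)
  have : Infinite ((foldedComplex commutatorWord commutatorWord 0 0).universalCover x).V := by
    -- a core line is an embedded ray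
    let ρ := lift (coverBase _ x) (foldD commutatorWord commutatorWord 0 0 (rung₁ 0) true) rfl
    obtain ⟨D, -, hD⟩ := exists_isCoreRay (fun n => (0 : Fin 4) + Fin.ofNat 4 n)
      (fun n => by rw [add_ofNat_succ]) (dtgt ρ)
      ((dtgt_projD ρ).symm.trans (congrArg dtgt (projD_lift _ _ _)))
    exact Infinite.of_injective _ (hZ.straight_injective hD.isStraight)
  exact (foldedDevelopment commutatorWord commutatorWord 0 0).isOneEndedGroup
    (hZ.connectedAtInfinity_of_links universalCover_locallyFinite
      commutator_puncturedLinksConnected.universalCover)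

theorem commutator_foldingData : FoldingData commutatorWord commutatorWord 0 2 where
  reduced₁ := by
    simp [FreeGroup.IsCyclicallyReduced, FreeGroup.IsReduced, commutatorWord, List.ofFn_succ]
  reduced₂ := by
    simp [FreeGroup.IsCyclicallyReduced, FreeGroup.IsReduced, commutatorWord, List.ofFn_succ]
  oneEnded := commutator_isOneEndedGroup
  ne := by decide
  disjoint := by
    rw [Set.disjoint_left]
    intro d h₁ h₂
    simp only [rowLetters, Set.mem_insert_iff, Set.mem_singleton_iff] at h₁ h₂
    revert d
    decide

end Folded

theorem proposition6p1 :
    (∀ (m n L : ℕ) [NeZero L] (w₁ : Fin L → Fin m × Bool) (w₂ : Fin L → Fin n × Bool)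
      (i j : Fin L), FoldingData w₁ w₂ i j →
      (foldedComplex w₁ w₂ i j).NonpositivelyCurved ∧
      ((foldedComplex w₁ w₂ i j).universalCover (foldedBase w₁ w₂ i j)).IsCAT0 ∧
      ((foldedComplex w₁ w₂ i j).universalCover (foldedBase w₁ w₂ i j)).Essential ∧
      (∃ h : Set ((foldedComplex w₁ w₂ i j).universalCover (foldedBase w₁ w₂ i j)).V,
        SquareComplex.IsHalfspace h ∧
        (((foldedComplex w₁ w₂ i j).universalCover
          (foldedBase w₁ w₂ i j)).skeleton.induce h).InfiniteEnded) ∧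
      ((foldedComplex w₁ w₂ i j).universalCover (foldedBase w₁ w₂ i j)).LocallyFinite ∧
      ((foldedComplex w₁ w₂ i j).universalCover (foldedBase w₁ w₂ i j)).skeleton.OneEnded ∧
      ∃ A : SquareComplex.CellularAction (CyclicAmalgam w₁ w₂)
          ((foldedComplex w₁ w₂ i j).universalCover (foldedBase w₁ w₂ i j)),
        A.IsDeckAction ∧ A.Proper ∧ A.Cocompact) ∧
    (∃ (m n L : ℕ) (_ : NeZero L) (w₁ : Fin L → Fin m × Bool) (w₂ : Fin L → Fin n × Bool)
      (i j : Fin L), FoldingData w₁ w₂ i j) := by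
  refine ⟨?_, 2, 2, 4, inferInstance, commutatorWord, commutatorWord, 0, 2,
    commutator_foldingData⟩
  intro m n L _ w₁ w₂ i j h
  have hnpc := h.foldingWords.nonpositivelyCurved
  have hZ := (folded_isVH w₁ w₂ i j).isCAT0VH hnpc (x := foldedBase w₁ w₂ i j)
  have hfin : ((foldedComplex w₁ w₂ i j).universalCover (foldedBase w₁ w₂ i j)).LocallyFinite :=
    SquareComplex.universalCover_locallyFinite
  have hend := (foldedDevelopment w₁ w₂ i j).connectedAtInfinity hfin h.oneEnded
  have := (foldedDevelopment w₁ w₂ i j).infinite h.oneEnded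
  have hL : 2 ≤ L := by
    have := i.2
    have := j.2
    have := Fin.val_ne_iff.2 h.ne
    omega
  refine ⟨hnpc, ⟨hZ.simplyConnected, hZ.npc⟩, hZ.essential ?_,
    exists_infiniteEnded_halfspace h.ne hZ, hfin,
    hend.oneEnded hfin.neighborSet_finite hZ.simplyConnected.1.preconnected,
    (foldedDevelopment w₁ w₂ i j).action, (foldedDevelopment w₁ w₂ i j).isDeckAction,
    (foldedDevelopment w₁ w₂ i j).proper, (foldedDevelopment w₁ w₂ i j).cocompact⟩
  exact (folded_extendable hL (exists_straight_partner h.ne hZ hend)).universalCover
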